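/- All objects are real and of class $C^\infty$, and the plane is $\mathbb{R}^2$. A planar $d$-web on an open set $U\subset\mathbb{R}^2$ is given by $d$ smooth $1$-forms $\omega_1,\dots,\omega_d$ on $U$ with $\omega_i\wedge\omega_j\neq 0$ at every point for $i\ne j$; its leaves are the leaves of the $d$ foliations $\omega_i=0$. The web is linearizable if near every point of $U$ there is a local diffeomorphism of the plane sending all leaves into straight lines. It is geodesic with respect to a torsion-free connection $\nabla$ if all its leaves are (unparametrized) geodesics of $\nabla$; two torsion-free connections are projectively equivalent if they have the same unparametrized geodesics, and a projective structure is an equivalence class. For a planar $4$-web normalize the forms so that $\omega_1+\omega_2+\omega_3=0$ and $a\omega_1+\omega_2+\omega_4=0$, let $\partial_1,\partial_2$ be the frame dual to $\omega_1,\omega_2$, $a_i=\partial_i(a)$ and $z=\frac{a_1-a a_2}{a(1-a)}$. The canonical projective structure of the $4$-web is the class of the torsion-free connection $\nabla$ whose symmetrized covariant differential $d^s_\nabla$ satisfies $d_\nabla^s\omega_1=\frac z2\,\omega_3\cdot\omega_1$, $d_\nabla^s\omega_2=-\frac z2\,\omega_3\cdot\omega_2$. For a representative $\nabla$, with $Ric(Y,Z)=\operatorname{tr}(X\mapsto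 R(X,Y)Z)$, put $\mathfrak{P}(X,Y)=\frac23Ric(X,Y)+\frac13Ric(Y,X)$; the Liouville tensor of the $4$-web is $\mathfrak{L}(X,Y,Z)=(\nabla_X\mathfrak{P})(Y,Z)-(\nabla_Y\mathfrak{P})(X,Z)$. Theorem. Let $d\ge 4$. A planar $d$-web on $U$ is linearizable if and only if it is geodesic with respect to the canonical projective structure of one of its $4$-subwebs and the Liouville tensor of one of its $4$-subwebs vanishes on $U$. Moreover, let a $4$-subweb have web functions $x,y,f,g$ on an open set $V\subset U$ (smooth first integrals of its four foliations, in this order, with nonvanishing differentials), let subscripts $x,y$ denote partial derivatives in the local coordinates $x,y$, and put $$a=\frac{f_yg_x}{f_xg_y},\quad w=\frac{f_y}{f_x},\quad \alpha=\frac{a a_y-w a_x}{w a(1-a)},\quad k=(\log |w|)_{xy},\quad \omega_1=-f_x\,dx,\quad \omega_2=-f_y\,dy .$$ Then for every representative of the canonical projective structure of the subweb on $V$ the Liouville tensor is $$\mathfrak{L}=\frac{1}{f_x^2f_y}\Bigl(L_1\omega_1+\frac{L_2}{w}\omega_2\Bigr)\otimes\omega_1\wedge\omega_2,$$ where $(\theta\otimes\Omega)(X,Y,Z)=\theta(Z)\,\Omega(X,Y)$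 and $$\begin{aligned} 3L_1={}&-w^{-1}(kw)_x+w(\alpha_{xx}+\alpha\alpha_x)+\bigl(\alpha w_{xx}+(\alpha^2+3\alpha_x)w_x-2\alpha_{xy}-2\alpha\alpha_y\bigr)\\ &+w^{-1}\bigl(-\alpha w_{xy}-2\alpha_yw_x+\alpha w_x^2\bigr)+w^{-2}\alpha w_xw_y,\\ 3L_2={}&-w\,(kw^{-1})_y+2w^2\alpha\alpha_x+w\bigl(2\alpha^2w_x-2\alpha_{xy}-\alpha\alpha_y\bigr)\\ &+\bigl(-\alpha w_{xy}-2\alpha_yw_x+\alpha_{yy}\bigr)+w^{-1}\bigl(\alpha w_xw_y-\alpha_yw_y\bigr). \end{aligned}$$ -/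

import Mathlib

noncomputable section

namespace PlanarWeb

open Set

/-- The plane `ℝ²`, with standard coordinates `p 0`, `p 1`. -/
abbrev Plane : Type := Fin 2 → ℝ

/-- A differential `1`-form on the plane: `θ p j` is the coefficient of `dx_j` at `p`. -/
abbrev OneForm : Type := Plane → Fin 2 → ℝ

/-- An affine connection, by its Christoffel symbols:
`∇_{∂_i} ∂_j = ∑ k, Γ p k i j • ∂_k` at the point `p`. -/
abbrev Connection : Type := Plane → Fin 2 → Fin 2 → Fin 2 → ℝ

/-- The partial derivative `∂u/∂x_i` at `p`. -/
def pd (i : Fin 2) (u : Plane → ℝ) (p : Plane) : ℝ :=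
  fderiv ℝ u p (Pi.single i 1)

/-- The differential of a function. -/
def dif (u : Plane → ℝ) : OneForm := fun p i => pd i u p

/-- The value of a covector on a tangent vector. -/
def pairing (α v : Fin 2 → ℝ) : ℝ := ∑ j, α j * v j

/-- The coefficient of `α ∧ β` with respect to `dx_0 ∧ dx_1`. -/
def wedge (α β : Fin 2 → ℝ) : ℝ := α 0 * β 1 - α 1 * β 0

/-! ### Webs and their leaves -/

/-- The `1`-forms `θ i` define a `d`-web on `U`: they are smooth and the foliations
`θ i = 0` have pairwise distinct directions at each point of `U`. -/
structure IsWeb {d : ℕ} (θ : Fin d → OneForm) (U : Set Plane) : Prop where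
  smooth : ∀ i, ContDiffOn ℝ (⊤ : ℕ∞) (θ i) U
  generalPosition : ∀ p ∈ U, ∀ i j, i ≠ j → wedge (θ i p) (θ j p) ≠ 0

/-- A smooth regular arc in `U`, parametrized by the open interval `(a, b)`. -/
structure IsRegularArc (U : Set Plane) (c : ℝ → Plane) (a b : ℝ) : Prop where
  smooth : ContDiffOn ℝ (⊤ : ℕ∞) c (Ioo a b)
  mem : ∀ t ∈ Ioo a b, c t ∈ U
  regular : ∀ t ∈ Ioo a b, deriv c t ≠ 0

/-- A regular arc in `U` contained in a leaf of the foliation `θ = 0`. -/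
structure IsLeafArc (θ : OneForm) (U : Set Plane) (c : ℝ → Plane) (a b : ℝ) : Prop where
  arc : IsRegularArc U c a b
  tangent : ∀ t ∈ Ioo a b, pairing (θ (c t)) (deriv c t) = 0

/-- The web is (locally) linearizable: near every point of `U` there is a smooth local
diffeomorphism `φ` of the plane that sends the leaves of all foliations into straight lines. -/
def IsLinearizable {d : ℕ} (θ : Fin d → OneForm) (U : Set Plane) : Prop :=
  ∀ p ∈ U, ∃ φ : OpenPartialHomeomorph Plane Plane,
    p ∈ φ.source ∧ φ.source ⊆ U ∧
    ContDiffOn ℝ (⊤ : ℕ∞) φ φ.source ∧ ContDiffOn ℝ (⊤ : ℕ∞) φ.symm φ.target ∧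
    ∀ (i : Fin d) (c : ℝ → Plane) (a b : ℝ), IsLeafArc (θ i) φ.source c a b →
      Collinear ℝ ((fun t => φ (c t)) '' Ioo a b)

/-! ### Connections, geodesics, projective structures -/

/-- `Γ` is a smooth torsion-free connection on `U`. -/
structure IsTorsionFree (Γ : Connection) (U : Set Plane) : Prop where
  smooth : ContDiffOn ℝ (⊤ : ℕ∞) Γ U
  symm : ∀ p ∈ U, ∀ k i j, Γ p k i j = Γ p k j i

/-- The `k`-th component of the acceleration `∇_{c'} c'`. -/
def acceleration (Γ : Connection) (c : ℝ → Plane) (t : ℝ) : Fin 2 → ℝ := fun k =>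
  deriv (deriv c) t k + ∑ i, ∑ j, Γ (c t) k i j * deriv c t i * deriv c t j

/-- The arc `c` is a geodesic of `Γ`, up to reparametrization. -/
def IsGeodesicArc (Γ : Connection) (c : ℝ → Plane) (a b : ℝ) : Prop :=
  ∀ t ∈ Ioo a b, ∃ μ : ℝ, acceleration Γ c t = μ • deriv c t

/-- All leaves of the foliation `θ = 0` on `U` are geodesics of `Γ`. -/
def IsGeodesicFoliation (Γ : Connection) (θ : OneForm) (U : Set Plane) : Prop :=
  ∀ (c : ℝ → Plane) (a b : ℝ), IsLeafArc θ U c a b → IsGeodesicArc Γ c a b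

/-- Two connections are projectively equivalent on `U`: they have the same
(unparametrized) geodesics. -/
def ProjEquiv (U : Set Plane) (Γ Γ' : Connection) : Prop :=
  ∀ (c : ℝ → Plane) (a b : ℝ), IsRegularArc U c a b →
    (IsGeodesicArc Γ c a b ↔ IsGeodesicArc Γ' c a b)

/-- The projective structure on `U` defined by `Γ`: all smooth torsion-free connections on `U`
that are projectively equivalent to `Γ`. -/
def projectiveClass (U : Set Plane) (Γ : Connection) : Set Connection :=
  {Γ' | IsTorsionFree Γ' U ∧ ProjEquiv U Γ' Γ}

/-- The web is geodesic on `U` with respect to the projective structure `S`: all leaves of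
all foliations are geodesics of a representative of `S` (hence of all representatives). -/
def IsGeodesicWeb {d : ℕ} (S : Set Connection) (θ : Fin d → OneForm) (U : Set Plane) : Prop :=
  ∃ Γ ∈ S, ∀ i, IsGeodesicFoliation Γ (θ i) U

/-! ### The canonical projective structure of a 4-web -/

/-- The normalization of the first three forms of a web: nonvanishing multiples
of `θ 0`, `θ 1`, `θ 2` whose sum is zero (see `normalized_add`). -/
def normalized (θ : Fin 4 → OneForm) : Fin 3 → OneForm := fun i p =>
  ![wedge (θ 1 p) (θ 2 p) • θ 0 p,
    wedge (θ 2 p) (θ 0 p) • θ 1 p,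
    wedge (θ 0 p) (θ 1 p) • θ 2 p] i

theorem normalized_add (θ : Fin 4 → OneForm) (p : Plane) :
    normalized θ 0 p + normalized θ 1 p + normalized θ 2 p = 0 := by
  funext j
  fin_cases j <;> simp [normalized, wedge] <;> ring

/-- The basic invariant `a` of a 4-web, defined by the requirement that
`a ω₁ + ω₂` is a multiple of the fourth form, where `ω₁, ω₂` are the normalized forms. -/
def basicInvariant (θ : Fin 4 → OneForm) (p : Plane) : ℝ :=
  -(wedge (normalized θ 1 p) (θ 3 p) / wedge (normalized θ 0 p) (θ 3 p))

/-- The frame `∂₁, ∂₂` (indices `0`, `1`) dual to the normalized forms `ω₁, ω₂`. -/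
def dualFrame (θ : Fin 4 → OneForm) (p : Plane) : Fin 2 → (Fin 2 → ℝ) :=
  let ω₁ := normalized θ 0 p
  let ω₂ := normalized θ 1 p
  ![(wedge ω₁ ω₂)⁻¹ • ![ω₂ 1, -ω₂ 0], (wedge ω₁ ω₂)⁻¹ • ![-ω₁ 1, ω₁ 0]]

/-- The function `z = (a₁ - a a₂) / (a (1 - a))`, where `a_i = ∂_i a`. -/
def zFun (θ : Fin 4 → OneForm) (p : Plane) : ℝ :=
  let a := basicInvariant θ p
  let da := dif (basicInvariant θ) p
  (pairing da (dualFrame θ p 0) - a * pairing da (dualFrame θ p 1)) / (a * (1 - a))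

/-- The symmetric product of two covectors. -/
def symProd (α β : Fin 2 → ℝ) (i j : Fin 2) : ℝ := (α i * β j + α j * β i) / 2

/-- The values `σ₁ = (z/2) ω₃ · ω₁` and `σ₂ = -(z/2) ω₃ · ω₂` prescribed for the symmetric
differentials of `ω₁` and `ω₂`. -/
def prescribedSymDiff (θ : Fin 4 → OneForm) (p : Plane) : Fin 2 → Fin 2 → Fin 2 → ℝ :=
  ![fun i j => zFun θ p / 2 * symProd (normalized θ 2 p) (normalized θ 0 p) i j,
    fun i j => -(zFun θ p / 2) * symProd (normalized θ 2 p) (normalized θ 1 p) i j]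

/-- The symmetric differential of a `1`-form with respect to a connection, i.e.
the symmetric part of `∇θ`. -/
def symDiff (Γ : Connection) (θ : OneForm) (p : Plane) (i j : Fin 2) : ℝ :=
  ((pd i (fun q => θ q j) p - ∑ k, Γ p k i j * θ p k) +
    (pd j (fun q => θ q i) p - ∑ k, Γ p k j i * θ p k)) / 2

/-- The torsion-free connection with `d^s ω₁ = (z/2) ω₃ · ω₁` and `d^s ω₂ = -(z/2) ω₃ · ω₂`
(see `symDiff_canonicalConnection`). Multiplying `ω₁, ω₂, ω₃` by a common nonvanishing function
only changes this connection within its projective class. -/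
def canonicalConnection (θ : Fin 4 → OneForm) : Connection := fun p k i j =>
  (((pd i (fun q => normalized θ 0 q j) p + pd j (fun q => normalized θ 0 q i) p) / 2
      - prescribedSymDiff θ p 0 i j) * dualFrame θ p 0 k) +
  (((pd i (fun q => normalized θ 1 q j) p + pd j (fun q => normalized θ 1 q i) p) / 2
      - prescribedSymDiff θ p 1 i j) * dualFrame θ p 1 k)

/-- The canonical projective structure of a 4-web on `U`. -/
def canonicalProjectiveStructure (θ : Fin 4 → OneForm) (U : Set Plane) : Set Connection :=
  projectiveClass U (canonicalConnection θ)

theorem wedge_normalized_ne_zero {θ : Fin 4 → OneForm} {U : Set Plane} (hθ : IsWeb θ U)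
    {p : Plane} (hp : p ∈ U) : wedge (normalized θ 0 p) (normalized θ 1 p) ≠ 0 := by
  have h01 := hθ.generalPosition p hp 0 1 (by decide)
  have h12 := hθ.generalPosition p hp 1 2 (by decide)
  have h20 := hθ.generalPosition p hp 2 0 (by decide)
  have : wedge (normalized θ 0 p) (normalized θ 1 p) =
      wedge (θ 1 p) (θ 2 p) * wedge (θ 2 p) (θ 0 p) * wedge (θ 0 p) (θ 1 p) := by
    simp [normalized, wedge]; ring
  rw [this]
  exact mul_ne_zero (mul_ne_zero h12 h20) h01

theorem canonicalConnection_symm (θ : Fin 4 → OneForm) (p : Plane) (k i j : Fin 2) :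
    canonicalConnection θ p k i j = canonicalConnection θ p k j i := by
  simp [canonicalConnection, prescribedSymDiff, symProd]; ring

/-- The canonical connection has the prescribed symmetric differentials. -/
theorem symDiff_canonicalConnection {θ : Fin 4 → OneForm} {U : Set Plane} (hθ : IsWeb θ U)
    {p : Plane} (hp : p ∈ U) (i j : Fin 2) :
    symDiff (canonicalConnection θ) (normalized θ 0) p i j =
        zFun θ p / 2 * symProd (normalized θ 2 p) (normalized θ 0 p) i j ∧
      symDiff (canonicalConnection θ) (normalized θ 1) p i j =
        -(zFun θ p / 2) * symProd (normalized θ 2 p) (normalized θ 1 p) i j := by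
  have hW := wedge_normalized_ne_zero hθ hp
  have e00 : dualFrame θ p 0 0 * normalized θ 0 p 0 +
      dualFrame θ p 0 1 * normalized θ 0 p 1 = 1 := by
    rw [← inv_mul_cancel₀ hW]; simp [dualFrame, wedge]; ring
  have e10 : dualFrame θ p 1 0 * normalized θ 0 p 0 +
      dualFrame θ p 1 1 * normalized θ 0 p 1 = 0 := by
    simp [dualFrame]; ring
  have e01 : dualFrame θ p 0 0 * normalized θ 1 p 0 +
      dualFrame θ p 0 1 * normalized θ 1 p 1 = 0 := by
    simp [dualFrame]; ring
  have e11 : dualFrame θ p 1 0 * normalized θ 1 p 0 +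
      dualFrame θ p 1 1 * normalized θ 1 p 1 = 1 := by
    rw [← inv_mul_cancel₀ hW]; simp [dualFrame, wedge]; ring
  have key : ∀ m, symDiff (canonicalConnection θ) (normalized θ m) p i j =
      (pd i (fun q => normalized θ m q j) p + pd j (fun q => normalized θ m q i) p) / 2
        - ∑ k, canonicalConnection θ p k i j * normalized θ m p k := by
    intro m
    have : ∑ k, canonicalConnection θ p k j i * normalized θ m p k =
        ∑ k, canonicalConnection θ p k i j * normalized θ m p k :=
      Finset.sum_congr rfl fun k _ => by rw [canonicalConnection_symm θ p k j i]
    unfold symDiff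
    rw [this]; ring
  constructor
  · rw [key, Fin.sum_univ_two]
    simp only [canonicalConnection]
    generalize hA : (pd i (fun q => normalized θ 0 q j) p +
      pd j (fun q => normalized θ 0 q i) p) / 2 = A
    generalize hB : (pd i (fun q => normalized θ 1 q j) p +
      pd j (fun q => normalized θ 1 q i) p) / 2 = B
    have : zFun θ p / 2 * symProd (normalized θ 2 p) (normalized θ 0 p) i j =
        prescribedSymDiff θ p 0 i j := rfl
    rw [this]
    linear_combination (-(A - prescribedSymDiff θ p 0 i j)) * e00 -
      (B - prescribedSymDiff θ p 1 i j) * e10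
  · rw [key, Fin.sum_univ_two]
    simp only [canonicalConnection]
    generalize hA : (pd i (fun q => normalized θ 0 q j) p +
      pd j (fun q => normalized θ 0 q i) p) / 2 = A
    generalize hB : (pd i (fun q => normalized θ 1 q j) p +
      pd j (fun q => normalized θ 1 q i) p) / 2 = B
    have : -(zFun θ p / 2) * symProd (normalized θ 2 p) (normalized θ 1 p) i j =
        prescribedSymDiff θ p 1 i j := rfl
    rw [this]
    linear_combination (-(A - prescribedSymDiff θ p 0 i j)) * e01 -
      (B - prescribedSymDiff θ p 1 i j) * e11

theorem contDiffOn_pd {U : Set Plane} (hU : IsOpen U) {u : Plane → ℝ}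
    (hu : ContDiffOn ℝ (⊤ : ℕ∞) u U) (i : Fin 2) :
    ContDiffOn ℝ (⊤ : ℕ∞) (pd i u) U :=
  (hu.fderiv_of_isOpen hU (by simp)).clm_apply contDiffOn_const

/-- The canonical connection is a smooth torsion-free connection, so that it is a
representative of the canonical projective structure. -/
theorem canonicalConnection_mem {θ : Fin 4 → OneForm} {U : Set Plane} (hU : IsOpen U)
    (hθ : IsWeb θ U) : canonicalConnection θ ∈ canonicalProjectiveStructure θ U := by
  refine ⟨⟨?_, fun p _ => canonicalConnection_symm θ p⟩, fun _ _ _ _ => Iff.rfl⟩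
  have hc : ∀ i j, ContDiffOn ℝ (⊤ : ℕ∞) (fun p => θ i p j) U := fun i j =>
    (contDiffOn_pi.1 (hθ.smooth i)) j
  have h0 : ∀ j, ContDiffOn ℝ (⊤ : ℕ∞) (fun p => normalized θ 0 p j) U := fun j => by
    simp only [normalized, wedge, Matrix.cons_val, Pi.smul_apply, smul_eq_mul]
    fun_prop
  have h1 : ∀ j, ContDiffOn ℝ (⊤ : ℕ∞) (fun p => normalized θ 1 p j) U := fun j => by
    simp only [normalized, wedge, Matrix.cons_val, Pi.smul_apply, smul_eq_mul]
    fun_prop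
  have h2 : ∀ j, ContDiffOn ℝ (⊤ : ℕ∞) (fun p => normalized θ 2 p j) U := fun j => by
    simp only [normalized, wedge, Matrix.cons_val, Pi.smul_apply, smul_eq_mul]
    fun_prop
  have hW : ContDiffOn ℝ (⊤ : ℕ∞)
      (fun p => (wedge (normalized θ 0 p) (normalized θ 1 p))⁻¹) U := by
    refine ContDiffOn.inv ?_ fun p hp => wedge_normalized_ne_zero hθ hp
    simp only [wedge]
    fun_prop
  have hE0 : ∀ k, ContDiffOn ℝ (⊤ : ℕ∞) (fun p => dualFrame θ p 0 k) U := fun k => by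
    fin_cases k <;> simp only [dualFrame, Matrix.cons_val, Pi.smul_apply, smul_eq_mul,
      Fin.zero_eta, Fin.mk_one] <;> fun_prop
  have hE1 : ∀ k, ContDiffOn ℝ (⊤ : ℕ∞) (fun p => dualFrame θ p 1 k) U := fun k => by
    fin_cases k <;> simp only [dualFrame, Matrix.cons_val, Pi.smul_apply, smul_eq_mul,
      Fin.zero_eta, Fin.mk_one] <;> fun_prop
  have hE : ∀ i j, i ≠ j → ∀ p ∈ U, wedge (θ i p) (θ j p) ≠ 0 := fun i j hij p hp =>
    hθ.generalPosition p hp i j hij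
  have w0 : ∀ p ∈ U, wedge (normalized θ 0 p) (θ 3 p) ≠ 0 := fun p hp => by
    have : wedge (normalized θ 0 p) (θ 3 p) =
        wedge (θ 1 p) (θ 2 p) * wedge (θ 0 p) (θ 3 p) := by
      simp [normalized, wedge]; ring
    rw [this]
    exact mul_ne_zero (hE 1 2 (by decide) p hp) (hE 0 3 (by decide) p hp)
  have w1 : ∀ p ∈ U, wedge (normalized θ 1 p) (θ 3 p) ≠ 0 := fun p hp => by
    have : wedge (normalized θ 1 p) (θ 3 p) =
        wedge (θ 2 p) (θ 0 p) * wedge (θ 1 p) (θ 3 p) := by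
      simp [normalized, wedge]; ring
    rw [this]
    exact mul_ne_zero (hE 2 0 (by decide) p hp) (hE 1 3 (by decide) p hp)
  have w2 : ∀ p ∈ U, wedge (normalized θ 2 p) (θ 3 p) ≠ 0 := fun p hp => by
    have : wedge (normalized θ 2 p) (θ 3 p) =
        wedge (θ 0 p) (θ 1 p) * wedge (θ 2 p) (θ 3 p) := by
      simp [normalized, wedge]; ring
    rw [this]
    exact mul_ne_zero (hE 0 1 (by decide) p hp) (hE 2 3 (by decide) p hp)
  have ha : ContDiffOn ℝ (⊤ : ℕ∞) (basicInvariant θ) U := by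
    refine (ContDiffOn.div ?_ ?_ w0).neg <;> simp only [wedge] <;> fun_prop
  have ha0 : ∀ p ∈ U, basicInvariant θ p ≠ 0 := fun p hp =>
    neg_ne_zero.2 (div_ne_zero (w1 p hp) (w0 p hp))
  have ha1 : ∀ p ∈ U, 1 - basicInvariant θ p ≠ 0 := fun p hp => by
    have h : normalized θ 2 p = -(normalized θ 0 p + normalized θ 1 p) := by
      rw [eq_neg_iff_add_eq_zero, add_comm]; exact normalized_add θ p
    have hs : wedge (normalized θ 0 p) (θ 3 p) * (1 - basicInvariant θ p) =
        -wedge (normalized θ 2 p) (θ 3 p) := by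
      have : wedge (normalized θ 0 p) (θ 3 p) * (1 - basicInvariant θ p) =
          wedge (normalized θ 0 p) (θ 3 p) + wedge (normalized θ 1 p) (θ 3 p) := by
        unfold basicInvariant
        field_simp [w0 p hp]
        ring
      rw [this, h]; simp [wedge]; ring
    intro h0
    rw [h0, mul_zero] at hs
    exact w2 p hp (neg_eq_zero.1 hs.symm)
  have hda : ∀ i, ContDiffOn ℝ (⊤ : ℕ∞) (fun p => dif (basicInvariant θ) p i) U := fun i =>
    contDiffOn_pd hU ha i
  have hz : ContDiffOn ℝ (⊤ : ℕ∞) (zFun θ) U := by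
    refine ContDiffOn.div ?_ ?_ fun p hp => mul_ne_zero (ha0 p hp) (ha1 p hp)
    · simp only [pairing, Fin.sum_univ_two]
      fun_prop
    · fun_prop
  refine contDiffOn_pi.2 fun k => contDiffOn_pi.2 fun i => contDiffOn_pi.2 fun j => ?_
  have q0 := fun i j => contDiffOn_pd hU (h0 j) i
  have q1 := fun i j => contDiffOn_pd hU (h1 j) i
  have q00 := q0 i j
  have q01 := q0 j i
  have q10 := q1 i j
  have q11 := q1 j i
  simp only [canonicalConnection, prescribedSymDiff, symProd, Matrix.cons_val]
  refine ((((q00.add q01).div_const 2).sub ?_).mul (hE0 k)).add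
    ((((q10.add q11).div_const 2).sub ?_).mul (hE1 k)) <;> fun_prop

/-! ### The Liouville tensor -/

/-- The curvature `R(∂_i, ∂_j) ∂_k = ∑ l, curvature Γ l k i j • ∂_l`. -/
def curvature (Γ : Connection) (l k i j : Fin 2) (p : Plane) : ℝ :=
  pd i (fun q => Γ q l j k) p - pd j (fun q => Γ q l i k) p
    + ∑ m, (Γ p l i m * Γ p m j k - Γ p l j m * Γ p m i k)

/-- The Ricci tensor `Ric(Y, Z) = tr (X ↦ R(X, Y) Z)`. -/
def ricci (Γ : Connection) (j k : Fin 2) (p : Plane) : ℝ :=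
  ∑ i, curvature Γ i k i j p

/-- `𝔓(X, Y) = (2/3) Ric(X, Y) + (1/3) Ric(Y, X)`. -/
def pTensor (Γ : Connection) (i j : Fin 2) (p : Plane) : ℝ :=
  2 / 3 * ricci Γ i j p + 1 / 3 * ricci Γ j i p

/-- The covariant derivative `(∇_{∂_i} 𝔓)(∂_j, ∂_k)`. -/
def covDerivP (Γ : Connection) (i j k : Fin 2) (p : Plane) : ℝ :=
  pd i (pTensor Γ j k) p
    - ∑ m, (Γ p m i j * pTensor Γ m k p + Γ p m i k * pTensor Γ j m p)

/-- The Liouville tensor of a connection,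
`𝔏(∂_i, ∂_j, ∂_k) = (∇_{∂_i} 𝔓)(∂_j, ∂_k) - (∇_{∂_j} 𝔓)(∂_i, ∂_k)`. -/
def liouville (Γ : Connection) (i j k : Fin 2) (p : Plane) : ℝ :=
  covDerivP Γ i j k p - covDerivP Γ j i k p

/-- The Liouville tensor of a 4-web: that of its canonical projective structure. -/
def webLiouville (θ : Fin 4 → OneForm) (i j k : Fin 2) (p : Plane) : ℝ :=
  liouville (canonicalConnection θ) i j k p

/-! ### The explicit invariants, in local coordinates adapted to the web -/

/-- `u` is a web function (first integral with nonvanishing differential) on `V`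
of the foliation `θ = 0`. -/
structure IsWebFunction (θ : OneForm) (u : Plane → ℝ) (V : Set Plane) : Prop where
  smooth : ContDiffOn ℝ (⊤ : ℕ∞) u V
  ne_zero : ∀ p ∈ V, dif u p ≠ 0
  wedge_eq_zero : ∀ p ∈ V, wedge (θ p) (dif u p) = 0

/-- The partial derivative `u_x` in the local coordinates `x, y`:
`du ∧ dy = u_x dx ∧ dy`. -/
def cx (x y u : Plane → ℝ) (p : Plane) : ℝ :=
  wedge (dif u p) (dif y p) / wedge (dif x p) (dif y p)

/-- The partial derivative `u_y` in the local coordinates `x, y`: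
`dx ∧ du = u_y dx ∧ dy`. -/
def cy (x y u : Plane → ℝ) (p : Plane) : ℝ :=
  wedge (dif x p) (dif u p) / wedge (dif x p) (dif y p)

/-- `w = f_y / f_x`. -/
def wInv (x y f : Plane → ℝ) (p : Plane) : ℝ := cy x y f p / cx x y f p

/-- `a = f_y g_x / (f_x g_y)`. -/
def aInv (x y f g : Plane → ℝ) (p : Plane) : ℝ :=
  cy x y f p * cx x y g p / (cx x y f p * cy x y g p)

/-- `α = (a a_y - w a_x) / (w a (1 - a))`. -/
def alphaInv (x y f g : Plane → ℝ) (p : Plane) : ℝ :=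
  let a := aInv x y f g
  let w := wInv x y f
  (a p * cy x y a p - w p * cx x y a p) / (w p * a p * (1 - a p))

/-- `k = (log w)_{xy} = (w_x / w)_y`, which makes sense for `w` of either sign. -/
def kInv (x y f : Plane → ℝ) (p : Plane) : ℝ :=
  cy x y (fun q => cx x y (wInv x y f) q / wInv x y f q) p

/-- The relative invariant `L₁`. -/
def liouvilleL1 (x y f g : Plane → ℝ) (p : Plane) : ℝ :=
  let w := wInv x y f
  let α := alphaInv x y f g
  let k := kInv x y f
  (1 / 3) *
    (-(w p)⁻¹ * cx x y (fun q => k q * w q) p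
      + w p * (cx x y (cx x y α) p + α p * cx x y α p)
      + (α p * cx x y (cx x y w) p + (α p ^ 2 + 3 * cx x y α p) * cx x y w p
          - 2 * cy x y (cx x y α) p - 2 * α p * cy x y α p)
      + (w p)⁻¹ * (-α p * cy x y (cx x y w) p - 2 * cy x y α p * cx x y w p
          + α p * cx x y w p ^ 2)
      + (w p ^ 2)⁻¹ * (α p * cx x y w p * cy x y w p))

/-- The relative invariant `L₂`. -/
def liouvilleL2 (x y f g : Plane → ℝ) (p : Plane) : ℝ :=
  let w := wInv x y f
  let α := alphaInv x y f g
  let k := kInv x y f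
  (1 / 3) *
    (-w p * cy x y (fun q => k q * (w q)⁻¹) p
      + w p ^ 2 * (2 * α p * cx x y α p)
      + w p * (2 * α p ^ 2 * cx x y w p - 2 * cy x y (cx x y α) p - α p * cy x y α p)
      + (-α p * cy x y (cx x y w) p - 2 * cy x y α p * cx x y w p + cy x y (cy x y α) p)
      + (w p)⁻¹ * (α p * cx x y w p * cy x y w p - cy x y α p * cy x y w p))

end PlanarWeb

end

open PlanarWeb

/-! For a foliation given by θ, being geodesic for Γ is a pointwise condition: the function
`leafCurvature`, the value of ∇θ on the square of a tangent vector, must vanish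
(`isGeodesicFoliation_iff`). For two torsion-free connections the difference of these functions is a
binary cubic form evaluated at the direction of the leaf, and its four coefficients measure exactly
the failure of projective equivalence. Four distinct directions kill a binary cubic, so at most one
projective structure makes a given 4-web geodesic (`projRel_of_leafCurvature_eq_zero`). The
canonical connection does make it geodesic (`canonicalConnection_isGeodesic`), so the canonical
structure is this unique one. The Liouville tensor depends only on the projective class
(`liouville_projRel`).

If the web is linearizable, pulling back the flat connection of the plane gives, near each point, a
connection with zero Liouville tensor for which all leaves are geodesic. By uniqueness it is
projectively the canonical connection of every 4-subweb, whence both conditions.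

Conversely, suppose that all foliations are geodesic for a structure with zero Liouville tensor. In
the trace-free representative, the equation ∇∇σ + 𝔓σ = 0 prolongs to a linear system of rank three
for (σ, dσ). In dimension two the Liouville tensor is the only obstruction to flatness of this
system (`tractorCoeff_flat`), so there are three independent local solutions, and two of their
ratios are coordinates in which geodesics are straight (`exists_flat_coordinates`). The Frobenius
theorem used here, `exists_parallel_section`, is proved by solving along rays and comparing
neighbouring rays with Grönwall's inequality.

For the explicit formula, uniqueness allows Γ to be replaced by the connection with ∇dx = -P dx⊗dx
and ∇dy = -Q dy⊗dy, where P and Q are fixed by requiring the leaves of f and g to be geodesic. Its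
Liouville tensor is short to compute (`IsDiagonal.liouville_eq`), and substituting P and Q gives L₁
and L₂ (`liouville_formula`). -/

noncomputable section

namespace PlanarWeb

open Set Filter Topology

/-! ### Calculus of partial derivatives -/

theorem pd_add {u v : Plane → ℝ} {p : Plane} (i : Fin 2) (hu : DifferentiableAt ℝ u p)
    (hv : DifferentiableAt ℝ v p) : pd i (fun q => u q + v q) p = pd i u p + pd i v p := by
  simp [pd, fderiv_fun_add hu hv]

theorem pd_sub {u v : Plane → ℝ} {p : Plane} (i : Fin 2) (hu : DifferentiableAt ℝ u p)
    (hv : DifferentiableAt ℝ v p) : pd i (fun q => u q - v q) p = pd i u p - pd i v p := by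
  simp [pd, fderiv_fun_sub hu hv]

theorem pd_neg (u : Plane → ℝ) (p : Plane) (i : Fin 2) :
    pd i (fun q => -u q) p = -pd i u p := by
  simp [pd, fderiv_fun_neg]

theorem pd_const (c : ℝ) (p : Plane) (i : Fin 2) : pd i (fun _ => c) p = 0 := by
  simp [pd]

theorem pd_mul {u v : Plane → ℝ} {p : Plane} (i : Fin 2) (hu : DifferentiableAt ℝ u p)
    (hv : DifferentiableAt ℝ v p) :
    pd i (fun q => u q * v q) p = pd i u p * v p + u p * pd i v p := by
  simp [pd, fderiv_fun_mul hu hv]; ring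

theorem pd_const_mul {v : Plane → ℝ} {p : Plane} (i : Fin 2) (c : ℝ)
    (hv : DifferentiableAt ℝ v p) : pd i (fun q => c * v q) p = c * pd i v p := by
  rw [pd_mul i (differentiableAt_const c) hv, pd_const]; ring

theorem pd_inv {u : Plane → ℝ} {p : Plane} (i : Fin 2) (hu : DifferentiableAt ℝ u p)
    (h0 : u p ≠ 0) : pd i (fun q => (u q)⁻¹) p = -pd i u p / u p ^ 2 := by
  have h := (hasDerivAt_inv h0).comp_hasFDerivAt p hu.hasFDerivAt
  have h' : HasFDerivAt (fun q => (u q)⁻¹) ((-(u p ^ 2)⁻¹) • fderiv ℝ u p) p := h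
  simp only [pd, h'.fderiv, smul_apply, smul_eq_mul]
  field_simp

theorem pd_div {u v : Plane → ℝ} {p : Plane} (i : Fin 2) (hu : DifferentiableAt ℝ u p)
    (hv : DifferentiableAt ℝ v p) (h0 : v p ≠ 0) :
    pd i (fun q => u q / v q) p = (pd i u p * v p - u p * pd i v p) / v p ^ 2 := by
  simp only [div_eq_mul_inv]
  rw [pd_mul i hu (hv.fun_inv h0), pd_inv i hv h0]
  field_simp
  ring

theorem pd_congr {U : Set Plane} (hU : IsOpen U) {u v : Plane → ℝ} (h : ∀ q ∈ U, u q = v q)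
    {p : Plane} (hp : p ∈ U) (i : Fin 2) : pd i u p = pd i v p := by
  have : u =ᶠ[𝓝 p] v := by
    filter_upwards [hU.mem_nhds hp] with q hq using h q hq
  simp [pd, this.fderiv_eq]

theorem diffAt {U : Set Plane} (hU : IsOpen U) {u : Plane → ℝ}
    (hu : ContDiffOn ℝ (⊤ : ℕ∞) u U) {p : Plane} (hp : p ∈ U) : DifferentiableAt ℝ u p :=
  (hu.contDiffAt (hU.mem_nhds hp)).differentiableAt (by simp)

theorem fderiv_apply_eq_sum (u : Plane → ℝ) (p v : Plane) :
    fderiv ℝ u p v = pd 0 u p * v 0 + pd 1 u p * v 1 := by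
  have : v = v 0 • (Pi.single 0 1 : Plane) + v 1 • (Pi.single 1 1 : Plane) := by
    funext i; fin_cases i <;> simp
  conv_lhs => rw [this]
  simp [pd]; ring

theorem pd_comm {U : Set Plane} (hU : IsOpen U) {u : Plane → ℝ}
    (hu : ContDiffOn ℝ (⊤ : ℕ∞) u U) {p : Plane} (hp : p ∈ U) (i j : Fin 2) :
    pd i (pd j u) p = pd j (pd i u) p := by
  have hs : IsSymmSndFDerivAt ℝ u p :=
    (hu.contDiffAt (hU.mem_nhds hp)).isSymmSndFDerivAt
      (by simp; exact WithTop.coe_le_coe.2 (le_top : (2 : ℕ∞) ≤ ⊤))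
  have hd : DifferentiableAt ℝ (fderiv ℝ u) p :=
    ((hu.fderiv_of_isOpen (m := (⊤ : ℕ∞)) hU (by simp)).contDiffAt (hU.mem_nhds hp)).differentiableAt
      (by simp)
  have key : ∀ a b : Fin 2, pd a (pd b u) p =
      fderiv ℝ (fderiv ℝ u) p (Pi.single a 1) (Pi.single b 1) := by
    intro a b
    have h2 : HasFDerivAt (fun q => fderiv ℝ u q (Pi.single b 1))
        ((ContinuousLinearMap.apply ℝ ℝ (Pi.single b 1 : Plane)).comp (fderiv ℝ (fderiv ℝ u) p)) p :=
      (ContinuousLinearMap.apply ℝ ℝ (Pi.single b 1 : Plane)).hasFDerivAt.comp p hd.hasFDerivAt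
    change fderiv ℝ (fun q => fderiv ℝ u q (Pi.single b 1)) p (Pi.single a 1) = _
    rw [h2.fderiv]
    rfl
  rw [key, key, hs.eq]

/-! ### Projective change of connection and invariance of the Liouville tensor. -/

/-- Projective equivalence in terms of Christoffel symbols: the connections differ by the
symmetrized product of the identity with a smooth `1`-form. -/
def ProjRel (U : Set Plane) (Γ Γ' : Connection) : Prop :=
  ∃ Υ : Fin 2 → Plane → ℝ, (∀ i, ContDiffOn ℝ (⊤ : ℕ∞) (Υ i) U) ∧
    ∀ p ∈ U, ∀ k i j, Γ' p k i j =
      Γ p k i j + (if k = i then Υ j p else 0) + (if k = j then Υ i p else 0)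

theorem IsTorsionFree.contDiffOn_apply {Γ : Connection} {U : Set Plane} (h : IsTorsionFree Γ U)
    (k i j : Fin 2) : ContDiffOn ℝ (⊤ : ℕ∞) (fun p => Γ p k i j) U :=
  contDiffOn_pi.1 (contDiffOn_pi.1 (contDiffOn_pi.1 h.smooth k) i) j

theorem ProjRel.isTorsionFree {Γ Γ' : Connection} {U : Set Plane} (h : ProjRel U Γ Γ')
    (hΓ : IsTorsionFree Γ U) : IsTorsionFree Γ' U := by
  obtain ⟨Υ, hΥ, h⟩ := h
  refine ⟨?_, fun p hp k i j => ?_⟩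
  · refine contDiffOn_pi.2 fun k => contDiffOn_pi.2 fun i => contDiffOn_pi.2 fun j => ?_
    refine ContDiffOn.congr ?_ fun p hp => h p hp k i j
    refine ((hΓ.contDiffOn_apply k i j).add ?_).add ?_ <;> split_ifs
    exacts [hΥ j, contDiffOn_const, hΥ i, contDiffOn_const]
  · rw [h p hp, h p hp, hΓ.symm p hp k i j]; ring

theorem contDiffOn_curvature {Γ : Connection} {U : Set Plane} (hU : IsOpen U)
    (h : IsTorsionFree Γ U) (l k i j : Fin 2) :
    ContDiffOn ℝ (⊤ : ℕ∞) (curvature Γ l k i j) U := by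
  have h' := h.contDiffOn_apply
  refine ((contDiffOn_pd hU (h' l j k) i).sub (contDiffOn_pd hU (h' l i k) j)).add ?_
  exact ContDiffOn.sum fun m _ => ((h' l i m).mul (h' m j k)).sub ((h' l j m).mul (h' m i k))

theorem contDiffOn_pTensor {Γ : Connection} {U : Set Plane} (hU : IsOpen U)
    (h : IsTorsionFree Γ U) (i j : Fin 2) : ContDiffOn ℝ (⊤ : ℕ∞) (pTensor Γ i j) U := by
  have hr : ∀ a b, ContDiffOn ℝ (⊤ : ℕ∞) (ricci Γ a b) U := fun a b =>
    ContDiffOn.sum fun m _ => contDiffOn_curvature hU h m b m a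
  exact (contDiffOn_const.mul (hr i j)).add (contDiffOn_const.mul (hr j i))

theorem liouville_antisymm (Γ : Connection) (i j k : Fin 2) (p : Plane) :
    liouville Γ i j k p = -liouville Γ j i k p := by
  simp [liouville]

/-- The weights 2/3 and 1/3 in 𝔓 are the ones for which the change reads -∇Υ + Υ⊗Υ even when ∇Υ is
not symmetric; the Ricci tensor alone mixes ∇Υ with its transpose. -/
theorem pTensor_projRel {Γ Γ' : Connection} {U : Set Plane} (hU : IsOpen U)
    (hΓ : IsTorsionFree Γ U) {Υ : Fin 2 → Plane → ℝ}
    (hΥ : ∀ i, ContDiffOn ℝ (⊤ : ℕ∞) (Υ i) U)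
    (h : ∀ p ∈ U, ∀ k i j, Γ' p k i j =
      Γ p k i j + (if k = i then Υ j p else 0) + (if k = j then Υ i p else 0))
    {p : Plane} (hp : p ∈ U) (i j : Fin 2) :
    pTensor Γ' i j p = pTensor Γ i j p - (pd i (Υ j) p - ∑ m, Γ p m i j * Υ m p)
      + Υ i p * Υ j p := by
  have dΓ : ∀ k i j, DifferentiableAt ℝ (fun q => Γ q k i j) p := fun k i j =>
    diffAt hU (hΓ.contDiffOn_apply k i j) hp
  have dΥ : ∀ j, DifferentiableAt ℝ (Υ j) p := fun j => diffAt hU (hΥ j) hp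
  have hd : ∀ l k i j, pd l (fun q => Γ' q k i j) p = pd l (fun q => Γ q k i j) p +
      (if k = i then pd l (Υ j) p else 0) + (if k = j then pd l (Υ i) p else 0) := by
    intro l k i j
    rw [pd_congr hU (fun q hq => h q hq k i j) hp]
    split_ifs
    · rw [pd_add _ ((dΓ k i j).fun_add (dΥ j)) (dΥ i), pd_add _ (dΓ k i j) (dΥ j)]
    · simp only [add_zero]; rw [pd_add _ (dΓ k i j) (dΥ j)]
    · simp only [add_zero]; rw [pd_add _ (dΓ k i j) (dΥ i)]
    · simp only [add_zero]
  have hs : ∀ k, Γ p k 1 0 = Γ p k 0 1 := fun k => hΓ.symm p hp k 1 0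
  have hds : ∀ l k, pd l (fun q => Γ q k 1 0) p = pd l (fun q => Γ q k 0 1) p := fun l k =>
    pd_congr hU (fun q hq => hΓ.symm q hq k 1 0) hp l
  simp only [pTensor, ricci, curvature, Fin.sum_univ_two, hd, h p hp]
  fin_cases i <;> fin_cases j <;> simp [hs, hds] <;> ring

/-- In higher dimension the change would contain the Weyl curvature contracted with Υ; in dimension
two that curvature is zero. -/
theorem liouville_projRel {Γ Γ' : Connection} {U : Set Plane} (hU : IsOpen U)
    (hΓ : IsTorsionFree Γ U) (h : ProjRel U Γ Γ') {p : Plane} (hp : p ∈ U) (i j k : Fin 2) :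
    liouville Γ' i j k p = liouville Γ i j k p := by
  obtain ⟨Υ, hΥ, h⟩ := h
  have dΓ : ∀ k i j, DifferentiableAt ℝ (fun q => Γ q k i j) p := fun k i j =>
    diffAt hU (hΓ.contDiffOn_apply k i j) hp
  have dΥ : ∀ j, DifferentiableAt ℝ (Υ j) p := fun j => diffAt hU (hΥ j) hp
  have ddΥ : ∀ i j, DifferentiableAt ℝ (pd i (Υ j)) p := fun i j =>
    diffAt hU (contDiffOn_pd hU (hΥ j) i) hp
  have dP : ∀ i j, DifferentiableAt ℝ (pTensor Γ i j) p := fun i j =>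
    diffAt hU (contDiffOn_pTensor hU hΓ i j) hp
  have hs : ∀ k, Γ p k 1 0 = Γ p k 0 1 := fun k => hΓ.symm p hp k 1 0
  have hds : ∀ l k, pd l (fun q => Γ q k 1 0) p = pd l (fun q => Γ q k 0 1) p := fun l k =>
    pd_congr hU (fun q hq => hΓ.symm q hq k 1 0) hp l
  have hdP : ∀ l i j, pd l (pTensor Γ' i j) p = pd l (pTensor Γ i j) p
      - (pd l (pd i (Υ j)) p - ((pd l (fun q => Γ q 0 i j) p * Υ 0 p + Γ p 0 i j * pd l (Υ 0) p)
        + (pd l (fun q => Γ q 1 i j) p * Υ 1 p + Γ p 1 i j * pd l (Υ 1) p)))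
      + (pd l (Υ i) p * Υ j p + Υ i p * pd l (Υ j) p) := by
    intro l i j
    rw [pd_congr hU (fun q hq => pTensor_projRel hU hΓ hΥ h hq i j) hp]
    simp only [Fin.sum_univ_two]
    have a1 := (dΓ 0 i j).fun_mul (dΥ 0)
    have a2 := (dΓ 1 i j).fun_mul (dΥ 1)
    rw [pd_add _ ((dP i j).fun_sub ((ddΥ i j).fun_sub (a1.fun_add a2))) ((dΥ i).fun_mul (dΥ j)),
      pd_sub _ (dP i j) ((ddΥ i j).fun_sub (a1.fun_add a2)),
      pd_sub _ (ddΥ i j) (a1.fun_add a2), pd_add _ a1 a2, pd_mul _ (dΓ 0 i j) (dΥ 0),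
      pd_mul _ (dΓ 1 i j) (dΥ 1), pd_mul _ (dΥ i) (dΥ j)]
  have hc : ∀ j, pd 1 (pd 0 (Υ j)) p = pd 0 (pd 1 (Υ j)) p := fun j => pd_comm hU (hΥ j) hp 1 0
  have main : ∀ k, liouville Γ' 0 1 k p = liouville Γ 0 1 k p := by
    intro k
    simp only [liouville, covDerivP, hdP, pTensor_projRel hU hΓ hΥ h hp, Fin.sum_univ_two, h p hp]
    -- Skew-symmetrizing ∇∇Υ leaves the curvature acting on Υ. It cancels against the products of 𝔓
    -- and Υ only after 𝔓 is expanded, because the cancellation is the identity expressing the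
    -- curvature of a surface through 𝔓.
    simp only [pTensor, ricci, curvature, Fin.sum_univ_two]
    fin_cases k <;> simp [hs, hds, hc] <;> ring
  fin_cases i <;> fin_cases j
  · simp [liouville]
  · exact main k
  · simp only [Fin.mk_one, Fin.zero_eta]
    rw [liouville_antisymm, main k, ← liouville_antisymm]
  · simp [liouville]

/-! ### Connections given by the covariant differentials of a coordinate coframe -/

/-- If `∇du = -g du ⊗ du`, then the curvature contracted with `du` is `dg ∧ du ⊗ du`. -/
theorem sum_pd_mul_curvature {Γ : Connection} {U : Set Plane} (hU : IsOpen U)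
    (hΓ : IsTorsionFree Γ U) {u g : Plane → ℝ} (hu : ContDiffOn ℝ (⊤ : ℕ∞) u U)
    (hg : ContDiffOn ℝ (⊤ : ℕ∞) g U)
    (h : ∀ q ∈ U, ∀ i j, pd i (pd j u) q =
      Γ q 0 i j * pd 0 u q + Γ q 1 i j * pd 1 u q - g q * (pd i u q * pd j u q))
    {p : Plane} (hp : p ∈ U) (i j k : Fin 2) :
    pd 0 u p * curvature Γ 0 k i j p + pd 1 u p * curvature Γ 1 k i j p =
      (pd i g p * pd j u p - pd j g p * pd i u p) * pd k u p := by
  have dΓ : ∀ k i j, DifferentiableAt ℝ (fun q => Γ q k i j) p := fun k i j =>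
    diffAt hU (hΓ.contDiffOn_apply k i j) hp
  have du : ∀ i, DifferentiableAt ℝ (pd i u) p := fun i => diffAt hU (contDiffOn_pd hU hu i) hp
  have dg : DifferentiableAt ℝ g p := diffAt hU hg hp
  have T : ∀ l i j, pd l (pd i (pd j u)) p =
      (pd l (fun q => Γ q 0 i j) p * pd 0 u p + Γ p 0 i j * pd l (pd 0 u) p)
      + (pd l (fun q => Γ q 1 i j) p * pd 1 u p + Γ p 1 i j * pd l (pd 1 u) p)
      - (pd l g p * (pd i u p * pd j u p)
        + g p * (pd l (pd i u) p * pd j u p + pd i u p * pd l (pd j u) p)) := by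
    intro l i j
    rw [pd_congr hU (fun q hq => h q hq i j) hp]
    have a1 := (dΓ 0 i j).fun_mul (du 0)
    have a2 := (dΓ 1 i j).fun_mul (du 1)
    have a3 := (du i).fun_mul (du j)
    rw [pd_sub _ (a1.fun_add a2) (dg.fun_mul a3), pd_add _ a1 a2, pd_mul _ (dΓ 0 i j) (du 0),
      pd_mul _ (dΓ 1 i j) (du 1), pd_mul _ dg a3, pd_mul _ (du i) (du j)]
  -- Symmetry of the third derivatives of u is the integrability condition that brings in the
  -- curvature; the Hessian equation then removes the remaining second derivatives.
  have hc := pd_comm hU (contDiffOn_pd hU hu k) hp i j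
  rw [T i j k, T j i k] at hc
  have hsym := pd_comm hU hu hp i j
  simp only [curvature, Fin.sum_univ_two]
  linear_combination hc + g p * pd k u p * hsym - Γ p 0 j k * h p hp i 0
    - Γ p 1 j k * h p hp i 1 + Γ p 0 i k * h p hp j 0 + Γ p 1 i k * h p hp j 1
    + g p * pd j u p * h p hp i k - g p * pd i u p * h p hp j k

section Coframe

variable {Γ : Connection} {U : Set Plane} {x y P Q : Plane → ℝ}

/-- The coordinate differentials satisfy `∇dx = -P dx ⊗ dx` and `∇dy = -Q dy ⊗ dy`. -/
structure IsDiagonal (Γ : Connection) (x y P Q : Plane → ℝ) (U : Set Plane) : Prop where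
  smooth_fst : ContDiffOn ℝ (⊤ : ℕ∞) x U
  smooth_snd : ContDiffOn ℝ (⊤ : ℕ∞) y U
  smooth_coeff_fst : ContDiffOn ℝ (⊤ : ℕ∞) P U
  smooth_coeff_snd : ContDiffOn ℝ (⊤ : ℕ∞) Q U
  wedge_ne_zero : ∀ p ∈ U, wedge (dif x p) (dif y p) ≠ 0
  hessian_fst : ∀ p ∈ U, ∀ i j, pd i (pd j x) p =
    Γ p 0 i j * pd 0 x p + Γ p 1 i j * pd 1 x p - P p * (pd i x p * pd j x p)
  hessian_snd : ∀ p ∈ U, ∀ i j, pd i (pd j y) p =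
    Γ p 0 i j * pd 0 y p + Γ p 1 i j * pd 1 y p - Q p * (pd i y p * pd j y p)

theorem contDiffOn_cx (hU : IsOpen U) (hx : ContDiffOn ℝ (⊤ : ℕ∞) x U)
    (hy : ContDiffOn ℝ (⊤ : ℕ∞) y U) (hw : ∀ p ∈ U, wedge (dif x p) (dif y p) ≠ 0)
    {u : Plane → ℝ} (hu : ContDiffOn ℝ (⊤ : ℕ∞) u U) :
    ContDiffOn ℝ (⊤ : ℕ∞) (cx x y u) U := by
  have a0 := contDiffOn_pd hU hx
  have a1 := contDiffOn_pd hU hy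
  have a2 := contDiffOn_pd hU hu
  refine ContDiffOn.div ?_ ?_ hw
  · exact ((a2 0).mul (a1 1)).sub ((a2 1).mul (a1 0))
  · exact ((a0 0).mul (a1 1)).sub ((a0 1).mul (a1 0))

theorem contDiffOn_cy (hU : IsOpen U) (hx : ContDiffOn ℝ (⊤ : ℕ∞) x U)
    (hy : ContDiffOn ℝ (⊤ : ℕ∞) y U) (hw : ∀ p ∈ U, wedge (dif x p) (dif y p) ≠ 0)
    {u : Plane → ℝ} (hu : ContDiffOn ℝ (⊤ : ℕ∞) u U) :
    ContDiffOn ℝ (⊤ : ℕ∞) (cy x y u) U := by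
  have a0 := contDiffOn_pd hU hx
  have a1 := contDiffOn_pd hU hy
  have a2 := contDiffOn_pd hU hu
  refine ContDiffOn.div ?_ ?_ hw
  · exact ((a0 0).mul (a2 1)).sub ((a0 1).mul (a2 0))
  · exact ((a0 0).mul (a1 1)).sub ((a0 1).mul (a1 0))

/-- The chain rule `du = u_x dx + u_y dy`. -/
theorem pd_eq_cx_cy {p : Plane} (hw : wedge (dif x p) (dif y p) ≠ 0) (u : Plane → ℝ)
    (i : Fin 2) : pd i u p = cx x y u p * pd i x p + cy x y u p * pd i y p := by
  have c1 : cx x y u p * wedge (dif x p) (dif y p) = wedge (dif u p) (dif y p) :=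
    div_mul_cancel₀ _ hw
  have c2 : cy x y u p * wedge (dif x p) (dif y p) = wedge (dif x p) (dif u p) :=
    div_mul_cancel₀ _ hw
  apply mul_right_cancel₀ hw
  simp only [wedge, dif] at c1 c2 ⊢
  fin_cases i <;> simp only [Fin.zero_eta, Fin.mk_one]
  · linear_combination -pd 0 x p * c1 - pd 0 y p * c2
  · linear_combination -pd 1 x p * c1 - pd 1 y p * c2

/-- Contracted with dx and dy, the curvature is dP∧dx⊗dx and dQ∧dy⊗dy, so only P_y and Q_x survive.
Inverting the coframe recovers the Ricci tensor. -/
theorem IsDiagonal.pTensor_eq (h : IsDiagonal Γ x y P Q U) (hU : IsOpen U)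
    (hΓ : IsTorsionFree Γ U) {p : Plane} (hp : p ∈ U) (i j : Fin 2) :
    pTensor Γ i j p = -(1 / 3) * (2 * cy x y P p + cx x y Q p) * (pd i y p * pd j x p)
      - (1 / 3) * (2 * cx x y Q p + cy x y P p) * (pd i x p * pd j y p) := by
  have hw := h.wedge_ne_zero p hp
  have e0 := fun k i j => sum_pd_mul_curvature hU hΓ h.smooth_fst h.smooth_coeff_fst h.hessian_fst hp i j k
  have e1 := fun k i j => sum_pd_mul_curvature hU hΓ h.smooth_snd h.smooth_coeff_snd h.hessian_snd hp i j k
  simp only [pd_eq_cx_cy hw P, pd_eq_cx_cy hw Q] at e0 e1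
  have hW : pd 0 x p * pd 1 y p - pd 1 x p * pd 0 y p ≠ 0 := hw
  set W := pd 0 x p * pd 1 y p - pd 1 x p * pd 0 y p with hWdef
  have r0 : ∀ k, curvature Γ 0 k 0 0 p = 0 := fun k => by simp [curvature]
  have r1 : ∀ k, curvature Γ 1 k 1 1 p = 0 := fun k => by simp [curvature]
  have R0 : ∀ k, curvature Γ 0 k 0 1 p =
      -(cy x y P p * pd 1 y p * pd k x p + cx x y Q p * pd 1 x p * pd k y p) := fun k => by
    apply mul_left_cancel₀ hW
    linear_combination pd 1 y p * e0 k 0 1 - pd 1 x p * e1 k 0 1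
  have R1 : ∀ k, curvature Γ 1 k 1 0 p =
      -(cy x y P p * pd 0 y p * pd k x p + cx x y Q p * pd 0 x p * pd k y p) := fun k => by
    apply mul_left_cancel₀ hW
    linear_combination pd 0 x p * e1 k 1 0 - pd 0 y p * e0 k 1 0
  simp only [pTensor, ricci, Fin.sum_univ_two]
  fin_cases i <;> fin_cases j <;> simp only [Fin.zero_eta, Fin.mk_one, r0, r1, R0, R1] <;> ring

/-- When the derivative of dy⊗dx is skew-symmetrized, the correction by Q drops out since dy∧dy = 0,
and only the one by P remains. For dx⊗dy the roles are exchanged. -/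
theorem IsDiagonal.liouville_eq (h : IsDiagonal Γ x y P Q U) (hU : IsOpen U)
    (hΓ : IsTorsionFree Γ U) {p : Plane} (hp : p ∈ U) (i j k : Fin 2) :
    liouville Γ i j k p =
      (-(1 / 3) * (cx x y (fun q => 2 * cy x y P q + cx x y Q q) p
          - P p * (2 * cy x y P p + cx x y Q p)) * pd k x p
        + (1 / 3) * (cy x y (fun q => 2 * cx x y Q q + cy x y P q) p
          - Q p * (2 * cx x y Q p + cy x y P p)) * pd k y p) *
      (pd i x p * pd j y p - pd j x p * pd i y p) := by
  have hw := h.wedge_ne_zero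
  have sA : ContDiffOn ℝ (⊤ : ℕ∞) (fun q => 2 * cy x y P q + cx x y Q q) U :=
    (contDiffOn_const.mul (contDiffOn_cy hU h.smooth_fst h.smooth_snd hw h.smooth_coeff_fst)).add
      (contDiffOn_cx hU h.smooth_fst h.smooth_snd hw h.smooth_coeff_snd)
  have sB : ContDiffOn ℝ (⊤ : ℕ∞) (fun q => 2 * cx x y Q q + cy x y P q) U :=
    (contDiffOn_const.mul (contDiffOn_cx hU h.smooth_fst h.smooth_snd hw h.smooth_coeff_snd)).add
      (contDiffOn_cy hU h.smooth_fst h.smooth_snd hw h.smooth_coeff_fst)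
  set A : Plane → ℝ := fun q => 2 * cy x y P q + cx x y Q q with hA
  set B : Plane → ℝ := fun q => 2 * cx x y Q q + cy x y P q with hB
  have hP : ∀ q ∈ U, ∀ i j, pTensor Γ i j q = -(1 / 3) * (A q * (pd i y q * pd j x q)
      + B q * (pd i x q * pd j y q)) := fun q hq i j => by
    rw [h.pTensor_eq hU hΓ hq i j]; ring
  have dA := diffAt hU sA hp
  have dB := diffAt hU sB hp
  have dx : ∀ i, DifferentiableAt ℝ (pd i x) p := fun i =>
    diffAt hU (contDiffOn_pd hU h.smooth_fst i) hp
  have dy : ∀ i, DifferentiableAt ℝ (pd i y) p := fun i =>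
    diffAt hU (contDiffOn_pd hU h.smooth_snd i) hp
  have hdP : ∀ l i j, pd l (pTensor Γ i j) p = -(1 / 3) *
      ((pd l A p * (pd i y p * pd j x p)
        + A p * (pd l (pd i y) p * pd j x p + pd i y p * pd l (pd j x) p))
      + (pd l B p * (pd i x p * pd j y p)
        + B p * (pd l (pd i x) p * pd j y p + pd i x p * pd l (pd j y) p))) := by
    intro l i j
    rw [pd_congr hU (fun q hq => hP q hq i j) hp]
    have a1 := (dy i).fun_mul (dx j)
    have a2 := (dx i).fun_mul (dy j)
    rw [pd_const_mul _ _ ((dA.fun_mul a1).fun_add (dB.fun_mul a2)),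
      pd_add _ (dA.fun_mul a1) (dB.fun_mul a2), pd_mul _ dA a1, pd_mul _ dB a2,
      pd_mul _ (dy i) (dx j), pd_mul _ (dx i) (dy j)]
  have hs := fun k => hΓ.symm p hp k 1 0
  have main : ∀ k, liouville Γ 0 1 k p =
      (-(1 / 3) * (cx x y A p - P p * A p) * pd k x p
        + (1 / 3) * (cy x y B p - Q p * B p) * pd k y p) *
      (pd 0 x p * pd 1 y p - pd 1 x p * pd 0 y p) := by
    intro k
    simp only [liouville, covDerivP, hdP, hP p hp, Fin.sum_univ_two, h.hessian_fst p hp,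
      h.hessian_snd p hp, pd_eq_cx_cy (hw p hp) A, pd_eq_cx_cy (hw p hp) B, hs]
    ring
  fin_cases i <;> fin_cases j
  · simp [liouville]
  · exact main k
  · simp only [Fin.mk_one, Fin.zero_eta]
    rw [liouville_antisymm, main k]; ring
  · simp [liouville]

end Coframe

/-! ### Leaves and geodesics -/

theorem ne_zero_iff_sq_add_sq {v : Fin 2 → ℝ} : v ≠ 0 ↔ 0 < v 0 ^ 2 + v 1 ^ 2 := by
  constructor
  · intro h
    by_contra hn
    apply h
    have h0 : v 0 = 0 := by nlinarith [sq_nonneg (v 0), sq_nonneg (v 1)]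
    have h1 : v 1 = 0 := by nlinarith [sq_nonneg (v 0), sq_nonneg (v 1)]
    funext i; fin_cases i <;> simpa
  · rintro h rfl
    simp at h

theorem eq_zero_of_wedge_eq_zero {α v w : Fin 2 → ℝ} (hv : wedge α v = 0) (hw : wedge α w = 0)
    (hα : α ≠ 0) : wedge v w = 0 := by
  have h := ne_zero_iff_sq_add_sq.1 hα
  apply mul_left_cancel₀ h.ne'
  simp only [wedge] at *
  linear_combination (α 0 * v 0 + α 1 * v 1) * hw - (α 1 * w 1 + α 0 * w 0) * hv

theorem exists_smul_of_wedge_eq_zero {v w : Fin 2 → ℝ} (hv : v ≠ 0) (h : wedge v w = 0) :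
    ∃ μ : ℝ, w = μ • v := by
  have hn := ne_zero_iff_sq_add_sq.1 hv
  simp only [wedge] at h
  refine ⟨(v 0 * w 0 + v 1 * w 1) / (v 0 ^ 2 + v 1 ^ 2), ?_⟩
  funext i
  simp only [Pi.smul_apply, smul_eq_mul]
  rw [div_mul_eq_mul_div, eq_div_iff hn.ne']
  fin_cases i <;> simp only [Fin.zero_eta, Fin.mk_one]
  · linear_combination -v 1 * h
  · linear_combination v 0 * h

theorem pairing_eq (α v : Fin 2 → ℝ) : pairing α v = α 0 * v 0 + α 1 * v 1 := by
  simp [pairing, Fin.sum_univ_two]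

theorem exists_smul_iff_pairing_eq_zero {α v w : Fin 2 → ℝ} (hα : α ≠ 0) (hv : v ≠ 0)
    (h : pairing α v = 0) : (∃ μ : ℝ, w = μ • v) ↔ pairing α w = 0 := by
  rw [pairing_eq] at h ⊢
  constructor
  · rintro ⟨μ, rfl⟩
    simp only [Pi.smul_apply, smul_eq_mul]
    linear_combination μ * h
  · intro hw
    apply exists_smul_of_wedge_eq_zero hv
    apply mul_left_cancel₀ (ne_zero_iff_sq_add_sq.1 hα).ne'
    simp only [wedge]
    linear_combination (α 0 * w 1 - α 1 * w 0) * h - (α 0 * v 1 - α 1 * v 0) * hw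

theorem hasDerivAt_comp_arc {u : Plane → ℝ} {c : ℝ → Plane} {t : ℝ} {v : Plane}
    (hu : DifferentiableAt ℝ u (c t)) (hc : HasDerivAt c v t) :
    HasDerivAt (fun s => u (c s)) (pd 0 u (c t) * v 0 + pd 1 u (c t) * v 1) t := by
  rw [← fderiv_apply_eq_sum]
  exact hu.hasFDerivAt.comp_hasDerivAt t hc

theorem IsRegularArc.hasDerivAt {U : Set Plane} {c : ℝ → Plane} {a b : ℝ}
    (h : IsRegularArc U c a b) {t : ℝ} (ht : t ∈ Ioo a b) : HasDerivAt c (deriv c t) t :=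
  ((h.smooth.contDiffAt (isOpen_Ioo.mem_nhds ht)).differentiableAt (by simp)).hasDerivAt

theorem IsRegularArc.hasDerivAt_deriv {U : Set Plane} {c : ℝ → Plane} {a b : ℝ}
    (h : IsRegularArc U c a b) {t : ℝ} (ht : t ∈ Ioo a b) :
    HasDerivAt (deriv c) (deriv (deriv c) t) t :=
  (((h.smooth.deriv_of_isOpen (m := (⊤ : ℕ∞)) isOpen_Ioo (by simp)).contDiffAt
    (isOpen_Ioo.mem_nhds ht)).differentiableAt (by simp)).hasDerivAt

theorem hasDerivAt_apply {c : ℝ → Fin 2 → ℝ} {v : Fin 2 → ℝ} {t : ℝ} (h : HasDerivAt c v t)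
    (i : Fin 2) : HasDerivAt (fun s => c s i) (v i) t :=
  (hasDerivAt_pi.1 h) i

/-- A tangent vector of the foliation `θ = 0`. -/
def tangentField (θ : OneForm) : Plane → Fin 2 → ℝ := fun p => ![-θ p 1, θ p 0]

/-- The obstruction for the leaves of `θ = 0` to be geodesics: the value of `∇θ` on the square
of a tangent vector of the foliation. -/
def leafCurvature (Γ : Connection) (θ : OneForm) (p : Plane) : ℝ :=
  ∑ i, ∑ j, (pd i (fun q => θ q j) p - ∑ k, Γ p k i j * θ p k) *
    tangentField θ p i * tangentField θ p j

/-- The arc is an integral curve of the field obtained by rotating θ. -/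
theorem exists_isLeafArc {U : Set Plane} (hU : IsOpen U) {θ : OneForm}
    (hθ : ContDiffOn ℝ (⊤ : ℕ∞) θ U) (h0 : ∀ p ∈ U, θ p ≠ 0) {p : Plane} (hp : p ∈ U) :
    ∃ (c : ℝ → Plane) (ε : ℝ), 0 < ε ∧ IsLeafArc θ U c (-ε) ε ∧ c 0 = p := by
  have hX : ContDiffOn ℝ (⊤ : ℕ∞) (tangentField θ) U := by
    refine contDiffOn_pi.2 fun i => ?_
    have h := contDiffOn_pi.1 hθ
    fin_cases i
    · exact (h 1).neg
    · exact h 0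
  have hXp : ContDiffAt ℝ 1 (tangentField θ) p :=
    (hX.contDiffAt (hU.mem_nhds hp)).of_le (by simp)
  obtain ⟨c, hc0, ε, hε, hc⟩ :=
    hXp.exists_forall_mem_closedBall_exists_eq_forall_mem_Ioo_hasDerivAt₀ 0
  have hcont : ContinuousAt c 0 := (hc 0 ⟨by linarith, by linarith⟩).continuousAt
  have hmem : ∀ᶠ t in 𝓝 (0 : ℝ), c t ∈ U := hcont.eventually (by rw [hc0]; exact hU.mem_nhds hp)
  obtain ⟨δ, hδ, hcU⟩ := Metric.eventually_nhds_iff.1 hmem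
  -- Taking r strictly below both radii keeps the closed interval [-r, r] inside the domain of the
  -- solution and its image inside U; the smoothness bootstrap works on a closed interval.
  obtain ⟨r, hr, hrm⟩ := exists_between (lt_min hε hδ)
  have hrε : r < ε := hrm.trans_le (min_le_left _ _)
  have hrδ : r < δ := hrm.trans_le (min_le_right _ _)
  have hU' : ∀ t ∈ Icc (-r) r, c t ∈ U := fun t ht => hcU (by
    rw [Real.dist_eq, sub_zero]; exact (abs_le.2 ht).trans_lt hrδ)
  have hd : ∀ t ∈ Icc (-r) r, HasDerivAt c (tangentField θ (c t)) t := fun t ht =>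
    hc t ⟨by linarith [ht.1], by linarith [ht.2]⟩
  have hsm : ContDiffOn ℝ (⊤ : ℕ∞) c (Icc (-r) r) :=
    ODE.contDiffOn_enat_Icc_of_hasDerivWithinAt (f := fun _ => tangentField θ) (u := U)
      (hX.comp contDiffOn_snd fun z hz => hz.2)
      (fun t ht => (hd t ht).hasDerivWithinAt) hU'
  refine ⟨c, r, hr, ⟨⟨hsm.mono Ioo_subset_Icc_self, fun t ht => hU' t (Ioo_subset_Icc_self ht),
    fun t ht => ?_⟩, fun t ht => ?_⟩, hc0⟩
  · rw [(hd t (Ioo_subset_Icc_self ht)).deriv]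
    have := ne_zero_iff_sq_add_sq.1 (h0 _ (hU' t (Ioo_subset_Icc_self ht)))
    refine ne_zero_iff_sq_add_sq.2 ?_
    simp only [tangentField, Matrix.cons_val]
    linarith
  · rw [(hd t (Ioo_subset_Icc_self ht)).deriv, pairing_eq]
    simp [tangentField]; ring

/-- Along a leaf, `θ(∇_{c'} c')` is a multiple of the leaf curvature. -/
theorem pairing_acceleration {U : Set Plane} (hU : IsOpen U) {θ : OneForm} {Γ : Connection}
    (hθ : ContDiffOn ℝ (⊤ : ℕ∞) θ U) {c : ℝ → Plane} {a b : ℝ} (hc : IsLeafArc θ U c a b)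
    {t : ℝ} (ht : t ∈ Ioo a b) :
    (θ (c t) 0 ^ 2 + θ (c t) 1 ^ 2) ^ 2 * pairing (θ (c t)) (acceleration Γ c t) =
      -(wedge (θ (c t)) (deriv c t)) ^ 2 * leafCurvature Γ θ (c t) := by
  have hp := hc.arc.mem t ht
  have d1 := hc.arc.hasDerivAt ht
  have d2 := hc.arc.hasDerivAt_deriv ht
  have hdθ : ∀ j, DifferentiableAt ℝ (fun q => θ q j) (c t) := fun j =>
    diffAt hU (contDiffOn_pi.1 hθ j) hp
  have key := ((hasDerivAt_comp_arc (hdθ 0) d1).fun_mul (hasDerivAt_apply d2 0)).fun_add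
    ((hasDerivAt_comp_arc (hdθ 1) d1).fun_mul (hasDerivAt_apply d2 1))
  have hz : (fun s => θ (c s) 0 * deriv c s 0 + θ (c s) 1 * deriv c s 1) =ᶠ[𝓝 t] fun _ => 0 := by
    filter_upwards [isOpen_Ioo.mem_nhds ht] with s hs
    rw [← pairing_eq]; exact hc.tangent s hs
  -- This is the derivative of the identity θ(c') = 0 along the arc.
  have h0 := key.unique ((hasDerivAt_const t (0 : ℝ)).congr_of_eventuallyEq hz)
  have hT := hc.tangent t ht
  rw [pairing_eq] at hT ⊢
  simp only [leafCurvature, tangentField, acceleration, wedge, Fin.sum_univ_two, Matrix.cons_val]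
  set v := deriv c t
  set θ0 := θ (c t) 0
  set θ1 := θ (c t) 1
  -- The velocity is proportional to the tangent field (-θ₁, θ₀), with ratio m/N; the relations are
  -- kept free of division.
  have e0 : (θ0 ^ 2 + θ1 ^ 2) * v 0 = -(θ0 * v 1 - θ1 * v 0) * θ1 := by
    linear_combination θ0 * hT
  have e1 : (θ0 ^ 2 + θ1 ^ 2) * v 1 = (θ0 * v 1 - θ1 * v 0) * θ0 := by
    linear_combination θ1 * hT
  set N := θ0 ^ 2 + θ1 ^ 2
  set m := θ0 * v 1 - θ1 * v 0
  have q00 : N ^ 2 * (v 0 * v 0) = m ^ 2 * (θ1 * θ1) := by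
    linear_combination N * v 0 * e0 - m * θ1 * e0
  have q01 : N ^ 2 * (v 0 * v 1) = -m ^ 2 * (θ1 * θ0) := by
    linear_combination N * v 1 * e0 - m * θ1 * e1
  have q11 : N ^ 2 * (v 1 * v 1) = m ^ 2 * (θ0 * θ0) := by
    linear_combination N * v 1 * e1 + m * θ0 * e1
  set a00 := pd 0 (fun q => θ q 0) (c t)
  set a01 := pd 0 (fun q => θ q 1) (c t)
  set a10 := pd 1 (fun q => θ q 0) (c t)
  set a11 := pd 1 (fun q => θ q 1) (c t)
  generalize Γ (c t) = G at *
  linear_combination N ^ 2 * h0 - (a00 - (G 0 0 0 * θ0 + G 1 0 0 * θ1)) * q00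
    - (a01 - (G 0 0 1 * θ0 + G 1 0 1 * θ1)) * q01
    - (a10 - (G 0 1 0 * θ0 + G 1 1 0 * θ1)) * q01
    - (a11 - (G 0 1 1 * θ0 + G 1 1 1 * θ1)) * q11

/-- This replaces a quantification over arcs by a pointwise equation, which can be localized and
compared between connections. The forward direction needs a leaf arc through every point. -/
theorem isGeodesicFoliation_iff {U : Set Plane} (hU : IsOpen U) {θ : OneForm} {Γ : Connection}
    (hθ : ContDiffOn ℝ (⊤ : ℕ∞) θ U) (h0 : ∀ p ∈ U, θ p ≠ 0) :
    IsGeodesicFoliation Γ θ U ↔ ∀ p ∈ U, leafCurvature Γ θ p = 0 := by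
  have wne : ∀ {c : ℝ → Plane} {a b : ℝ}, IsLeafArc θ U c a b → ∀ t ∈ Ioo a b,
      wedge (θ (c t)) (deriv c t) ≠ 0 := by
    intro c a b hc t ht hw
    have hT := hc.tangent t ht
    rw [pairing_eq] at hT
    simp only [wedge] at hw
    have h1 := (ne_zero_iff_sq_add_sq.1 (h0 _ (hc.arc.mem t ht))).ne'
    have h2 := (ne_zero_iff_sq_add_sq.1 (hc.arc.regular t ht)).ne'
    -- Lagrange's identity: |θ|²|c'|² is the sum of the squares of θ(c') and θ∧c'.
    apply mul_ne_zero h1 h2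
    linear_combination (θ (c t) 0 * deriv c t 0 + θ (c t) 1 * deriv c t 1) * hT
      + (θ (c t) 0 * deriv c t 1 - θ (c t) 1 * deriv c t 0) * hw
  constructor
  · intro h p hp
    obtain ⟨c, ε, hε, hc, rfl⟩ := exists_isLeafArc hU hθ h0 hp
    have ht : (0 : ℝ) ∈ Ioo (-ε) ε := ⟨by linarith, hε⟩
    have h1 := (exists_smul_iff_pairing_eq_zero (h0 _ (hc.arc.mem 0 ht)) (hc.arc.regular 0 ht)
      (hc.tangent 0 ht)).1 (h c _ _ hc 0 ht)
    have h2 := pairing_acceleration (Γ := Γ) hU hθ hc ht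
    rw [h1, mul_zero] at h2
    exact (mul_eq_zero.1 h2.symm).resolve_left (neg_ne_zero.2 (pow_ne_zero 2 (wne hc 0 ht)))
  · intro h c a b hc t ht
    refine (exists_smul_iff_pairing_eq_zero (h0 _ (hc.arc.mem t ht)) (hc.arc.regular t ht)
      (hc.tangent t ht)).2 ?_
    have h2 := pairing_acceleration (Γ := Γ) hU hθ hc ht
    rw [h _ (hc.arc.mem t ht), mul_zero] at h2
    exact (mul_eq_zero.1 h2).resolve_left
      (pow_ne_zero 2 (ne_zero_iff_sq_add_sq.1 (h0 _ (hc.arc.mem t ht))).ne')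

theorem IsLeafArc.of_wedge_eq_zero {U : Set Plane} {θ η : OneForm} (hθ : ∀ p ∈ U, θ p ≠ 0)
    (h : ∀ p ∈ U, wedge (θ p) (η p) = 0) {c : ℝ → Plane} {a b : ℝ} (hc : IsLeafArc θ U c a b) :
    IsLeafArc η U c a b := by
  refine ⟨hc.arc, fun t ht => ?_⟩
  have hp := hc.arc.mem t ht
  have h1 := hc.tangent t ht
  have h2 := h _ hp
  rw [pairing_eq] at h1 ⊢
  simp only [wedge] at h2
  apply mul_left_cancel₀ (ne_zero_iff_sq_add_sq.1 (hθ _ hp)).ne'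
  linear_combination (η (c t) 0 * θ (c t) 0 + η (c t) 1 * θ (c t) 1) * h1
    - (θ (c t) 1 * deriv c t 0 - θ (c t) 0 * deriv c t 1) * h2

theorem isGeodesicFoliation_congr {U : Set Plane} {Γ : Connection} {θ η : OneForm}
    (hη : ∀ p ∈ U, η p ≠ 0) (h : ∀ p ∈ U, wedge (θ p) (η p) = 0)
    (hg : IsGeodesicFoliation Γ θ U) : IsGeodesicFoliation Γ η U := fun c a b hc =>
  hg c a b (hc.of_wedge_eq_zero hη fun p hp => by
    have := h p hp
    simp only [wedge] at this ⊢
    linear_combination -this)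

theorem IsWeb.ne_zero {d : ℕ} {θ : Fin d → OneForm} {U : Set Plane} (h : IsWeb θ U)
    (hd : 2 ≤ d) (i : Fin d) : ∀ p ∈ U, θ i p ≠ 0 := by
  intro p hp h0
  have : Nontrivial (Fin d) := Fin.nontrivial_iff_two_le.2 hd
  obtain ⟨j, hj⟩ := exists_ne i
  apply h.generalPosition p hp i j hj.symm
  simp [wedge, h0]

/-! ### Uniqueness of the projective structure of a geodesic 4-web -/

/-- A binary cubic form with four distinct zeros vanishes. -/
theorem cubic_eq_zero {v : Fin 4 → Fin 2 → ℝ} (hv : ∀ i j, i ≠ j → wedge (v i) (v j) ≠ 0)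
    {e : Fin 4 → ℝ} (h : ∀ i, e 0 * v i 1 ^ 3 + e 1 * (v i 0 * v i 1 ^ 2)
      + e 2 * (v i 0 ^ 2 * v i 1) + e 3 * v i 0 ^ 3 = 0) : e = 0 := by
  -- The four equations are linear in e, with the homogeneous Vandermonde matrix; up to sign, its
  -- determinant is the product of the pairwise wedges.
  have hdet : (Matrix.projVandermonde (fun i => v i 0) (fun i => v i 1)).det ≠ 0 := by
    rw [Matrix.det_projVandermonde]
    refine Finset.prod_ne_zero_iff.2 fun i _ => Finset.prod_ne_zero_iff.2 fun j hj => ?_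
    have := hv i j (Finset.mem_Ioi.1 hj).ne
    simp only [wedge] at this
    intro h0
    apply this
    linear_combination -h0
  refine Matrix.eq_zero_of_mulVec_eq_zero hdet ?_
  funext i
  have := h i
  simp only [Matrix.mulVec, dotProduct, Matrix.projVandermonde_apply, Fin.sum_univ_four, Pi.zero_apply]
  simp [Fin.rev]
  linear_combination this

/-- Subtracting the two leaf curvatures cancels the derivatives of θ and leaves a cubic form in θ,
built from the difference of the Christoffel symbols. By symmetry of the symbols it has four
coefficients, and their vanishing says that the difference is the symmetrized product of the
identity with a 1-form. -/
theorem projRel_of_leafCurvature_eq_zero {Γ Γ' : Connection} {U : Set Plane}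
    (hΓ : IsTorsionFree Γ U) (hΓ' : IsTorsionFree Γ' U) {θ : Fin 4 → OneForm}
    (hθ : IsWeb θ U) (h : ∀ i, ∀ p ∈ U, leafCurvature Γ (θ i) p = 0)
    (h' : ∀ i, ∀ p ∈ U, leafCurvature Γ' (θ i) p = 0) : ProjRel U Γ Γ' := by
  -- In a projective change the symbol with upper index 1 and lower indices 0, 1 changes by Υ₀
  -- alone, and the one with upper index 0 by Υ₁ alone.
  refine ⟨![fun p => Γ' p 1 0 1 - Γ p 1 0 1, fun p => Γ' p 0 0 1 - Γ p 0 0 1], ?_, ?_⟩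
  · intro i
    fin_cases i
    · exact (hΓ'.contDiffOn_apply 1 0 1).sub (hΓ.contDiffOn_apply 1 0 1)
    · exact (hΓ'.contDiffOn_apply 0 0 1).sub (hΓ.contDiffOn_apply 0 0 1)
  · intro p hp
    have hs := fun k => hΓ.symm p hp k 1 0
    have hs' := fun k => hΓ'.symm p hp k 1 0
    have key : ![Γ' p 1 0 0 - Γ p 1 0 0,
        (Γ' p 0 0 0 - Γ p 0 0 0) - 2 * (Γ' p 1 0 1 - Γ p 1 0 1),
        (Γ' p 1 1 1 - Γ p 1 1 1) - 2 * (Γ' p 0 0 1 - Γ p 0 0 1),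
        (Γ' p 0 1 1 - Γ p 0 1 1)] = (0 : Fin 4 → ℝ) := by
      refine cubic_eq_zero (v := fun i => θ i p) (fun i j hij => hθ.generalPosition p hp i j hij)
        fun i => ?_
      have e := h i p hp
      have e' := h' i p hp
      simp only [leafCurvature, tangentField, Fin.sum_univ_two, Matrix.cons_val, hs, hs'] at e e' ⊢
      linear_combination e - e'
    have k0 := congrFun key 0
    have k1 := congrFun key 1
    have k2 := congrFun key 2
    have k3 := congrFun key 3
    simp at k0 k1 k2 k3
    intro k i j
    fin_cases k <;> fin_cases i <;> fin_cases j <;> simp [hs, hs'] <;> linarith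

/-! ### The canonical connection of a 4-web is geodesic -/

theorem IsWeb.contDiffOn_apply {d : ℕ} {θ : Fin d → OneForm} {U : Set Plane} (h : IsWeb θ U)
    (i : Fin d) (j : Fin 2) : ContDiffOn ℝ (⊤ : ℕ∞) (fun p => θ i p j) U :=
  contDiffOn_pi.1 (h.smooth i) j

theorem IsWeb.mono {d : ℕ} {θ : Fin d → OneForm} {U V : Set Plane} (h : IsWeb θ U)
    (hV : V ⊆ U) : IsWeb θ V :=
  ⟨fun i => (h.smooth i).mono hV, fun p hp => h.generalPosition p (hV hp)⟩

theorem IsWeb.subweb {d e : ℕ} {θ : Fin d → OneForm} {U : Set Plane} (h : IsWeb θ U)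
    (s : Fin e ↪ Fin d) : IsWeb (fun i => θ (s i)) U :=
  ⟨fun i => h.smooth (s i), fun p hp _ _ hij =>
    h.generalPosition p hp _ _ (s.injective.ne hij)⟩

theorem contDiffOn_wedge {α β : OneForm} {U : Set Plane}
    (hα : ∀ j, ContDiffOn ℝ (⊤ : ℕ∞) (fun p => α p j) U)
    (hβ : ∀ j, ContDiffOn ℝ (⊤ : ℕ∞) (fun p => β p j) U) :
    ContDiffOn ℝ (⊤ : ℕ∞) (fun p => wedge (α p) (β p)) U :=
  ((hα 0).mul (hβ 1)).sub ((hα 1).mul (hβ 0))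

theorem contDiffOn_normalized {θ : Fin 4 → OneForm} {U : Set Plane} (hθ : IsWeb θ U) (i : Fin 3)
    (j : Fin 2) : ContDiffOn ℝ (⊤ : ℕ∞) (fun p => normalized θ i p j) U := by
  have h := hθ.contDiffOn_apply
  fin_cases i
  · exact (contDiffOn_wedge (h 1) (h 2)).mul (h 0 j)
  · exact (contDiffOn_wedge (h 2) (h 0)).mul (h 1 j)
  · exact (contDiffOn_wedge (h 0) (h 1)).mul (h 2 j)

theorem wedge_normalized_zero_three (θ : Fin 4 → OneForm) (p : Plane) :
    wedge (normalized θ 0 p) (θ 3 p) = wedge (θ 1 p) (θ 2 p) * wedge (θ 0 p) (θ 3 p) := by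
  simp [normalized, wedge]; ring

theorem wedge_normalized_one_three (θ : Fin 4 → OneForm) (p : Plane) :
    wedge (normalized θ 1 p) (θ 3 p) = wedge (θ 2 p) (θ 0 p) * wedge (θ 1 p) (θ 3 p) := by
  simp [normalized, wedge]; ring

theorem wedge_normalized_two_three (θ : Fin 4 → OneForm) (p : Plane) :
    wedge (normalized θ 2 p) (θ 3 p) = wedge (θ 0 p) (θ 1 p) * wedge (θ 2 p) (θ 3 p) := by
  simp [normalized, wedge]; ring

section Canonical

variable {θ : Fin 4 → OneForm} {U : Set Plane} (hθ : IsWeb θ U)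
include hθ

theorem wedge_normalized_zero_three_ne_zero {p : Plane} (hp : p ∈ U) :
    wedge (normalized θ 0 p) (θ 3 p) ≠ 0 := by
  rw [wedge_normalized_zero_three]
  exact mul_ne_zero (hθ.generalPosition p hp 1 2 (by decide))
    (hθ.generalPosition p hp 0 3 (by decide))

theorem contDiffOn_basicInvariant : ContDiffOn ℝ (⊤ : ℕ∞) (basicInvariant θ) U := by
  refine (ContDiffOn.div ?_ ?_ fun p hp => wedge_normalized_zero_three_ne_zero hθ hp).neg
  · exact contDiffOn_wedge (contDiffOn_normalized hθ 1) (hθ.contDiffOn_apply 3)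
  · exact contDiffOn_wedge (contDiffOn_normalized hθ 0) (hθ.contDiffOn_apply 3)

theorem basicInvariant_mul {p : Plane} (hp : p ∈ U) :
    basicInvariant θ p * wedge (normalized θ 0 p) (θ 3 p) = -wedge (normalized θ 1 p) (θ 3 p) := by
  rw [basicInvariant, neg_mul, div_mul_cancel₀ _ (wedge_normalized_zero_three_ne_zero hθ hp)]

theorem basicInvariant_ne_zero {p : Plane} (hp : p ∈ U) : basicInvariant θ p ≠ 0 := by
  intro h
  have h1 := basicInvariant_mul hθ hp
  rw [h, zero_mul, wedge_normalized_one_three, eq_comm, neg_eq_zero] at h1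
  exact mul_ne_zero (hθ.generalPosition p hp 2 0 (by decide))
    (hθ.generalPosition p hp 1 3 (by decide)) h1

/-- Where a = 1 the fourth form would be a multiple of ω₁ + ω₂ = -ω₃, so the third and fourth
directions would coincide. -/
theorem one_sub_basicInvariant_ne_zero {p : Plane} (hp : p ∈ U) :
    1 - basicInvariant θ p ≠ 0 := by
  intro h
  have h1 := basicInvariant_mul hθ hp
  have h2 : wedge (normalized θ 2 p) (θ 3 p) = 0 := by
    have e0 := congrFun (normalized_add θ p) 0
    have e1 := congrFun (normalized_add θ p) 1
    simp only [Pi.add_apply, Pi.zero_apply] at e0 e1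
    simp only [wedge] at *
    linear_combination -h1 - (normalized θ 0 p 0 * θ 3 p 1 - normalized θ 0 p 1 * θ 3 p 0) * h
      + θ 3 p 1 * e0 - θ 3 p 0 * e1
  rw [wedge_normalized_two_three] at h2
  exact mul_ne_zero (hθ.generalPosition p hp 0 1 (by decide))
    (hθ.generalPosition p hp 2 3 (by decide)) h2

/-- The leaf curvature of a pencil of foliations with respect to the canonical connection. -/
theorem leafCurvature_canonicalConnection (hU : IsOpen U) {h : Plane → ℝ}
    (hh : ContDiffOn ℝ (⊤ : ℕ∞) h U) {p : Plane} (hp : p ∈ U) :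
    leafCurvature (canonicalConnection θ)
        (fun q j => h q * normalized θ 0 q j + normalized θ 1 q j) p =
      wedge (normalized θ 0 p) (normalized θ 1 p) ^ 2 *
        ((pairing (dif h p) (dualFrame θ p 0) - h p * pairing (dif h p) (dualFrame θ p 1))
          - zFun θ p * (h p * (1 - h p))) := by
  have hW := wedge_normalized_ne_zero hθ hp
  have dn : ∀ i j, DifferentiableAt ℝ (fun q => normalized θ i q j) p := fun i j =>
    diffAt hU (contDiffOn_normalized hθ i j) hp
  have dh := diffAt hU hh hp
  have hd : ∀ i j, pd i (fun q => h q * normalized θ 0 q j + normalized θ 1 q j) p =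
      pd i h p * normalized θ 0 p j + h p * pd i (fun q => normalized θ 0 q j) p
        + pd i (fun q => normalized θ 1 q j) p := fun i j => by
    rw [pd_add _ (dh.fun_mul (dn 0 j)) (dn 1 j), pd_mul _ dh (dn 0 j)]
  have hs := fun k => canonicalConnection_symm θ p k 1 0
  have s00 := symDiff_canonicalConnection hθ hp 0 0
  have s01 := symDiff_canonicalConnection hθ hp 0 1
  have s11 := symDiff_canonicalConnection hθ hp 1 1
  have e0 := congrFun (normalized_add θ p) 0
  have e1 := congrFun (normalized_add θ p) 1
  -- One of the two wedge factors clears the determinant in the denominators of the dual frame.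
  have hpair : wedge (normalized θ 0 p) (normalized θ 1 p) *
      (pairing (dif h p) (dualFrame θ p 0) - h p * pairing (dif h p) (dualFrame θ p 1)) =
      pd 0 h p * (normalized θ 1 p 1 + h p * normalized θ 0 p 1)
      - pd 1 h p * (normalized θ 1 p 0 + h p * normalized θ 0 p 0) := by
    simp only [pairing_eq, dif, dualFrame, Matrix.cons_val, Pi.smul_apply, smul_eq_mul]
    linear_combination (pd 0 h p * normalized θ 1 p 1 - pd 1 h p * normalized θ 1 p 0
      - h p * (-pd 0 h p * normalized θ 0 p 1 + pd 1 h p * normalized θ 0 p 0)) *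
      mul_inv_cancel₀ hW
  simp only [Pi.add_apply, Pi.zero_apply] at e0 e1
  have e0' : normalized θ 2 p 0 = -(normalized θ 0 p 0 + normalized θ 1 p 0) := by
    linear_combination e0
  have e1' : normalized θ 2 p 1 = -(normalized θ 0 p 1 + normalized θ 1 p 1) := by
    linear_combination e1
  simp only [symDiff, symProd, Fin.sum_univ_two, hs, e0', e1'] at s00 s01 s11
  rw [mul_sub, pow_two, mul_assoc, hpair]
  simp only [leafCurvature, tangentField, Fin.sum_univ_two, Matrix.cons_val, hd, hs, wedge]
  set X0 := -(h p * normalized θ 0 p 1 + normalized θ 1 p 1)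
  set X1 := h p * normalized θ 0 p 0 + normalized θ 1 p 0
  linear_combination X0 ^ 2 * (h p * s00.1 + s00.2) + 2 * X0 * X1 * (h p * s01.1 + s01.2)
    + X1 ^ 2 * (h p * s11.1 + s11.2)

/-- In the pencil hω₁ + ω₂ the geodesic condition is h₁ - h h₂ = z h(1 - h). The constants 0 and 1
solve it and give the second and third foliations; h = a solves it by the definition of z and gives
the fourth. The first foliation is the point at infinity of the pencil and is checked directly. -/
theorem canonicalConnection_isGeodesic (hU : IsOpen U) (i : Fin 4) :
    IsGeodesicFoliation (canonicalConnection θ) (θ i) U := by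
  have pencil : ∀ h : Plane → ℝ, ContDiffOn ℝ (⊤ : ℕ∞) h U →
      (∀ p ∈ U, (pairing (dif h p) (dualFrame θ p 0) - h p * pairing (dif h p) (dualFrame θ p 1))
          - zFun θ p * (h p * (1 - h p)) = 0) → ∀ m : Fin 4,
      (∀ p ∈ U, wedge (fun j => h p * normalized θ 0 p j + normalized θ 1 p j) (θ m p) = 0) →
      IsGeodesicFoliation (canonicalConnection θ) (θ m) U := by
    intro h hh hz m hm
    refine isGeodesicFoliation_congr
      (θ := fun q j => h q * normalized θ 0 q j + normalized θ 1 q j)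
      (hθ.ne_zero (by norm_num) m) hm ?_
    refine (isGeodesicFoliation_iff hU ?_ fun p hp h0 => ?_).2 fun p hp => ?_
    · exact contDiffOn_pi.2 fun j =>
        (hh.mul (contDiffOn_normalized hθ 0 j)).add (contDiffOn_normalized hθ 1 j)
    · apply wedge_normalized_ne_zero hθ hp
      have e0 := congrFun h0 0
      have e1 := congrFun h0 1
      simp only [Pi.zero_apply] at e0 e1
      simp only [wedge]
      linear_combination normalized θ 0 p 0 * e1 - normalized θ 0 p 1 * e0
    · rw [leafCurvature_canonicalConnection hθ hU hh hp, hz p hp, mul_zero]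
  have dconst : ∀ (c : ℝ) (p v), pairing (dif (fun _ => c) p) v = 0 := fun c p v => by
    simp [pairing_eq, dif, pd_const]
  fin_cases i
  · refine isGeodesicFoliation_congr (θ := normalized θ 0) (hθ.ne_zero (by norm_num) 0)
      (fun p _ => by simp [normalized, wedge]; ring) ?_
    refine (isGeodesicFoliation_iff hU ?_ fun p hp h0 => ?_).2 fun p hp => ?_
    · exact contDiffOn_pi.2 fun j => contDiffOn_normalized hθ 0 j
    · apply wedge_normalized_ne_zero hθ hp
      simp [wedge, h0]
    · have hs := fun k => canonicalConnection_symm θ p k 1 0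
      have s00 := (symDiff_canonicalConnection hθ hp 0 0).1
      have s01 := (symDiff_canonicalConnection hθ hp 0 1).1
      have s11 := (symDiff_canonicalConnection hθ hp 1 1).1
      simp only [symDiff, symProd, Fin.sum_univ_two, hs] at s00 s01 s11
      simp only [leafCurvature, tangentField, Fin.sum_univ_two, Matrix.cons_val, hs]
      linear_combination normalized θ 0 p 1 ^ 2 * s00
        - 2 * normalized θ 0 p 0 * normalized θ 0 p 1 * s01 + normalized θ 0 p 0 ^ 2 * s11
  · exact pencil (fun _ => 0) contDiffOn_const (fun p _ => by simp [dconst]) 1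
      (fun p _ => by simp [normalized, wedge]; ring)
  · refine pencil (fun _ => 1) contDiffOn_const (fun p _ => by simp [dconst]) 2 (fun p _ => ?_)
    have e0 := congrFun (normalized_add θ p) 0
    have e1 := congrFun (normalized_add θ p) 1
    have e2 : wedge (normalized θ 2 p) (θ 2 p) = 0 := by simp [normalized, wedge]; ring
    simp only [Pi.add_apply, Pi.zero_apply] at e0 e1
    simp only [wedge] at e2 ⊢
    linear_combination θ 2 p 1 * e0 - θ 2 p 0 * e1 - e2
  · refine pencil (basicInvariant θ) (contDiffOn_basicInvariant hθ) (fun p hp => ?_) 3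
      fun p hp => ?_
    · have h0 := basicInvariant_ne_zero hθ hp
      have h1 := one_sub_basicInvariant_ne_zero hθ hp
      have : zFun θ p * (basicInvariant θ p * (1 - basicInvariant θ p)) = _ :=
        div_mul_cancel₀ _ (mul_ne_zero h0 h1)
      rw [this]
      ring
    · have := basicInvariant_mul hθ hp
      simp only [wedge] at this ⊢
      linear_combination this

theorem leafCurvature_canonicalConnection_eq_zero (hU : IsOpen U) (i : Fin 4) :
    ∀ p ∈ U, leafCurvature (canonicalConnection θ) (θ i) p = 0 :=
  (isGeodesicFoliation_iff hU (hθ.smooth i) (hθ.ne_zero (by norm_num) i)).1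
    (canonicalConnection_isGeodesic hθ hU i)

/-- A connection for which the foliations of a 4-web are geodesic belongs to the canonical
projective structure of the web. -/
theorem projRel_canonicalConnection (hU : IsOpen U) {Γ : Connection} (hΓ : IsTorsionFree Γ U)
    (h : ∀ i, IsGeodesicFoliation Γ (θ i) U) : ProjRel U (canonicalConnection θ) Γ :=
  projRel_of_leafCurvature_eq_zero (canonicalConnection_mem hU hθ).1 hΓ hθ
    (leafCurvature_canonicalConnection_eq_zero hθ hU)
    fun i => (isGeodesicFoliation_iff hU (hθ.smooth i) (hθ.ne_zero (by norm_num) i)).1 (h i)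

end Canonical

/-- The added terms contribute multiples of θ evaluated on its own tangent field, which is zero. -/
theorem leafCurvature_projRel {Γ Γ' : Connection} {U : Set Plane} (h : ProjRel U Γ Γ')
    (θ : OneForm) {p : Plane} (hp : p ∈ U) : leafCurvature Γ' θ p = leafCurvature Γ θ p := by
  obtain ⟨Υ, -, h⟩ := h
  simp [leafCurvature, tangentField, Fin.sum_univ_two, h p hp]
  ring

/-! ### The explicit form of the Liouville tensor -/

/-- The connection with `∇dx = -P dx ⊗ dx` and `∇dy = -Q dy ⊗ dy`. -/
def diagonalConnection (x y P Q : Plane → ℝ) : Connection := fun p k i j =>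
  (wedge (dif x p) (dif y p))⁻¹ *
    (![pd 1 y p, -pd 0 y p] k * (pd i (pd j x) p + P p * (pd i x p * pd j x p))
      + ![-pd 1 x p, pd 0 x p] k * (pd i (pd j y) p + Q p * (pd i y p * pd j y p)))

section Coordinates

variable {U : Set Plane} {x y : Plane → ℝ}

theorem isDiagonal_diagonalConnection (hx : ContDiffOn ℝ (⊤ : ℕ∞) x U)
    (hy : ContDiffOn ℝ (⊤ : ℕ∞) y U) (hw : ∀ p ∈ U, wedge (dif x p) (dif y p) ≠ 0)
    {P Q : Plane → ℝ} (hP : ContDiffOn ℝ (⊤ : ℕ∞) P U) (hQ : ContDiffOn ℝ (⊤ : ℕ∞) Q U) :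
    IsDiagonal (diagonalConnection x y P Q) x y P Q U where
  smooth_fst := hx
  smooth_snd := hy
  smooth_coeff_fst := hP
  smooth_coeff_snd := hQ
  wedge_ne_zero := hw
  hessian_fst p hp i j := by
    have e := mul_inv_cancel₀ (hw p hp)
    simp only [diagonalConnection, Matrix.cons_val]
    simp only [wedge, dif] at *
    linear_combination -(pd i (pd j x) p + P p * (pd i x p * pd j x p)) * e
  hessian_snd p hp i j := by
    have e := mul_inv_cancel₀ (hw p hp)
    simp only [diagonalConnection, Matrix.cons_val]
    simp only [wedge, dif] at *
    linear_combination -(pd i (pd j y) p + Q p * (pd i y p * pd j y p)) * e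

theorem isTorsionFree_diagonalConnection (hU : IsOpen U) (hx : ContDiffOn ℝ (⊤ : ℕ∞) x U)
    (hy : ContDiffOn ℝ (⊤ : ℕ∞) y U) (hw : ∀ p ∈ U, wedge (dif x p) (dif y p) ≠ 0)
    {P Q : Plane → ℝ} (hP : ContDiffOn ℝ (⊤ : ℕ∞) P U) (hQ : ContDiffOn ℝ (⊤ : ℕ∞) Q U) :
    IsTorsionFree (diagonalConnection x y P Q) U := by
  have a0 := contDiffOn_pd hU hx
  have a1 := contDiffOn_pd hU hy
  refine ⟨contDiffOn_pi.2 fun k => contDiffOn_pi.2 fun i => contDiffOn_pi.2 fun j => ?_,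
    fun p hp k i j => ?_⟩
  · refine ((contDiffOn_wedge a0 a1).inv hw).mul (ContDiffOn.add (ContDiffOn.mul ?_ ?_)
      (ContDiffOn.mul ?_ ?_))
    · fin_cases k
      exacts [a1 1, (a1 0).neg]
    · exact (contDiffOn_pd hU (a0 j) i).add (hP.mul ((a0 i).mul (a0 j)))
    · fin_cases k
      exacts [(a0 1).neg, a0 0]
    · exact (contDiffOn_pd hU (a1 j) i).add (hQ.mul ((a1 i).mul (a1 j)))
  · simp only [diagonalConnection]
    rw [pd_comm hU hx hp i j, pd_comm hU hy hp i j]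
    ring

theorem cx_congr (hU : IsOpen U) {u v : Plane → ℝ} (h : ∀ q ∈ U, u q = v q) {p : Plane}
    (hp : p ∈ U) : cx x y u p = cx x y v p := by
  simp only [cx, wedge, dif, pd_congr hU h hp]

theorem cy_congr (hU : IsOpen U) {u v : Plane → ℝ} (h : ∀ q ∈ U, u q = v q) {p : Plane}
    (hp : p ∈ U) : cy x y u p = cy x y v p := by
  simp only [cy, wedge, dif, pd_congr hU h hp]

/-! ### Differentiation rules for ∂/∂x and ∂/∂y in the web coordinates. -/

section Rules

variable {u v : Plane → ℝ} {p : Plane}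

theorem cx_add (hu : DifferentiableAt ℝ u p) (hv : DifferentiableAt ℝ v p) :
    cx x y (fun q => u q + v q) p = cx x y u p + cx x y v p := by
  simp only [cx, wedge, dif, pd_add _ hu hv]; ring

theorem cy_add (hu : DifferentiableAt ℝ u p) (hv : DifferentiableAt ℝ v p) :
    cy x y (fun q => u q + v q) p = cy x y u p + cy x y v p := by
  simp only [cy, wedge, dif, pd_add _ hu hv]; ring

theorem cx_sub (hu : DifferentiableAt ℝ u p) (hv : DifferentiableAt ℝ v p) :
    cx x y (fun q => u q - v q) p = cx x y u p - cx x y v p := by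
  simp only [cx, wedge, dif, pd_sub _ hu hv]; ring

theorem cy_sub (hu : DifferentiableAt ℝ u p) (hv : DifferentiableAt ℝ v p) :
    cy x y (fun q => u q - v q) p = cy x y u p - cy x y v p := by
  simp only [cy, wedge, dif, pd_sub _ hu hv]; ring

theorem cy_neg : cy x y (fun q => -u q) p = -cy x y u p := by
  simp only [cy, wedge, dif, pd_neg]; ring

theorem cx_const_mul (c : ℝ) (hu : DifferentiableAt ℝ u p) :
    cx x y (fun q => c * u q) p = c * cx x y u p := by
  simp only [cx, wedge, dif, pd_const_mul _ c hu]; ring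

theorem cy_const_mul (c : ℝ) (hu : DifferentiableAt ℝ u p) :
    cy x y (fun q => c * u q) p = c * cy x y u p := by
  simp only [cy, wedge, dif, pd_const_mul _ c hu]; ring

theorem cx_mul (hu : DifferentiableAt ℝ u p) (hv : DifferentiableAt ℝ v p) :
    cx x y (fun q => u q * v q) p = cx x y u p * v p + u p * cx x y v p := by
  simp only [cx, wedge, dif, pd_mul _ hu hv]; ring

theorem cy_mul (hu : DifferentiableAt ℝ u p) (hv : DifferentiableAt ℝ v p) :
    cy x y (fun q => u q * v q) p = cy x y u p * v p + u p * cy x y v p := by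
  simp only [cy, wedge, dif, pd_mul _ hu hv]; ring

theorem cx_div (hu : DifferentiableAt ℝ u p) (hv : DifferentiableAt ℝ v p) (h0 : v p ≠ 0) :
    cx x y (fun q => u q / v q) p = (cx x y u p * v p - u p * cx x y v p) / v p ^ 2 := by
  simp only [cx, wedge, dif, pd_div _ hu hv h0]; ring

theorem cy_div (hu : DifferentiableAt ℝ u p) (hv : DifferentiableAt ℝ v p) (h0 : v p ≠ 0) :
    cy x y (fun q => u q / v q) p = (cy x y u p * v p - u p * cy x y v p) / v p ^ 2 := by
  simp only [cy, wedge, dif, pd_div _ hu hv h0]; ring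

theorem cy_inv (hv : DifferentiableAt ℝ v p) (h0 : v p ≠ 0) :
    cy x y (fun q => (v q)⁻¹) p = -cy x y v p / v p ^ 2 := by
  simp only [cy, wedge, dif, pd_inv _ hv h0]; ring

end Rules

variable (hU : IsOpen U) (hx : ContDiffOn ℝ (⊤ : ℕ∞) x U) (hy : ContDiffOn ℝ (⊤ : ℕ∞) y U)
  (hw : ∀ p ∈ U, wedge (dif x p) (dif y p) ≠ 0)
include hU hx hy hw

theorem pd_pd_eq {u : Plane → ℝ} (hu : ContDiffOn ℝ (⊤ : ℕ∞) u U) {p : Plane} (hp : p ∈ U)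
    (i j : Fin 2) : pd i (pd j u) p =
      (cx x y (cx x y u) p * pd i x p + cy x y (cx x y u) p * pd i y p) * pd j x p
      + cx x y u p * pd i (pd j x) p
      + (cx x y (cy x y u) p * pd i x p + cy x y (cy x y u) p * pd i y p) * pd j y p
      + cy x y u p * pd i (pd j y) p := by
  have d1 := diffAt hU (contDiffOn_cx hU hx hy hw hu) hp
  have d2 := diffAt hU (contDiffOn_cy hU hx hy hw hu) hp
  have d3 := diffAt hU (contDiffOn_pd hU hx j) hp
  have d4 := diffAt hU (contDiffOn_pd hU hy j) hp
  rw [pd_congr hU (fun q hq => pd_eq_cx_cy (hw q hq) u j) hp,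
    pd_add _ (d1.fun_mul d3) (d2.fun_mul d4), pd_mul _ d1 d3, pd_mul _ d2 d4,
    pd_eq_cx_cy (hw p hp) (cx x y u), pd_eq_cx_cy (hw p hp) (cy x y u)]
  ring

theorem cx_cy_comm {u : Plane → ℝ} (hu : ContDiffOn ℝ (⊤ : ℕ∞) u U) {p : Plane} (hp : p ∈ U) :
    cx x y (cy x y u) p = cy x y (cx x y u) p := by
  have h := pd_comm hU hu hp 0 1
  rw [pd_pd_eq hU hx hy hw hu hp 0 1, pd_pd_eq hU hx hy hw hu hp 1 0, pd_comm hU hx hp 1 0,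
    pd_comm hU hy hp 1 0] at h
  apply mul_right_cancel₀ (hw p hp)
  simp only [wedge, dif]
  linear_combination h

/-- Up to the factor u_x, du is dx + w dy with w = u_y/u_x, so the leaf condition is a first-order
equation for w, linear in P and Q. Two web functions therefore determine P and Q. -/
theorem leafCurvature_dif {Γ : Connection} {P Q : Plane → ℝ} (h : IsDiagonal Γ x y P Q U)
    {u : Plane → ℝ} (hu : ContDiffOn ℝ (⊤ : ℕ∞) u U) (h0 : ∀ p ∈ U, cx x y u p ≠ 0) {p : Plane}
    (hp : p ∈ U) : leafCurvature Γ (dif u) p =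
      wedge (dif x p) (dif y p) ^ 2 * cx x y u p ^ 3 *
        (cy x y (wInv x y u) p - wInv x y u p * cx x y (wInv x y u) p
          - wInv x y u p ^ 2 * P p - wInv x y u p * Q p) := by
  have s1 := contDiffOn_cx hU hx hy hw hu
  have s2 := contDiffOn_cy hU hx hy hw hu
  have d1 := diffAt hU s1 hp
  have d2 := diffAt hU s2 hp
  have n1 := h0 p hp
  have e1 : cx x y (wInv x y u) p = _ := cx_div d2 d1 n1
  have e2 : cy x y (wInv x y u) p = _ := cy_div d2 d1 n1
  rw [e1, e2, wInv]
  have hf : cx x y u p ^ 3 * ((cy x y (cy x y u) p * cx x y u p - cy x y u p * cy x y (cx x y u) p)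
      / cx x y u p ^ 2 - cy x y u p / cx x y u p *
      ((cx x y (cy x y u) p * cx x y u p - cy x y u p * cx x y (cx x y u) p) / cx x y u p ^ 2)
      - (cy x y u p / cx x y u p) ^ 2 * P p - cy x y u p / cx x y u p * Q p) =
      cx x y u p * (cy x y (cy x y u) p * cx x y u p - cy x y u p * cy x y (cx x y u) p)
      - cy x y u p * (cx x y (cy x y u) p * cx x y u p - cy x y u p * cx x y (cx x y u) p)
      - cx x y u p * cy x y u p ^ 2 * P p - cx x y u p ^ 2 * cy x y u p * Q p := by
    field_simp
  rw [mul_assoc, hf]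
  have hd : ∀ i j, pd i (fun q => dif u q j) p = pd i (pd j u) p := fun i j => rfl
  simp only [leafCurvature, tangentField, Fin.sum_univ_two, Matrix.cons_val, hd,
    pd_pd_eq hU hx hy hw hu hp, h.hessian_fst p hp, h.hessian_snd p hp]
  simp only [dif, wedge, pd_eq_cx_cy (hw p hp) u]
  ring

end Coordinates

theorem IsDiagonal.leafCurvature_fst {Γ : Connection} {U : Set Plane} {x y P Q : Plane → ℝ}
    (h : IsDiagonal Γ x y P Q U) {p : Plane} (hp : p ∈ U) : leafCurvature Γ (dif x) p = 0 := by
  have hd : ∀ i j, pd i (fun q => dif x q j) p = pd i (pd j x) p := fun i j => rfl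
  simp only [leafCurvature, tangentField, Fin.sum_univ_two, Matrix.cons_val, hd, h.hessian_fst p hp]
  simp only [dif]
  ring

theorem IsDiagonal.leafCurvature_snd {Γ : Connection} {U : Set Plane} {x y P Q : Plane → ℝ}
    (h : IsDiagonal Γ x y P Q U) {p : Plane} (hp : p ∈ U) : leafCurvature Γ (dif y) p = 0 := by
  have hd : ∀ i j, pd i (fun q => dif y q j) p = pd i (pd j y) p := fun i j => rfl
  simp only [leafCurvature, tangentField, Fin.sum_univ_two, Matrix.cons_val, hd, h.hessian_snd p hp]
  simp only [dif]
  ring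

theorem IsWebFunction.wedge_dif_ne_zero {θ η : OneForm} {u v : Plane → ℝ} {V : Set Plane}
    (hu : IsWebFunction θ u V) (hv : IsWebFunction η v V)
    (hg : ∀ p ∈ V, wedge (θ p) (η p) ≠ 0) : ∀ p ∈ V, wedge (dif u p) (dif v p) ≠ 0 := by
  intro p hp h
  have hθ : θ p ≠ 0 := fun h0 => hg p hp (by simp [wedge, h0])
  have a := hu.wedge_eq_zero p hp
  have b := hv.wedge_eq_zero p hp
  have c : wedge (dif v p) (θ p) = 0 := by
    refine eq_zero_of_wedge_eq_zero h ?_ (hu.ne_zero p hp)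
    simp only [wedge] at a ⊢
    linear_combination -a
  apply hg p hp
  refine eq_zero_of_wedge_eq_zero c ?_ (hv.ne_zero p hp)
  simp only [wedge] at b ⊢
  linear_combination -b

/-- The tensor is evaluated on a diagonal connection in the same projective class, where only P_y,
Q_x and their first derivatives enter. -/
theorem liouville_formula {θ : Fin 4 → OneForm} {V : Set Plane} (hV : IsOpen V)
    (hθ : IsWeb θ V) {x y f g : Plane → ℝ} (hx : IsWebFunction (θ 0) x V)
    (hy : IsWebFunction (θ 1) y V) (hf : IsWebFunction (θ 2) f V) (hg : IsWebFunction (θ 3) g V)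
    {Γ : Connection} (hΓ : IsTorsionFree Γ V) (hgeo : ∀ i, IsGeodesicFoliation Γ (θ i) V)
    {p : Plane} (hp : p ∈ V) (i j k : Fin 2) :
    liouville Γ i j k p = -(liouvilleL1 x y f g p * pd k x p + liouvilleL2 x y f g p * pd k y p) *
      (pd i x p * pd j y p - pd j x p * pd i y p) := by
  have gp : ∀ i j, i ≠ j → ∀ q ∈ V, wedge (θ i q) (θ j q) ≠ 0 := fun i j hij q hq =>
    hθ.generalPosition q hq i j hij
  have hw := hx.wedge_dif_ne_zero hy (gp 0 1 (by decide))
  have f1 : ∀ q ∈ V, cx x y f q ≠ 0 := fun q hq =>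
    div_ne_zero (hf.wedge_dif_ne_zero hy (gp 2 1 (by decide)) q hq) (hw q hq)
  have f2 : ∀ q ∈ V, cy x y f q ≠ 0 := fun q hq =>
    div_ne_zero (hx.wedge_dif_ne_zero hf (gp 0 2 (by decide)) q hq) (hw q hq)
  have g1 : ∀ q ∈ V, cx x y g q ≠ 0 := fun q hq =>
    div_ne_zero (hg.wedge_dif_ne_zero hy (gp 3 1 (by decide)) q hq) (hw q hq)
  have g2 : ∀ q ∈ V, cy x y g q ≠ 0 := fun q hq =>
    div_ne_zero (hx.wedge_dif_ne_zero hg (gp 0 3 (by decide)) q hq) (hw q hq)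
  have fg : ∀ q ∈ V, cx x y f q * cy x y g q - cy x y f q * cx x y g q ≠ 0 := fun q hq h0 => by
    apply hf.wedge_dif_ne_zero hg (gp 2 3 (by decide)) q hq
    simp only [wedge, dif, pd_eq_cx_cy (hw q hq) f, pd_eq_cx_cy (hw q hq) g]
    linear_combination (pd 0 x q * pd 1 y q - pd 1 x q * pd 0 y q) * h0
  have sX : ∀ {u : Plane → ℝ}, ContDiffOn ℝ (⊤ : ℕ∞) u V → ContDiffOn ℝ (⊤ : ℕ∞) (cx x y u) V :=
    fun hu => contDiffOn_cx hV hx.smooth hy.smooth hw hu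
  have sY : ∀ {u : Plane → ℝ}, ContDiffOn ℝ (⊤ : ℕ∞) u V → ContDiffOn ℝ (⊤ : ℕ∞) (cy x y u) V :=
    fun hu => contDiffOn_cy hV hx.smooth hy.smooth hw hu
  have dV : ∀ {u : Plane → ℝ}, ContDiffOn ℝ (⊤ : ℕ∞) u V → ∀ q ∈ V, DifferentiableAt ℝ u q :=
    fun hu q hq => diffAt hV hu hq
  set w : Plane → ℝ := wInv x y f with hwdef
  set b : Plane → ℝ := wInv x y g with hbdef
  set a : Plane → ℝ := aInv x y f g with hadef
  set α : Plane → ℝ := alphaInv x y f g with hαdef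
  have sw : ContDiffOn ℝ (⊤ : ℕ∞) w V := (sY hf.smooth).div (sX hf.smooth) f1
  have sb : ContDiffOn ℝ (⊤ : ℕ∞) b V := (sY hg.smooth).div (sX hg.smooth) g1
  have sa : ContDiffOn ℝ (⊤ : ℕ∞) a V :=
    ((sY hf.smooth).mul (sX hg.smooth)).div ((sX hf.smooth).mul (sY hg.smooth))
      fun q hq => mul_ne_zero (f1 q hq) (g2 q hq)
  have w0 : ∀ q ∈ V, w q ≠ 0 := fun q hq => div_ne_zero (f2 q hq) (f1 q hq)
  have b0 : ∀ q ∈ V, b q ≠ 0 := fun q hq => div_ne_zero (g2 q hq) (g1 q hq)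
  have a0 : ∀ q ∈ V, a q ≠ 0 := fun q hq =>
    div_ne_zero (mul_ne_zero (f2 q hq) (g1 q hq)) (mul_ne_zero (f1 q hq) (g2 q hq))
  have a1 : ∀ q ∈ V, 1 - a q ≠ 0 := fun q hq h0 => by
    apply fg q hq
    have : cy x y f q * cx x y g q / (cx x y f q * cy x y g q) = 1 := by
      change a q = 1
      linarith
    rw [div_eq_one_iff_eq (mul_ne_zero (f1 q hq) (g2 q hq))] at this
    linarith
  have hwab : ∀ q ∈ V, w q = a q * b q := fun q hq => by
    simp only [hwdef, hadef, hbdef, wInv, aInv]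
    have := f1 q hq
    have := g1 q hq
    have := g2 q hq
    field_simp
  have hden : ∀ q ∈ V, w q * a q * (1 - a q) ≠ 0 := fun q hq =>
    mul_ne_zero (mul_ne_zero (w0 q hq) (a0 q hq)) (a1 q hq)
  have sα : ContDiffOn ℝ (⊤ : ℕ∞) α V :=
    ((sa.mul (sY sa)).sub (sw.mul (sX sa))).div ((sw.mul sa).mul (contDiffOn_const.sub sa)) hden
  -- These solve w²P + wQ = w_y - w w_x together with the same equation for b = w/a, the condition
  -- coming from g. The solution is unique because w and b are nonzero and a ≠ 1.
  set P : Plane → ℝ := fun q => -(α q + cx x y w q / w q) with hPdef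
  set Q : Plane → ℝ := fun q => cy x y w q / w q + w q * α q with hQdef
  have swx : ContDiffOn ℝ (⊤ : ℕ∞) (fun q => cx x y w q / w q) V := (sX sw).div sw w0
  have swy : ContDiffOn ℝ (⊤ : ℕ∞) (fun q => cy x y w q / w q) V := (sY sw).div sw w0
  have sP : ContDiffOn ℝ (⊤ : ℕ∞) P V := (sα.add swx).neg
  have sQ : ContDiffOn ℝ (⊤ : ℕ∞) Q V := swy.add (sw.mul sα)
  have hD := isDiagonal_diagonalConnection hx.smooth hy.smooth hw sP sQ
  have hT := isTorsionFree_diagonalConnection hV hx.smooth hy.smooth hw sP sQ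
  set Γ' := diagonalConnection x y P Q
  -- the four foliations are geodesic for the diagonal connection
  have hlc : ∀ {η : OneForm} {u : Plane → ℝ}, IsWebFunction η u V → (∀ q ∈ V, η q ≠ 0) →
      ContDiffOn ℝ (⊤ : ℕ∞) η V → (∀ q ∈ V, leafCurvature Γ' (dif u) q = 0) →
      ∀ q ∈ V, leafCurvature Γ' η q = 0 := by
    intro η u hu h0 hs hl
    refine (isGeodesicFoliation_iff hV hs h0).1 (isGeodesicFoliation_congr (θ := dif u) h0
      (fun q hq => ?_) ((isGeodesicFoliation_iff hV ?_ hu.ne_zero).2 hl))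
    · have := hu.wedge_eq_zero q hq
      simp only [wedge] at this ⊢
      linear_combination -this
    · exact contDiffOn_pi.2 fun j => contDiffOn_pd hV hu.smooth j
  have hη := hθ.ne_zero (by norm_num)
  have hgeo' : ∀ i, ∀ q ∈ V, leafCurvature Γ' (θ i) q = 0 := by
    intro i
    fin_cases i
    · exact hlc hx (hη 0) (hθ.smooth 0) fun q hq => hD.leafCurvature_fst hq
    · exact hlc hy (hη 1) (hθ.smooth 1) fun q hq => hD.leafCurvature_snd hq
    · refine hlc hf (hη 2) (hθ.smooth 2) fun q hq => ?_
      rw [leafCurvature_dif hV hx.smooth hy.smooth hw hD hf.smooth f1 hq]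
      refine mul_eq_zero_of_right _ ?_
      have := w0 q hq
      change cy x y w q - w q * cx x y w q - w q ^ 2 * -(α q + cx x y w q / w q)
        - w q * (cy x y w q / w q + w q * α q) = 0
      field_simp
      ring
    · refine hlc hg (hη 3) (hθ.smooth 3) fun q hq => ?_
      rw [leafCurvature_dif hV hx.smooth hy.smooth hw hD hg.smooth g1 hq]
      refine mul_eq_zero_of_right _ ?_
      change cy x y b q - b q * cx x y b q - b q ^ 2 * -(α q + cx x y w q / w q)
        - b q * (cy x y w q / w q + w q * α q) = 0
      have hα : α q = (a q * cy x y a q - w q * cx x y a q) / (w q * a q * (1 - a q)) := rfl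
      rw [hα, cx_congr hV hwab hq, cy_congr hV hwab hq, cx_mul (dV sa q hq) (dV sb q hq),
        cy_mul (dV sa q hq) (dV sb q hq), hwab q hq]
      have := a0 q hq
      have := a1 q hq
      have := b0 q hq
      field_simp
      ring
  -- Both connections make the same 4-web geodesic, so uniqueness identifies their projective
  -- classes.
  have hrel : ProjRel V Γ' Γ := projRel_of_leafCurvature_eq_zero hT hΓ hθ hgeo' fun i =>
    (isGeodesicFoliation_iff hV (hθ.smooth i) (hη i)).1 (hgeo i)
  rw [liouville_projRel hV hT hrel hp, hD.liouville_eq hV hT hp]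
  -- explicit evaluation
  set κ : Plane → ℝ := kInv x y f with hκdef
  have sκ : ContDiffOn ℝ (⊤ : ℕ∞) κ V := sY swx
  have hκ : ∀ q ∈ V, κ q = (cy x y (cx x y w) q * w q - cx x y w q * cy x y w q) / w q ^ 2 :=
    fun q hq => cy_div (dV (sX sw) q hq) (dV sw q hq) (w0 q hq)
  -- The curvature k enters twice: through (w_x/w)_y in P_y and, after mixed derivatives of w are
  -- exchanged, through (w_y/w)_x in Q_x.
  have hPy : ∀ q ∈ V, cy x y P q = -(cy x y α q + κ q) := fun q hq => by
    simp only [hPdef]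
    rw [cy_neg, cy_add (dV sα q hq) (dV swx q hq)]
    rfl
  have hQx : ∀ q ∈ V, cx x y Q q = κ q + (cx x y w q * α q + w q * cx x y α q) := fun q hq => by
    simp only [hQdef]
    rw [cx_add (dV swy q hq) ((dV sw q hq).fun_mul (dV sα q hq)), cx_mul (dV sw q hq) (dV sα q hq),
      cx_div (dV (sY sw) q hq) (dV sw q hq) (w0 q hq), hκ q hq,
      cx_cy_comm hV hx.smooth hy.smooth hw sw hq]
    ring
  have hA : ∀ q ∈ V, 2 * cy x y P q + cx x y Q q =
      cx x y w q * α q + w q * cx x y α q - κ q - 2 * cy x y α q := fun q hq => by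
    rw [hPy q hq, hQx q hq]; ring
  have hB : ∀ q ∈ V, 2 * cx x y Q q + cy x y P q =
      κ q + 2 * (cx x y w q * α q + w q * cx x y α q) - cy x y α q := fun q hq => by
    rw [hPy q hq, hQx q hq]; ring
  have dw := dV sw p hp
  have dα := dV sα p hp
  have dκ := dV sκ p hp
  have dwx := dV (sX sw) p hp
  have dαx := dV (sX sα) p hp
  have dαy := dV (sY sα) p hp
  have d1 := dwx.fun_mul dα
  have d2 := dw.fun_mul dαx
  have wp := w0 p hp
  rw [cx_congr hV hA hp, cy_congr hV hB hp, hA p hp, hB p hp,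
    cx_sub ((d1.fun_add d2).fun_sub dκ) (dαy.const_mul 2), cx_sub (d1.fun_add d2) dκ,
    cx_add d1 d2, cx_mul dwx dα, cx_mul dw dαx, cx_const_mul _ dαy,
    cy_sub (dκ.fun_add ((d1.fun_add d2).const_mul 2)) dαy,
    cy_add dκ ((d1.fun_add d2).const_mul 2), cy_const_mul _ (d1.fun_add d2),
    cy_add d1 d2, cy_mul dwx dα, cy_mul dw dαx, cx_cy_comm hV hx.smooth hy.smooth hw sα hp]
  have hL1 : liouvilleL1 x y f g p = 1 / 3 *
      (cx x y (cx x y w) p * α p + cx x y w p * cx x y α p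
        + (cx x y w p * cx x y α p + w p * cx x y (cx x y α) p)
        - cx x y κ p - 2 * cy x y (cx x y α) p - P p *
        (cx x y w p * α p + w p * cx x y α p - κ p - 2 * cy x y α p)) := by
    simp only [liouvilleL1, ← hwdef, ← hαdef, ← hκdef, hPdef]
    rw [cx_mul dκ dw, hκ p hp]
    field_simp
    ring
  have hL2 : liouvilleL2 x y f g p = -(1 / 3) *
      (cy x y κ p + 2 * (cy x y (cx x y w) p * α p + cx x y w p * cy x y α p
        + (cy x y w p * cx x y α p + w p * cy x y (cx x y α) p))
        - cy x y (cy x y α) p - Q p *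
        (κ p + 2 * (cx x y w p * α p + w p * cx x y α p) - cy x y α p)) := by
    simp only [liouvilleL2, ← hwdef, ← hαdef, ← hκdef, hQdef]
    rw [cy_mul dκ (dw.fun_inv wp), cy_inv dw wp, hκ p hp]
    field_simp
    ring
  rw [hL1, hL2]
  ring

/-! ### Parallel sections of flat linear connections -/

section Frobenius

variable {E F : Type*} [NormedAddCommGroup E] [NormedSpace ℝ E]
  [NormedAddCommGroup F] [NormedSpace ℝ F]

/-- Grönwall's inequality with rate 1 over unit time; 3 is a convenient bound for e. -/
theorem norm_le_of_norm_deriv_le {z z' : ℝ → E} {δ ε : ℝ} (hδ : 0 ≤ δ) (hε : 0 ≤ ε)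
    (hz : ∀ t ∈ Icc (0 : ℝ) 1, HasDerivWithinAt z (z' t) (Icc 0 1) t) (h0 : ‖z 0‖ ≤ δ)
    (hb : ∀ t ∈ Icc (0 : ℝ) 1, ‖z' t‖ ≤ ‖z t‖ + ε) {t : ℝ} (ht : t ∈ Icc (0 : ℝ) 1) :
    ‖z t‖ ≤ 3 * (δ + ε) := by
  have h := norm_le_gronwallBound_of_norm_deriv_right_le (K := 1) (δ := δ) (ε := ε)
    (fun t ht => (hz t ht).continuousWithinAt)
    (fun t ht => (hz t (Ico_subset_Icc_self ht)).mono_of_mem_nhdsWithin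
      (Icc_mem_nhdsGE_of_mem ht)) h0
    (fun t ht => by rw [one_mul]; exact hb t (Ico_subset_Icc_self ht)) t ht
  rw [gronwallBound_of_K_ne_0 one_ne_zero] at h
  have he : Real.exp (1 * (t - 0)) ≤ 3 := by
    refine (Real.exp_le_exp.2 (by linarith [ht.2] : 1 * (t - 0) ≤ 1)).trans ?_
    linarith [Real.exp_one_lt_d9]
  have h1 : 1 ≤ Real.exp (1 * (t - 0)) := Real.one_le_exp (by linarith [ht.1])
  simp only [div_one] at h
  nlinarith

/-- Solutions of a linear equation on `[0, 1]` whose coefficient is small. -/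
theorem exists_linear_solution [CompleteSpace E] {B : ℝ → E →L[ℝ] E}
    (hB : ContinuousOn B (Icc 0 1)) (y₀ : E)
    (hn : ∀ t ∈ Icc (0 : ℝ) 1, ‖B t‖ * (‖y₀‖ + 1) ≤ 1) :
    ∃ z : ℝ → E, z 0 = y₀ ∧
      ∀ t ∈ Icc (0 : ℝ) 1, HasDerivWithinAt z (B t (z t)) (Icc 0 1) t := by
  have hB1 : ∀ t ∈ Icc (0 : ℝ) 1, ‖B t‖ ≤ 1 := fun t ht => by
    nlinarith [hn t ht, norm_nonneg (B t), norm_nonneg y₀]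
  -- By the smallness hypothesis the vector field has norm at most 1 on the closed unit ball about
  -- y₀, so a solution cannot leave the ball in unit time. The parameter 0 is the radius of initial
  -- values: only y₀ is used.
  have hpl : IsPicardLindelof (fun t y => B t y) (tmin := 0) (tmax := 1)
      ⟨0, by simp⟩ y₀ 1 0 1 1 :=
    { lipschitzOnWith := fun t ht => by
        refine ((B t).lipschitz.weaken ?_).lipschitzOnWith
        exact hB1 t ht
      continuousOn := fun y _ => hB.clm_apply continuousOn_const
      norm_le := fun t ht y hy => by
        have h1 : ‖y‖ ≤ ‖y₀‖ + 1 := by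
          have := norm_sub_norm_le y y₀
          have h2 : ‖y - y₀‖ ≤ 1 := by simpa [dist_eq_norm] using hy
          linarith
        calc ‖B t y‖ ≤ ‖B t‖ * ‖y‖ := (B t).le_opNorm y
          _ ≤ ‖B t‖ * (‖y₀‖ + 1) := by gcongr
          _ ≤ _ := by simpa using hn t ht
      mul_max_le := by simp }
  exact hpl.exists_eq_forall_mem_Icc_hasDerivWithinAt₀

/-- If `Y` has a quadratic remainder then it is differentiable. -/
theorem hasFDerivAt_of_norm_sub_le {Y : F → E} {L : F →L[ℝ] E} {q : F} {K r : ℝ} (hr : 0 < r)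
    (h : ∀ v, ‖v‖ < r → ‖Y (q + v) - Y q - L v‖ ≤ K * ‖v‖ ^ 2) : HasFDerivAt Y L q := by
  have h0 : HasFDerivAt (fun x => Y x - Y q - L (x - q)) (0 : F →L[ℝ] E) q := by
    refine Asymptotics.IsBigO.hasFDerivAt (n := 2) ?_ (by norm_num)
    refine Asymptotics.IsBigO.of_bound K ?_
    filter_upwards [Metric.ball_mem_nhds q hr] with x hx
    have := h (x - q) (by simpa [dist_eq_norm] using hx)
    simpa using this
  have h1 : HasFDerivAt (fun x => Y q + L (x - q)) L q := by
    simpa using (L.hasFDerivAt.comp q ((hasFDerivAt_id q).sub_const q)).const_add (Y q)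
  have h2 := h0.fun_add h1
  rw [zero_add] at h2
  refine h2.congr_of_eventuallyEq (Eventually.of_forall fun x => ?_)
  simp only
  abel

/-- The mean value inequality on the segment from x to y, comparing the derivative there with its
value at x. -/
theorem norm_taylor_le {G : Type*} [NormedAddCommGroup G] [NormedSpace ℝ G] {f : F → G} {s : Set F}
    (hs : Convex ℝ s) (hf : ∀ x ∈ s, DifferentiableAt ℝ f x) {C : ℝ} (hC : 0 ≤ C)
    (hl : ∀ x ∈ s, ∀ y ∈ s, ‖fderiv ℝ f x - fderiv ℝ f y‖ ≤ C * ‖x - y‖) {x y : F} (hx : x ∈ s)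
    (hy : y ∈ s) : ‖f y - f x - fderiv ℝ f x (y - x)‖ ≤ C * ‖y - x‖ ^ 2 := by
  have hsub : segment ℝ x y ⊆ s := hs.segment_subset hx hy
  have h := (convex_segment x y).norm_image_sub_le_of_norm_hasFDerivWithin_le'
    (f := f) (f' := fderiv ℝ f) (φ := fderiv ℝ f x) (C := C * ‖y - x‖)
    (fun z hz => (hf z (hsub hz)).hasFDerivAt.hasFDerivWithinAt)
    (fun z hz => (hl z (hsub hz) x hx).trans (by
      have hz' := norm_sub_le_of_mem_segment hz
      gcongr))
    (left_mem_segment ℝ x y) (right_mem_segment ℝ x y)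
  linarith

theorem hasDerivAt_comp_line {f : F → E} {p v : F} {t : ℝ} (hf : DifferentiableAt ℝ f (p + t • v)) :
    HasDerivAt (fun s : ℝ => f (p + s • v)) (fderiv ℝ f (p + t • v) v) t :=
  hf.hasFDerivAt.comp_hasDerivAt t
    (by simpa using ((hasDerivAt_id t).smul_const v).const_add p)

/-- Along each ray p + tv the equation is an ordinary linear one with solution z_v, and Y(p + v) =
z_v(1). The defect z_{v+h} - z_v - Ω(th)z_v satisfies, because of flatness, the equation of the ray
v up to an error of order |h|². Grönwall's inequality bounds it by a multiple of |h|², which is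
differentiability of Y with the required derivative. -/
theorem exists_parallel_section [CompleteSpace E] {Ω : F → F →L[ℝ] E →L[ℝ] E} {U : Set F}
    (hU : IsOpen U) (hΩ : ContDiffOn ℝ 2 Ω U)
    (hflat : ∀ q ∈ U, ∀ (u v : F) (z : E), fderiv ℝ Ω q u v z + Ω q v (Ω q u z) =
      fderiv ℝ Ω q v u z + Ω q u (Ω q v z)) {p : F} (hp : p ∈ U) (y₀ : E) :
    ∃ r > 0, Metric.ball p r ⊆ U ∧ ∃ Y : F → E, Y p = y₀ ∧
      ∀ q ∈ Metric.ball p r, HasFDerivAt Y ((Ω q).flip (Y q)) q := by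
  have hΩp : ContDiffAt ℝ 2 Ω p := hΩ.contDiffAt (hU.mem_nhds hp)
  obtain ⟨K₁, s₁, hs₁, hl₁⟩ := (hΩp.of_le (by norm_num : (1 : WithTop ℕ∞) ≤ 2)).exists_lipschitzOnWith
  obtain ⟨K₂, s₂, hs₂, hl₂⟩ :=
    (hΩp.fderiv_right (m := 1) (by norm_num)).exists_lipschitzOnWith
  have hc : ContinuousAt Ω p := hΩp.continuousAt
  have hcn : Tendsto (fun q => ‖Ω q‖) (𝓝 p) (𝓝 ‖Ω p‖) := 
    ((@continuous_norm (F →L[ℝ] E →L[ℝ] E) _).tendsto _).comp hc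
  have hs₃ : ∀ᶠ q in 𝓝 p, ‖Ω q‖ < ‖Ω p‖ + 1 :=
    hcn.eventually_lt_const (lt_add_one _)
  obtain ⟨R, hR, hRs⟩ := Metric.mem_nhds_iff.1
    (inter_mem (inter_mem hs₁ hs₂) (inter_mem hs₃ (hU.mem_nhds hp)))
  -- A single constant dominates the norm of Ω and the Lipschitz constants of Ω and of its
  -- derivative near p.
  obtain ⟨C, hC⟩ : ∃ C : ℝ, C = K₁ + K₂ + (‖Ω p‖ + 1) := ⟨_, rfl⟩
  have hK₁ : (K₁ : ℝ) ≤ C := by linarith [K₂.coe_nonneg, norm_nonneg (Ω p)]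
  have hK₂ : (K₂ : ℝ) ≤ C := by linarith [K₁.coe_nonneg, norm_nonneg (Ω p)]
  have hΩC : ‖Ω p‖ + 1 ≤ C := by linarith [K₁.coe_nonneg, K₂.coe_nonneg]
  have hC1 : 1 ≤ C := by linarith [norm_nonneg (Ω p)]
  have hC0 : 0 ≤ C := by linarith
  have bΩ : ∀ q ∈ Metric.ball p R, ‖Ω q‖ ≤ C := fun q hq => (hRs hq).2.1.le.trans hΩC
  have lΩ : ∀ q ∈ Metric.ball p R, ∀ q' ∈ Metric.ball p R, ‖Ω q - Ω q'‖ ≤ C * ‖q - q'‖ :=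
    fun q hq q' hq' => (hl₁.norm_sub_le (hRs hq).1.1 (hRs hq').1.1).trans (by gcongr)
  have dΩ : ∀ q ∈ Metric.ball p R, DifferentiableAt ℝ Ω q := fun q hq =>
    (hΩ.contDiffAt (hU.mem_nhds (hRs hq).2.2)).differentiableAt (by norm_num)
  have tΩ : ∀ q ∈ Metric.ball p R, ∀ q' ∈ Metric.ball p R,
      ‖Ω q' - Ω q - fderiv ℝ Ω q (q' - q)‖ ≤ C * ‖q' - q‖ ^ 2 := fun q hq q' hq' =>
    norm_taylor_le (convex_ball p R) dΩ hC0 (fun a ha b hb =>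
      (hl₂.norm_sub_le (hRs ha).1.2 (hRs hb).1.2).trans (by gcongr)) hq hq'
  -- The bound r ≤ 1 lets ‖v‖ be replaced by 1 in the estimates; the last bound is the smallness
  -- needed to solve along a whole ray.
  obtain ⟨r, hr0, hrR, hr1, hrC⟩ : ∃ r : ℝ, 0 < r ∧ r ≤ R ∧ r ≤ 1 ∧ C * r * (‖y₀‖ + 1) ≤ 1 := by
    have hpos : 0 < C * (‖y₀‖ + 1) := by positivity
    refine ⟨min R (min 1 (1 / (C * (‖y₀‖ + 1)))), by positivity, min_le_left _ _,
      (min_le_right _ _).trans (min_le_left _ _), ?_⟩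
    calc C * min R (min 1 (1 / (C * (‖y₀‖ + 1)))) * (‖y₀‖ + 1)
        = C * (‖y₀‖ + 1) * min R (min 1 (1 / (C * (‖y₀‖ + 1)))) := by ring
      _ ≤ C * (‖y₀‖ + 1) * (1 / (C * (‖y₀‖ + 1))) := by
        gcongr
        exact (min_le_right _ _).trans (min_le_right _ _)
      _ = 1 := mul_one_div_cancel hpos.ne'
  have hmem : ∀ v : F, ‖v‖ < r → ∀ t ∈ Icc (0 : ℝ) 1, p + t • v ∈ Metric.ball p R := by
    intro v hv t ht
    rw [Metric.mem_ball, dist_eq_norm, add_sub_cancel_left, norm_smul, Real.norm_of_nonneg ht.1]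
    calc t * ‖v‖ ≤ 1 * ‖v‖ := by gcongr; exact ht.2
      _ < R := by linarith
  have hBn : ∀ v : F, ‖v‖ < r → ∀ t ∈ Icc (0 : ℝ) 1, ‖Ω (p + t • v) v‖ ≤ C * r := by
    intro v hv t ht
    calc _ ≤ ‖Ω (p + t • v)‖ * ‖v‖ := ContinuousLinearMap.le_opNorm _ _
      _ ≤ C * r := by gcongr; exact bΩ _ (hmem v hv t ht)
  have hex : ∀ v : F, ∃ z : ℝ → E, z 0 = y₀ ∧ (‖v‖ < r →
      ∀ t ∈ Icc (0 : ℝ) 1, HasDerivWithinAt z (Ω (p + t • v) v (z t)) (Icc 0 1) t) := by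
    intro v
    by_cases hv : ‖v‖ < r
    · obtain ⟨z, hz0, hz⟩ := exists_linear_solution (B := fun t => Ω (p + t • v) v) (fun t ht =>
        ((hasDerivAt_comp_line (E := F →L[ℝ] E →L[ℝ] E) (f := Ω) (dΩ _ (hmem v hv t ht))).continuousAt.clm_apply
          continuousAt_const).continuousWithinAt) y₀ fun t ht =>
        (mul_le_mul_of_nonneg_right (hBn v hv t ht) (by positivity)).trans hrC
      exact ⟨z, hz0, fun _ => hz⟩
    · exact ⟨fun _ => y₀, rfl, fun h => absurd h hv⟩
  choose z hz0 hz using hex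
  have hCr : C * r ≤ 1 := by nlinarith [norm_nonneg y₀, mul_nonneg hC0 hr0.le]
  have hB1 : ∀ v : F, ‖v‖ < r → ∀ t ∈ Icc (0 : ℝ) 1, ∀ x : E, ‖Ω (p + t • v) v x‖ ≤ ‖x‖ := by
    intro v hv t ht x
    calc _ ≤ ‖Ω (p + t • v) v‖ * ‖x‖ := ContinuousLinearMap.le_opNorm _ _
      _ ≤ 1 * ‖x‖ := by gcongr; exact (hBn v hv t ht).trans hCr
      _ = ‖x‖ := one_mul _
  obtain ⟨M, hM⟩ : ∃ M : ℝ, M = 3 * (‖y₀‖ + 0) := ⟨_, rfl⟩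
  have hM0 : 0 ≤ M := by rw [hM]; positivity
  have hzM : ∀ v : F, ‖v‖ < r → ∀ t ∈ Icc (0 : ℝ) 1, ‖z v t‖ ≤ M := fun v hv t ht => by
    rw [hM]
    exact norm_le_of_norm_deriv_le (norm_nonneg _) le_rfl (hz v hv) (by rw [hz0])
      (fun t ht => by rw [add_zero]; exact hB1 v hv t ht _) ht
  -- the differences of the base points
  have hsub : ∀ (v h : F), ∀ t ∈ Icc (0 : ℝ) 1,
      (p + t • (v + h)) - (p + t • v) = t • h ∧ ‖(p + t • (v + h)) - (p + t • v)‖ ≤ ‖h‖ := by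
    intro v h t ht
    have e : (p + t • (v + h)) - (p + t • v) = t • h := by rw [smul_add]; abel
    refine ⟨e, ?_⟩
    rw [e, norm_smul, Real.norm_of_nonneg ht.1]
    exact mul_le_of_le_one_left (norm_nonneg _) ht.2
  have ap3 : ∀ (A : F →L[ℝ] E →L[ℝ] E) (v : F) (x : E) (a b c : ℝ), 0 ≤ a → 0 ≤ b →
      ‖A‖ ≤ a → ‖v‖ ≤ b → ‖x‖ ≤ c → ‖A v x‖ ≤ a * b * c := by
    intro A v x a b c ha hb hA hv hx
    calc ‖A v x‖ ≤ ‖A‖ * ‖v‖ * ‖x‖ := A.le_opNorm₂ v x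
      _ ≤ a * b * c := by gcongr
  -- First-order estimate: solutions on neighbouring rays differ by O(|h|).
  have hW : ∀ v h : F, ‖v‖ < r → ‖v + h‖ < r → ∀ t ∈ Icc (0 : ℝ) 1,
      ‖z (v + h) t - z v t‖ ≤ 6 * C * M * ‖h‖ := by
    intro v h hv hvh t ht
    have := norm_le_of_norm_deriv_le (z := fun t => z (v + h) t - z v t) (δ := 0)
      (ε := 2 * C * M * ‖h‖) le_rfl (by positivity)
      (fun t ht => (hz _ hvh t ht).fun_sub (hz _ hv t ht)) (by simp [hz0]) (fun t ht => ?_) ht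
    · linarith
    · set A := Ω (p + t • v)
      set A' := Ω (p + t • (v + h))
      have e : A' (v + h) (z (v + h) t) - A v (z v t) = A' (v + h) (z (v + h) t - z v t)
          + ((A' - A) (v + h) (z v t) + A h (z v t)) := by
        simp only [map_sub, map_add, sub_apply, add_apply]
        abel
      rw [e]
      have hA' : ‖A' - A‖ ≤ C * ‖h‖ := (lΩ _ (hmem _ hvh t ht) _ (hmem _ hv t ht)).trans
        (by gcongr; exact (hsub v h t ht).2)
      have b1 := ap3 (A' - A) (v + h) (z v t) (C * ‖h‖) 1 M (by positivity) zero_le_one hA'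
        (hvh.le.trans hr1) (hzM v hv t ht)
      have b2 := ap3 A h (z v t) C ‖h‖ M hC0 (norm_nonneg _) (bΩ _ (hmem _ hv t ht)) le_rfl
        (hzM v hv t ht)
      refine (norm_add_le _ _).trans (add_le_add (hB1 _ hvh t ht _) ((norm_add_le _ _).trans ?_))
      linarith
  -- Second-order estimate, for the defect after its expected linear part is removed.
  have hD : ∀ v h : F, ‖v‖ < r → ‖v + h‖ < r →
      ‖z (v + h) 1 - z v 1 - Ω (p + v) h (z v 1)‖ ≤ 3 * (2 * C * M + 12 * C ^ 2 * M) * ‖h‖ ^ 2 := by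
    intro v h hv hvh
    have h1 : (1 : ℝ) ∈ Icc (0 : ℝ) 1 := by simp
    have := norm_le_of_norm_deriv_le
      (z := fun t => z (v + h) t - z v t - Ω (p + t • v) (t • h) (z v t))
      (z' := fun t => Ω (p + t • (v + h)) (v + h) (z (v + h) t) - Ω (p + t • v) v (z v t)
        - ((fderiv ℝ Ω (p + t • v) v (t • h) + Ω (p + t • v) h) (z v t)
          + Ω (p + t • v) (t • h) (Ω (p + t • v) v (z v t)))) (δ := 0)
      (ε := (2 * C * M + 12 * C ^ 2 * M) * ‖h‖ ^ 2) le_rfl (by positivity)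
      (fun t ht => ?_) (by simp [hz0]) (fun t ht => ?_) h1
    · simp only [one_smul, zero_add] at this
      linarith
    · refine ((hz _ hvh t ht).fun_sub (hz _ hv t ht)).fun_sub (HasDerivWithinAt.clm_apply ?_ (hz _ hv t ht))
      have c1 : HasDerivAt (fun t : ℝ => Ω (p + t • v)) (fderiv ℝ Ω (p + t • v) v) t :=
        hasDerivAt_comp_line (E := F →L[ℝ] E →L[ℝ] E) (f := Ω) (dΩ _ (hmem v hv t ht))
      have c2 : HasDerivAt (fun t : ℝ => t • h) h t := by
        simpa using (hasDerivAt_id t).smul_const h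
      exact (c1.clm_apply c2).hasDerivWithinAt
    -- Flatness for the vectors v and th exchanges the order of differentiation and composition, so
    -- that the principal term becomes Ω(v) applied to the defect. All other terms are quadratic in
    -- h.
    · have hfl := hflat _ (hRs (hmem v hv t ht)).2.2 v (t • h) (z v t)
      have htay := tΩ _ (hmem v hv t ht) _ (hmem _ hvh t ht)
      rw [(hsub v h t ht).1] at htay
      have hA' : ‖Ω (p + t • (v + h)) - Ω (p + t • v)‖ ≤ C * ‖h‖ :=
        (lΩ _ (hmem _ hvh t ht) _ (hmem _ hv t ht)).trans (by gcongr; exact (hsub v h t ht).2)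
      have hAC := bΩ _ (hmem v hv t ht)
      have hWt := hW v h hv hvh t ht
      have hth : ‖t • h‖ ≤ ‖h‖ := by
        rw [norm_smul, Real.norm_of_nonneg ht.1]
        exact mul_le_of_le_one_left (norm_nonneg _) ht.2
      have hvr := hB1 v hv t ht (z (v + h) t - z v t - Ω (p + t • v) (t • h) (z v t))
      set A := Ω (p + t • v)
      set A' := Ω (p + t • (v + h))
      set DA := fderiv ℝ Ω (p + t • v)
      set x := z v t
      set x' := z (v + h) t
      have e : A' (v + h) x' - A v x - ((DA v (t • h) + A h) x + A (t • h) (A v x)) =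
          A v (x' - x - A (t • h) x) + (((A' - A - DA (t • h)) v x + (A' - A) v (x' - x))
            + ((A' - A) h x' + A h (x' - x))) := by
        have : (DA v (t • h) + A h) x + A (t • h) (A v x) =
            DA (t • h) v x + A v (A (t • h) x) + A h x := by
          rw [add_apply, ← hfl]; abel
        rw [this]
        simp only [map_sub, map_add, sub_apply, add_apply]
        abel
      rw [e]
      have b1 := ap3 (A' - A - DA (t • h)) v x (C * ‖h‖ ^ 2) 1 M (by positivity) zero_le_one
        (htay.trans (by gcongr)) (hv.le.trans hr1) (hzM v hv t ht)
      have b2 := ap3 (A' - A) v (x' - x) (C * ‖h‖) 1 (6 * C * M * ‖h‖) (by positivity) zero_le_one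
        hA' (hv.le.trans hr1) hWt
      have b3 := ap3 (A' - A) h x' (C * ‖h‖) ‖h‖ M (by positivity) (norm_nonneg _) hA' le_rfl
        (hzM _ hvh t ht)
      have b4 := ap3 A h (x' - x) C ‖h‖ (6 * C * M * ‖h‖) hC0 (norm_nonneg _) hAC le_rfl hWt
      refine (norm_add_le _ _).trans (add_le_add hvr ((norm_add_le _ _).trans
        ((add_le_add (norm_add_le _ _) (norm_add_le _ _)).trans ?_)))
      exact (add_le_add (add_le_add b1 b2) (add_le_add b3 b4)).trans (le_of_eq (by ring))
  refine ⟨r, hr0, fun q hq => (hRs (Metric.ball_subset_ball hrR hq)).2.2,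
    fun q => z (q - p) 1, ?_, fun q hq => ?_⟩
  · have h1 : (1 : ℝ) ∈ Icc (0 : ℝ) 1 := by simp
    have := norm_le_of_norm_deriv_le (z := fun t => z 0 t - y₀) (δ := 0) (ε := 0) le_rfl le_rfl
      (fun t ht => (hz 0 (by simpa using hr0) t ht).sub_const y₀) (by simp [hz0])
      (fun t ht => by simp) h1
    simp only [sub_self]
    exact sub_eq_zero.1 (norm_le_zero_iff.1 (by linarith))
  · have hq' : ‖q - p‖ < r := by simpa [dist_eq_norm] using hq
    refine hasFDerivAt_of_norm_sub_le (r := r - ‖q - p‖)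
      (K := 3 * (2 * C * M + 12 * C ^ 2 * M)) (by linarith) fun v hv => ?_
    have hvv : ‖(q - p) + v‖ < r := (norm_add_le _ _).trans_lt (by linarith)
    have := hD (q - p) v hq' hvv
    rw [add_sub_cancel] at this
    rw [add_sub_right_comm]
    exact this

end Frobenius

/-! ### Matrix form of the Frobenius theorem on the plane, in rank three. -/

/-- The elementary form `dx_i ⊗ E_{ab}`. -/
def elementaryForm (i : Fin 2) (a b : Fin 3) : Plane →L[ℝ] (Fin 3 → ℝ) →L[ℝ] (Fin 3 → ℝ) :=
  (ContinuousLinearMap.proj (R := ℝ) (φ := fun _ : Fin 2 => ℝ) i).smulRight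
    ((ContinuousLinearMap.proj (R := ℝ) (φ := fun _ : Fin 3 => ℝ) b).smulRight
      (Pi.single a 1 : Fin 3 → ℝ))

/-- The connection form with matrix coefficients `A i a b`. -/
def connectionForm (A : Fin 2 → Fin 3 → Fin 3 → Plane → ℝ) (q : Plane) :
    Plane →L[ℝ] (Fin 3 → ℝ) →L[ℝ] (Fin 3 → ℝ) :=
  ∑ i, ∑ a, ∑ b, A i a b q • elementaryForm i a b

theorem connectionForm_apply (A : Fin 2 → Fin 3 → Fin 3 → Plane → ℝ) (q v : Plane)
    (z : Fin 3 → ℝ) (a : Fin 3) :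
    connectionForm A q v z a = ∑ i, ∑ b, A i a b q * (v i * z b) := by
  simp only [connectionForm, elementaryForm, sum_apply, smul_apply, ContinuousLinearMap.smulRight_apply,
    ContinuousLinearMap.proj_apply, Finset.sum_apply, Pi.smul_apply, smul_eq_mul]
  refine Finset.sum_congr rfl fun i _ => ?_
  rw [Finset.sum_eq_single a]
  · simp
  · intro a' _ h
    simp [Pi.single_eq_of_ne h.symm]
  · simp

section Combination

variable {G ι κ μ : Type*} [NormedAddCommGroup G] [NormedSpace ℝ G] [Fintype ι] [Fintype κ]
  [Fintype μ] {u : ι → κ → μ → Plane → ℝ} {U : Set Plane}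

theorem contDiffOn_sum_smul_const (hu : ∀ i a b, ContDiffOn ℝ (⊤ : ℕ∞) (u i a b) U)
    (C : ι → κ → μ → G) : ContDiffOn ℝ (⊤ : ℕ∞) (fun q => ∑ i, ∑ a, ∑ b, u i a b q • C i a b) U :=
  ContDiffOn.sum fun i _ => ContDiffOn.sum fun a _ => ContDiffOn.sum fun b _ =>
    (hu i a b).smul contDiffOn_const

theorem fderiv_sum_smul_const {q : Plane} (hu : ∀ i a b, DifferentiableAt ℝ (u i a b) q)
    (C : ι → κ → μ → G) (v : Plane) :
    fderiv ℝ (fun q => ∑ i, ∑ a, ∑ b, u i a b q • C i a b) q v =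
      ∑ i, ∑ a, ∑ b, fderiv ℝ (u i a b) q v • C i a b := by
  have h : HasFDerivAt (fun q => ∑ i, ∑ a, ∑ b, u i a b q • C i a b)
      (∑ i, ∑ a, ∑ b, (fderiv ℝ (u i a b) q).smulRight (C i a b)) q :=
    HasFDerivAt.fun_sum fun i _ => HasFDerivAt.fun_sum fun a _ => HasFDerivAt.fun_sum fun b _ =>
      (hu i a b).hasFDerivAt.smul_const _
  rw [h.fderiv]
  simp only [sum_apply, ContinuousLinearMap.smulRight_apply]

end Combination

theorem contDiffOn_flip_apply {D E F : Type*} [NormedAddCommGroup D] [NormedSpace ℝ D]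
    [NormedAddCommGroup E] [NormedSpace ℝ E] [NormedAddCommGroup F] [NormedSpace ℝ F]
    {n : WithTop ℕ∞} {V : Set D} {Ω : D → E →L[ℝ] F →L[ℝ] F} {Y : D → F}
    (hΩ : ContDiffOn ℝ n Ω V) (hY : ContDiffOn ℝ n Y V) :
    ContDiffOn ℝ n (fun q => (Ω q).flip (Y q)) V := by
  have h : ContDiff ℝ n
      (ContinuousLinearMap.flip : (E →L[ℝ] F →L[ℝ] F) → (F →L[ℝ] E →L[ℝ] F)) :=
    IsBoundedLinearMap.contDiff ⟨⟨ContinuousLinearMap.flip_add, ContinuousLinearMap.flip_smul⟩,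
      1, one_pos, fun f => by rw [ContinuousLinearMap.opNorm_flip, one_mul]⟩
  exact (h.comp_contDiffOn hΩ).clm_apply hY

/-- The Frobenius theorem for ∂ᵢY = AᵢY: the integrability condition is skew in the two directions,
so in the plane the single pair (0, 1) suffices. -/
theorem exists_solution_of_flat {A : Fin 2 → Fin 3 → Fin 3 → Plane → ℝ} {U : Set Plane}
    (hU : IsOpen U) (hA : ∀ i a b, ContDiffOn ℝ (⊤ : ℕ∞) (A i a b) U)
    (hflat : ∀ q ∈ U, ∀ a b, pd 0 (A 1 a b) q + ∑ c, A 1 a c q * A 0 c b q =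
      pd 1 (A 0 a b) q + ∑ c, A 0 a c q * A 1 c b q) {p : Plane} (hp : p ∈ U) (y₀ : Fin 3 → ℝ) :
    ∃ V, IsOpen V ∧ p ∈ V ∧ V ⊆ U ∧ ∃ Y : Fin 3 → Plane → ℝ, (∀ a, Y a p = y₀ a) ∧
      (∀ a, ContDiffOn ℝ (⊤ : ℕ∞) (Y a) V) ∧
      ∀ q ∈ V, ∀ i a, pd i (Y a) q = ∑ b, A i a b q * Y b q := by
  have hΩ : ContDiffOn ℝ (⊤ : ℕ∞) (connectionForm A) U :=
    contDiffOn_sum_smul_const hA elementaryForm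
  have hd : ∀ q ∈ U, ∀ u v z, fderiv ℝ (connectionForm A) q u v z =
      connectionForm (fun i a b q => fderiv ℝ (A i a b) q u) q v z := by
    intro q hq u v z
    have h : fderiv ℝ (connectionForm A) q u =
        connectionForm (fun i a b q => fderiv ℝ (A i a b) q u) q :=
      fderiv_sum_smul_const (fun i a b => diffAt hU (hA i a b) hq) elementaryForm u
    rw [h]
  obtain ⟨r, hr, hrU, Y, hYp, hY⟩ := exists_parallel_section hU (hΩ.of_le (by
      exact WithTop.coe_le_coe.2 (le_top : (2 : ℕ∞) ≤ ⊤))) (p := p) (fun q hq u v z => by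
    rw [hd q hq, hd q hq]
    funext a
    have f0 := hflat q hq a 0
    have f1 := hflat q hq a 1
    have f2 := hflat q hq a 2
    simp only [Fin.sum_univ_three] at f0 f1 f2
    simp only [Pi.add_apply, connectionForm_apply, Fin.sum_univ_three, Fin.sum_univ_two,
      fderiv_apply_eq_sum]
    linear_combination (u 0 * v 1 - u 1 * v 0) * (z 0 * f0 + z 1 * f1 + z 2 * f2)) hp y₀
  -- Bootstrap: the derivative of Y is Ω applied to Y, so each order of smoothness of Y yields the
  -- next.
  have hsm : ContDiffOn ℝ (⊤ : ℕ∞) Y (Metric.ball p r) := by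
    refine contDiffOn_infty.2 fun n => ?_
    induction n with
    | zero => exact contDiffOn_zero.2 fun q hq => (hY q hq).continuousAt.continuousWithinAt
    | succ n ih =>
      push_cast
      refine (contDiffOn_succ_iff_fderiv_of_isOpen Metric.isOpen_ball).2
        ⟨fun q hq => (hY q hq).differentiableAt.differentiableWithinAt,
          fun h => absurd h (WithTop.natCast_ne_top n), ?_⟩
      refine ContDiffOn.congr (f := fun q => (connectionForm A q).flip (Y q)) ?_
        fun q hq => (hY q hq).fderiv
      exact contDiffOn_flip_apply (contDiffOn_infty.1 (hΩ.mono hrU) n) ih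
  refine ⟨Metric.ball p r, Metric.isOpen_ball, Metric.mem_ball_self hr, hrU,
    fun a q => Y q a, fun a => congrFun hYp a, fun a => contDiffOn_pi.1 hsm a, fun q hq i a => ?_⟩
  have h := (hasFDerivAt_pi'.1 (hY q hq)) a
  rw [pd, h.fderiv]
  simp only [ContinuousLinearMap.comp_apply, ContinuousLinearMap.proj_apply,
    ContinuousLinearMap.flip_apply, connectionForm_apply]
  rw [Finset.sum_eq_single i]
  · simp
  · intro j _ hj
    simp [Pi.single_eq_of_ne hj]
  · simp

/-! ### Projectively flat connections -/

/-- The matrix coefficients of the tractor connection of a trace-free connection. -/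
def tractorCoeff (Γ : Connection) (i : Fin 2) (a b : Fin 3) (q : Plane) : ℝ :=
  ![![0, if i = 0 then 1 else 0, if i = 1 then 1 else 0],
    ![-pTensor Γ i 0 q, Γ q 0 i 0, Γ q 1 i 0],
    ![-pTensor Γ i 1 q, Γ q 0 i 1, Γ q 1 i 1]] a b

theorem contDiffOn_tractorCoeff {Γ : Connection} {U : Set Plane} (hU : IsOpen U)
    (hΓ : IsTorsionFree Γ U) (i : Fin 2) (a b : Fin 3) :
    ContDiffOn ℝ (⊤ : ℕ∞) (tractorCoeff Γ i a b) U := by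
  have hP := fun j => (contDiffOn_pTensor hU hΓ i j).neg
  have hG := hΓ.contDiffOn_apply
  fin_cases a <;> fin_cases b
  exacts [contDiffOn_const, contDiffOn_const, contDiffOn_const, hP 0, hG 0 i 0, hG 1 i 0, hP 1,
    hG 0 i 1, hG 1 i 1]

/-- The system is the prolongation of ∇∇σ + 𝔓σ = 0 to (σ, dσ). In its curvature, row 0 reduces to
the symmetry of Γ and of 𝔓, the latter owed to the vanishing trace. The first entries of rows 1 and
2 are the Liouville tensor. The remaining entries vanish because 𝔓 determines the curvature in
dimension two. -/
theorem tractorCoeff_flat {Γ : Connection} {U : Set Plane} (hU : IsOpen U)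
    (hΓ : IsTorsionFree Γ U) (htr : ∀ q ∈ U, ∀ j, Γ q 0 0 j + Γ q 1 1 j = 0)
    (hL : ∀ q ∈ U, ∀ i j k, liouville Γ i j k q = 0) {q : Plane} (hq : q ∈ U) (a b : Fin 3) :
    pd 0 (tractorCoeff Γ 1 a b) q + ∑ c, tractorCoeff Γ 1 a c q * tractorCoeff Γ 0 c b q =
      pd 1 (tractorCoeff Γ 0 a b) q + ∑ c, tractorCoeff Γ 0 a c q * tractorCoeff Γ 1 c b q := by
  have hs := fun k => hΓ.symm q hq k 1 0
  have hds : ∀ l k, pd l (fun q => Γ q k 1 0) q = pd l (fun q => Γ q k 0 1) q := fun l k =>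
    pd_congr hU (fun q hq => hΓ.symm q hq k 1 0) hq l
  have t0 : Γ q 1 0 1 = -Γ q 0 0 0 := by linear_combination htr q hq 0 - hs 1
  have t1 : Γ q 1 1 1 = -Γ q 0 0 1 := by linear_combination htr q hq 1
  have dt0 : ∀ l, pd l (fun q => Γ q 1 0 1) q = -pd l (fun q => Γ q 0 0 0) q := fun l => by
    rw [← pd_neg]
    exact pd_congr hU (fun q hq => by linear_combination htr q hq 0 - hΓ.symm q hq 1 1 0) hq l
  have dt1 : ∀ l, pd l (fun q => Γ q 1 1 1) q = -pd l (fun q => Γ q 0 0 1) q := fun l => by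
    rw [← pd_neg]
    exact pd_congr hU (fun q hq => by linear_combination htr q hq 1) hq l
  have L0 := hL q hq 0 1 0
  have L1 := hL q hq 0 1 1
  simp only [liouville, covDerivP, Fin.sum_univ_two, hs, t0, t1] at L0 L1
  have p0 : ∀ l i (j : Fin 2), pd l (fun q => -pTensor Γ i j q) q = -pd l (pTensor Γ i j) q :=
    fun l i j => pd_neg _ _ _
  have c0 : ∀ c : ℝ, ∀ l, pd l (fun _ => c) q = 0 := fun c l => pd_const c q l
  have key : ∀ l i : Fin 2, ∀ a b, pd l (tractorCoeff Γ i a b) q =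
      ![![0, 0, 0],
        ![-pd l (pTensor Γ i 0) q, pd l (fun q => Γ q 0 i 0) q, pd l (fun q => Γ q 1 i 0) q],
        ![-pd l (pTensor Γ i 1) q, pd l (fun q => Γ q 0 i 1) q, pd l (fun q => Γ q 1 i 1) q]]
        a b := by
    intro l i a b
    fin_cases a <;> fin_cases b
    exacts [c0 _ l, c0 _ l, c0 _ l, p0 l i 0, rfl, rfl, p0 l i 1, rfl, rfl]
  rw [key, key]
  have e00 : pTensor Γ 0 0 q = pd 0 (fun q => Γ q 0 0 0) q + pd 1 (fun q => Γ q 1 0 0) q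
      - 2 * Γ q 0 0 0 ^ 2 - 2 * Γ q 0 0 1 * Γ q 1 0 0 := by
    simp only [pTensor, ricci, curvature, Fin.sum_univ_two, hs, hds, t0, t1, dt0]; ring
  have e01 : pTensor Γ 0 1 q = pd 0 (fun q => Γ q 0 0 1) q - pd 1 (fun q => Γ q 0 0 0) q
      - Γ q 0 0 0 * Γ q 0 0 1 - Γ q 1 0 0 * Γ q 0 1 1 := by
    simp only [pTensor, ricci, curvature, Fin.sum_univ_two, hs, hds, t0, t1, dt0, dt1]; ring
  have e10 : pTensor Γ 1 0 q = pd 0 (fun q => Γ q 0 0 1) q - pd 1 (fun q => Γ q 0 0 0) q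
      - Γ q 0 0 0 * Γ q 0 0 1 - Γ q 1 0 0 * Γ q 0 1 1 := by
    simp only [pTensor, ricci, curvature, Fin.sum_univ_two, hs, hds, t0, t1, dt0, dt1]; ring
  have e11 : pTensor Γ 1 1 q = pd 0 (fun q => Γ q 0 1 1) q - pd 1 (fun q => Γ q 0 0 1) q
      - 2 * Γ q 0 0 1 ^ 2 + 2 * Γ q 0 0 0 * Γ q 0 1 1 := by
    simp only [pTensor, ricci, curvature, Fin.sum_univ_two, hs, t0, t1, dt1]; ring
  fin_cases a <;> fin_cases b <;>
    simp [tractorCoeff, Fin.sum_univ_three, hs, hds, t0, t1, dt0, dt1]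
  · rw [e01, e10]
  · linear_combination -L0
  · rw [e10]; ring
  · rw [e00]; ring
  · linear_combination -L1
  · rw [e11]; ring
  · rw [e01]; ring

/-- The trace-free representative of a projective class. -/
theorem exists_projRel_trace_eq_zero {Γ : Connection} {U : Set Plane} (hΓ : IsTorsionFree Γ U) :
    ∃ Γ', ProjRel U Γ Γ' ∧ ∀ q ∈ U, ∀ j, Γ' q 0 0 j + Γ' q 1 1 j = 0 := by
  -- A projective change adds 3Υ to the trace: twice from the first term and once from the second.
  set Υ : Fin 2 → Plane → ℝ := fun j q => -(1 / 3) * (Γ q 0 0 j + Γ q 1 1 j) with hΥ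
  refine ⟨fun q k i j => Γ q k i j + (if k = i then Υ j q else 0) + (if k = j then Υ i q else 0),
    ⟨Υ, fun j => ?_, fun _ _ _ _ _ => rfl⟩, fun q _ j => ?_⟩
  · exact contDiffOn_const.mul ((hΓ.contDiffOn_apply 0 0 j).add (hΓ.contDiffOn_apply 1 1 j))
  · fin_cases j <;> simp [hΥ] <;> ring

/-- Coordinates in which the geodesics of a trace-free connection with vanishing Liouville tensor
are straight lines. -/
theorem exists_flat_coordinates {Γ : Connection} {U : Set Plane} (hU : IsOpen U)
    (hΓ : IsTorsionFree Γ U) (htr : ∀ q ∈ U, ∀ j, Γ q 0 0 j + Γ q 1 1 j = 0)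
    (hL : ∀ q ∈ U, ∀ i j k, liouville Γ i j k q = 0) {p : Plane} (hp : p ∈ U) :
    ∃ V, IsOpen V ∧ p ∈ V ∧ V ⊆ U ∧ ∃ ψ Υ : Fin 2 → Plane → ℝ,
      (∀ a, ContDiffOn ℝ (⊤ : ℕ∞) (ψ a) V) ∧
      (∀ q ∈ V, wedge (dif (ψ 0) q) (dif (ψ 1) q) ≠ 0) ∧
      ∀ q ∈ V, ∀ a i j, pd i (pd j (ψ a)) q = Γ q 0 i j * pd 0 (ψ a) q + Γ q 1 i j * pd 1 (ψ a) q
        + Υ i q * pd j (ψ a) q + Υ j q * pd i (ψ a) q := by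
  -- The initial values of (σ, dσ) at p are the three basis vectors, so σ₀(p) = 1 and the ratios
  -- below have the standard differentials at p.
  have hsol := fun b : Fin 3 => exists_solution_of_flat hU (contDiffOn_tractorCoeff hU hΓ)
    (fun q hq a b => tractorCoeff_flat hU hΓ htr hL hq a b) hp (Pi.single b 1)
  choose V hVo hpV hVU Y hYp hYs hY using hsol
  have hW : IsOpen (⋂ b, V b) := isOpen_iInter_of_finite hVo
  set W := ⋂ b, V b with hWdef
  have hWV : ∀ b, W ⊆ V b := fun b => iInter_subset V b
  have hpW : p ∈ W := mem_iInter.2 hpV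
  set σ : Fin 3 → Plane → ℝ := fun b => Y b 0 with hσ
  have sσ : ∀ b, ContDiffOn ℝ (⊤ : ℕ∞) (σ b) W := fun b => (hYs b 0).mono (hWV b)
  have dσ : ∀ b, ∀ q ∈ W, ∀ i, pd i (σ b) q = Y b i.succ q := by
    intro b q hq i
    rw [hσ, hY b q (hWV b hq)]
    fin_cases i <;> simp [Fin.sum_univ_three, tractorCoeff]
  have ddσ : ∀ b, ∀ q ∈ W, ∀ i j, pd i (pd j (σ b)) q = Γ q 0 i j * pd 0 (σ b) q
      + Γ q 1 i j * pd 1 (σ b) q - pTensor Γ i j q * σ b q := by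
    intro b q hq i j
    rw [pd_congr hW (fun q hq => dσ b q hq j) hq, hY b q (hWV b hq), dσ b q hq, dσ b q hq]
    fin_cases j <;> simp [Fin.sum_univ_three, tractorCoeff, hσ] <;> ring
  have σp : ∀ b, σ b p = (Pi.single b 1 : Fin 3 → ℝ) 0 := fun b => hYp b 0
  have dσp : ∀ b i, pd i (σ b) p = (Pi.single b 1 : Fin 3 → ℝ) i.succ := fun b i => by
    rw [dσ b p hpW, hYp]
  have hO1 : IsOpen (W ∩ {q | σ 0 q ≠ 0}) :=
    (sσ 0).continuousOn.isOpen_inter_preimage hW isOpen_ne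
  set W₁ := W ∩ {q | σ 0 q ≠ 0} with hW₁
  -- In a quotient of two solutions the 𝔓 terms cancel; what remains is a projective change with Υ =
  -- -d log |σ₀|.
  set ψ : Fin 2 → Plane → ℝ := fun a q => σ a.succ q / σ 0 q with hψ
  have sψ : ∀ a, ContDiffOn ℝ (⊤ : ℕ∞) (ψ a) W₁ := fun a =>
    ((sσ a.succ).mono inter_subset_left).div ((sσ 0).mono inter_subset_left) fun q hq => hq.2
  have sw : ContDiffOn ℝ (⊤ : ℕ∞) (fun q => wedge (dif (ψ 0) q) (dif (ψ 1) q)) W₁ :=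
    contDiffOn_wedge (contDiffOn_pd hO1 (sψ 0)) (contDiffOn_pd hO1 (sψ 1))
  have hp1 : p ∈ W₁ := ⟨hpW, by simp [σp]⟩
  have dσ' : ∀ b, DifferentiableAt ℝ (σ b) p := fun b => diffAt hW (sσ b) hpW
  have dψp : ∀ a i, pd i (ψ a) p = if i = a then 1 else 0 := fun a i => by
    rw [hψ]
    simp only
    rw [pd_div i (dσ' _) (dσ' 0) hp1.2, dσp, dσp, σp, σp]
    fin_cases a <;> fin_cases i <;> simp
  refine ⟨W₁ ∩ {q | wedge (dif (ψ 0) q) (dif (ψ 1) q) ≠ 0},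
    sw.continuousOn.isOpen_inter_preimage hO1 isOpen_ne, ⟨hp1, ?_⟩,
    fun q hq => hVU 0 (hWV 0 hq.1.1), ψ, fun i q => -(pd i (σ 0) q / σ 0 q),
    fun a => (sψ a).mono inter_subset_left, fun q hq => hq.2, ?_⟩
  · simp [wedge, dif, dψp]
  · rintro q ⟨hq, -⟩ a i j
    have hmul : ∀ q ∈ W₁, σ a.succ q = ψ a q * σ 0 q := fun q hq => by
      simp only [hψ]
      rw [div_mul_cancel₀ _ hq.2]
    have dψ := fun q (hq : q ∈ W₁) => diffAt hO1 (sψ a) hq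
    have d0 := fun q (hq : q ∈ W₁) => diffAt hW (sσ 0) hq.1
    have h1 : ∀ j, ∀ q ∈ W₁, pd j (σ a.succ) q = pd j (ψ a) q * σ 0 q + ψ a q * pd j (σ 0) q :=
      fun j q hq => by rw [pd_congr hO1 hmul hq, pd_mul _ (dψ q hq) (d0 q hq)]
    have ddψ := diffAt hO1 (contDiffOn_pd hO1 (sψ a) j) hq
    have dd0 := diffAt hW (contDiffOn_pd hW (sσ 0) j) hq.1
    have h2 : pd i (pd j (σ a.succ)) q = pd i (pd j (ψ a)) q * σ 0 q + pd j (ψ a) q * pd i (σ 0) q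
        + (pd i (ψ a) q * pd j (σ 0) q + ψ a q * pd i (pd j (σ 0)) q) := by
      rw [pd_congr hO1 (h1 j) hq, pd_add _ (ddψ.fun_mul (d0 q hq)) ((dψ q hq).fun_mul dd0),
        pd_mul _ ddψ (d0 q hq), pd_mul _ (dψ q hq) dd0]
    rw [ddσ _ q hq.1, ddσ _ q hq.1, h1 0 q hq, h1 1 q hq, hmul q hq] at h2
    have h0 : σ 0 q ≠ 0 := hq.2
    apply mul_right_cancel₀ h0
    field_simp
    linear_combination -h2

/-! ### Regular arcs on straight lines -/

theorem eq_of_hasDerivAt_zero {a b : ℝ} {u : ℝ → ℝ} (h : ∀ t ∈ Ioo a b, HasDerivAt u 0 t)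
    {s t : ℝ} (hs : s ∈ Ioo a b) (ht : t ∈ Ioo a b) : u s = u t :=
  isOpen_Ioo.is_const_of_deriv_eq_zero isPreconnected_Ioo
    (fun t ht => (h t ht).differentiableAt.differentiableWithinAt)
    (fun t ht => (h t ht).deriv) hs ht

theorem hasDerivAt_wedge (v : Fin 2 → ℝ) {c : ℝ → Fin 2 → ℝ} {w : Fin 2 → ℝ} {t : ℝ}
    (h : HasDerivAt c w t) : HasDerivAt (fun s => wedge v (c s)) (wedge v w) t :=
  ((hasDerivAt_apply h 1).const_mul (v 0)).sub ((hasDerivAt_apply h 0).const_mul (v 1))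

/-- The direction of an arc whose acceleration is tangent to it is constant. -/
theorem IsRegularArc.wedge_deriv_eq_zero {U : Set Plane} {γ : ℝ → Plane} {a b : ℝ}
    (h : IsRegularArc U γ a b) (hμ : ∀ t ∈ Ioo a b, ∃ μ : ℝ, deriv (deriv γ) t = μ • deriv γ t)
    {s t : ℝ} (hs : s ∈ Ioo a b) (ht : t ∈ Ioo a b) : wedge (deriv γ s) (deriv γ t) = 0 := by
  have hN := fun t ht => ne_zero_iff_sq_add_sq.1 (h.regular t ht)
  -- The orthogonal projector onto the tangent line has zero derivative at each time. This needs no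
  -- regularity of the factor μ in t and no choice of sign for a unit tangent.
  have hm : ∀ i j, deriv γ s i * deriv γ s j / (deriv γ s 0 ^ 2 + deriv γ s 1 ^ 2) =
      deriv γ t i * deriv γ t j / (deriv γ t 0 ^ 2 + deriv γ t 1 ^ 2) := by
    intro i j
    refine eq_of_hasDerivAt_zero
      (u := fun t => deriv γ t i * deriv γ t j / (deriv γ t 0 ^ 2 + deriv γ t 1 ^ 2))
      (fun t ht => ?_) hs ht
    obtain ⟨μ, hμ⟩ := hμ t ht
    have d := fun i => hasDerivAt_apply (h.hasDerivAt_deriv ht) i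
    refine (((d i).fun_mul (d j)).fun_div (((d 0).fun_pow 2).fun_add ((d 1).fun_pow 2))
      (hN t ht).ne').congr_deriv ?_
    rw [div_eq_zero_iff]
    left
    simp only [hμ, Pi.smul_apply, smul_eq_mul]
    push_cast
    ring
  have hs0 := hN s hs
  have ht0 := hN t ht
  have h00 := hm 0 0
  have h01 := hm 0 1
  have h11 := hm 1 1
  rw [div_eq_div_iff hs0.ne' ht0.ne'] at h00 h01 h11
  have hsq : wedge (deriv γ s) (deriv γ t) ^ 2 * ((deriv γ s 0 ^ 2 + deriv γ s 1 ^ 2) *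
      (deriv γ t 0 ^ 2 + deriv γ t 1 ^ 2)) = 0 := by
    simp only [wedge]
    linear_combination (deriv γ s 0 ^ 2 + deriv γ s 1 ^ 2) * (deriv γ t 1 ^ 2 * h00
      + deriv γ t 0 ^ 2 * h11 - 2 * deriv γ t 0 * deriv γ t 1 * h01)
  have := (mul_eq_zero.1 hsq).resolve_right (mul_pos hs0 ht0).ne'
  exact pow_eq_zero_iff (two_ne_zero) |>.1 this

/-- An arc whose acceleration is tangent to it lies on a straight line. -/
theorem IsRegularArc.collinear {U : Set Plane} {γ : ℝ → Plane} {a b : ℝ}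
    (h : IsRegularArc U γ a b)
    (hμ : ∀ t ∈ Ioo a b, ∃ μ : ℝ, deriv (deriv γ) t = μ • deriv γ t) :
    Collinear ℝ (γ '' Ioo a b) := by
  rcases (Ioo a b).eq_empty_or_nonempty with h0 | ⟨s, hs⟩
  · rw [h0, image_empty]
    exact collinear_empty ℝ _
  refine (collinear_iff_of_mem (mem_image_of_mem γ hs)).2 ⟨deriv γ s, ?_⟩
  rintro _ ⟨t, ht, rfl⟩
  have hc := eq_of_hasDerivAt_zero (u := fun t => wedge (deriv γ s) (γ t)) (fun t ht => by
    have := hasDerivAt_wedge (deriv γ s) (h.hasDerivAt ht)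
    rwa [h.wedge_deriv_eq_zero hμ hs ht] at this) ht hs
  obtain ⟨r, hr⟩ := exists_smul_of_wedge_eq_zero (h.regular s hs) (w := γ t - γ s) (by
    simp only [wedge, Pi.sub_apply] at hc ⊢
    linear_combination hc)
  exact ⟨r, by rw [vadd_eq_add, ← hr, sub_add_cancel]⟩

/-- The acceleration of an arc on a straight line is tangent to it. -/
theorem IsRegularArc.exists_smul_of_collinear {U : Set Plane} {γ : ℝ → Plane} {a b : ℝ}
    (h : IsRegularArc U γ a b) (hc : Collinear ℝ (γ '' Ioo a b)) {t : ℝ} (ht : t ∈ Ioo a b) :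
    ∃ μ : ℝ, deriv (deriv γ) t = μ • deriv γ t := by
  obtain ⟨v, hv⟩ := (collinear_iff_of_mem (mem_image_of_mem γ ht)).1 hc
  have hconst : ∀ s ∈ Ioo a b, wedge v (γ s) = wedge v (γ t) := by
    intro s hs
    obtain ⟨r, hr⟩ := hv _ (mem_image_of_mem γ hs)
    rw [hr]
    simp only [wedge, vadd_eq_add, Pi.add_apply, Pi.smul_apply, smul_eq_mul]
    ring
  have h1 : ∀ s ∈ Ioo a b, wedge v (deriv γ s) = 0 := fun s hs =>
    (hasDerivAt_wedge v (h.hasDerivAt hs)).unique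
      ((hasDerivAt_const s (wedge v (γ t))).congr_of_eventuallyEq
        (eventually_of_mem (isOpen_Ioo.mem_nhds hs) hconst))
  have h2 : wedge v (deriv (deriv γ) t) = 0 :=
    (hasDerivAt_wedge v (h.hasDerivAt_deriv ht)).unique
      ((hasDerivAt_const t (0 : ℝ)).congr_of_eventuallyEq
        (eventually_of_mem (isOpen_Ioo.mem_nhds ht) h1))
  have hv0 : v ≠ 0 := by
    rintro rfl
    refine h.regular t ht ((h.hasDerivAt ht).unique
      ((hasDerivAt_const t (γ t)).congr_of_eventuallyEq
        (eventually_of_mem (isOpen_Ioo.mem_nhds ht) fun s hs => ?_)))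
    obtain ⟨r, hr⟩ := hv _ (mem_image_of_mem γ hs)
    simpa using hr
  exact exists_smul_of_wedge_eq_zero (h.regular t ht) (eq_zero_of_wedge_eq_zero (h1 t ht) h2 hv0)

/-! ### Local diffeomorphisms -/

theorem eq_zero_of_pairing_eq_zero {α β v : Fin 2 → ℝ} (h : wedge α β ≠ 0)
    (hα : α 0 * v 0 + α 1 * v 1 = 0) (hβ : β 0 * v 0 + β 1 * v 1 = 0) : v = 0 := by
  funext i
  apply mul_left_cancel₀ h
  fin_cases i
  · change (α 0 * β 1 - α 1 * β 0) * v 0 = _ * 0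
    linear_combination β 1 * hα - α 1 * hβ
  · change (α 0 * β 1 - α 1 * β 0) * v 1 = _ * 0
    linear_combination α 0 * hβ - β 0 * hα

theorem fderiv_pi_apply_eq {ψ : Fin 2 → Plane → ℝ} {q : Plane}
    (h : ∀ a, DifferentiableAt ℝ (ψ a) q) (v : Plane) (a : Fin 2) :
    fderiv ℝ (fun q a => ψ a q) q v a = pd 0 (ψ a) q * v 0 + pd 1 (ψ a) q * v 1 := by
  rw [fderiv_pi h, ← fderiv_apply_eq_sum]
  rfl

theorem exists_localDiffeo {V : Set Plane} (hV : IsOpen V) {ψ : Fin 2 → Plane → ℝ}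
    (hψ : ∀ a, ContDiffOn ℝ (⊤ : ℕ∞) (ψ a) V)
    (hw : ∀ q ∈ V, wedge (dif (ψ 0) q) (dif (ψ 1) q) ≠ 0) {p : Plane} (hp : p ∈ V) :
    ∃ φ : OpenPartialHomeomorph Plane Plane, p ∈ φ.source ∧ φ.source ⊆ V ∧
      (∀ q, φ q = fun a => ψ a q) ∧ ContDiffOn ℝ (⊤ : ℕ∞) φ φ.source ∧
      ContDiffOn ℝ (⊤ : ℕ∞) φ.symm φ.target := by
  have hs : ContDiffOn ℝ (⊤ : ℕ∞) (fun q a => ψ a q : Plane → Plane) V := contDiffOn_pi.2 hψ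
  have hsAt := fun q (hq : q ∈ V) => hs.contDiffAt (hV.mem_nhds hq)
  have hequiv : ∀ q ∈ V, ∃ L : Plane ≃L[ℝ] Plane,
      HasFDerivAt (fun q a => ψ a q : Plane → Plane) (L : Plane →L[ℝ] Plane) q := by
    intro q hq
    have hd : ∀ a, DifferentiableAt ℝ (ψ a) q := fun a => diffAt hV (hψ a) hq
    have hinj : Function.Injective
        (fderiv ℝ (fun q a => ψ a q : Plane → Plane) q : Plane →ₗ[ℝ] Plane) := by
      refine (injective_iff_map_eq_zero _).2 fun v hv => ?_
      have h0 := fun a => (fderiv_pi_apply_eq hd v a).symm.trans (congrFun hv a)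
      exact eq_zero_of_pairing_eq_zero (hw q hq) (h0 0) (h0 1)
    refine ⟨(LinearEquiv.ofInjectiveEndo _ hinj).toContinuousLinearEquiv, ?_⟩
    exact ((hsAt q hq).differentiableAt (by simp)).hasFDerivAt
  choose! L hL using hequiv
  -- Restricting to V makes the derivative invertible at every point of the source, so the inverse
  -- is smooth on the whole target and not only near the image of p.
  set φ := ((hsAt p hp).toOpenPartialHomeomorph _ (hL p hp) (by simp)).restrOpen V hV with hφ
  have hsrc : φ.source ⊆ V := fun q hq => hq.2
  refine ⟨φ, ⟨ContDiffAt.mem_toOpenPartialHomeomorph_source _ _ _, hp⟩, hsrc, fun q => rfl,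
    hs.mono hsrc, fun y hy => ContDiffAt.contDiffWithinAt ?_⟩
  have hy' := hsrc (φ.map_target hy)
  exact φ.contDiffAt_symm hy (hL _ hy') (hsAt _ hy')

/-- By the chain rule for the composition with the inverse, the two Jacobian matrices are inverse to
each other; taking determinants gives the claim. -/
theorem wedge_dif_ne_zero_of_localDiffeo (φ : OpenPartialHomeomorph Plane Plane)
    (h : ContDiffOn ℝ (⊤ : ℕ∞) φ φ.source) (h' : ContDiffOn ℝ (⊤ : ℕ∞) φ.symm φ.target)
    {q : Plane} (hq : q ∈ φ.source) :
    wedge (dif (fun q => φ q 0) q) (dif (fun q => φ q 1) q) ≠ 0 := by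
  have hd : ∀ a, DifferentiableAt ℝ (fun q => φ q a) q := fun a =>
    diffAt φ.open_source (contDiffOn_pi.1 h a) hq
  have hd' : ∀ b, DifferentiableAt ℝ (fun y => φ.symm y b) (φ q) := fun b =>
    diffAt φ.open_target (contDiffOn_pi.1 h' b) (φ.map_source hq)
  have hφ : DifferentiableAt ℝ (fun q a => φ q a : Plane → Plane) q := differentiableAt_pi.2 hd
  have key : ∀ b i, pd 0 (fun y => φ.symm y b) (φ q) * pd i (fun q => φ q 0) q +
      pd 1 (fun y => φ.symm y b) (φ q) * pd i (fun q => φ q 1) q =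
      (Pi.single i 1 : Fin 2 → ℝ) b := by
    intro b i
    have h1 : HasFDerivAt (fun y => φ.symm (φ y) b)
        ((fderiv ℝ (fun y => φ.symm y b) (φ q)).comp (fderiv ℝ (fun q a => φ q a) q)) q :=
      HasFDerivAt.comp (g := fun y => φ.symm y b) q (hd' b).hasFDerivAt hφ.hasFDerivAt
    have h2 : HasFDerivAt (fun y => φ.symm (φ y) b) (ContinuousLinearMap.proj b) q :=
      (ContinuousLinearMap.proj (R := ℝ) (φ := fun _ : Fin 2 => ℝ) b).hasFDerivAt.congr_of_eventuallyEq
        (eventually_of_mem (φ.open_source.mem_nhds hq) fun y hy => by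
          simp [φ.left_inv hy])
    have h3 := DFunLike.congr_fun (h1.unique h2) (Pi.single i 1)
    rw [ContinuousLinearMap.comp_apply, fderiv_apply_eq_sum, fderiv_pi_apply_eq hd,
      fderiv_pi_apply_eq hd] at h3
    have h4 := h3
    fin_cases i <;> simpa using h4
  have k00 := (key 0 0).trans (Pi.single_eq_same 0 1)
  have k01 := (key 0 1).trans (Pi.single_eq_of_ne zero_ne_one 1)
  have k10 := (key 1 0).trans (Pi.single_eq_of_ne one_ne_zero 1)
  have k11 := (key 1 1).trans (Pi.single_eq_same 1 1)
  intro hw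
  simp only [wedge, dif] at hw
  have : (1 : ℝ) = 0 := by
    linear_combination (pd 0 (fun y => φ.symm y 0) (φ q) * pd 1 (fun y => φ.symm y 1) (φ q)
      - pd 1 (fun y => φ.symm y 0) (φ q) * pd 0 (fun y => φ.symm y 1) (φ q)) * hw
      - k11 - (pd 0 (fun y => φ.symm y 1) (φ q) * pd 1 (fun q => φ q 0) q
        + pd 1 (fun y => φ.symm y 1) (φ q) * pd 1 (fun q => φ q 1) q) * k00
      + (pd 0 (fun y => φ.symm y 1) (φ q) * pd 0 (fun q => φ q 0) q
        + pd 1 (fun y => φ.symm y 1) (φ q) * pd 0 (fun q => φ q 1) q) * k01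
  exact one_ne_zero this

/-! ### Arcs in flat coordinates -/

section Arc

variable {V : Set Plane} {ψ : Fin 2 → Plane → ℝ} {c : ℝ → Plane} {a b : ℝ}

theorem IsRegularArc.hasDerivAt_image (hc : IsRegularArc V c a b) (hV : IsOpen V)
    (hψ : ∀ m, ContDiffOn ℝ (⊤ : ℕ∞) (ψ m) V) {t : ℝ} (ht : t ∈ Ioo a b) :
    HasDerivAt (fun t m => ψ m (c t))
      (fun m => pd 0 (ψ m) (c t) * deriv c t 0 + pd 1 (ψ m) (c t) * deriv c t 1) t :=
  hasDerivAt_pi.2 fun m =>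
    hasDerivAt_comp_arc (diffAt hV (hψ m) (hc.mem t ht)) (hc.hasDerivAt ht)

theorem IsRegularArc.image (hc : IsRegularArc V c a b) (hV : IsOpen V)
    (hψ : ∀ m, ContDiffOn ℝ (⊤ : ℕ∞) (ψ m) V)
    (hw : ∀ q ∈ V, wedge (dif (ψ 0) q) (dif (ψ 1) q) ≠ 0) :
    IsRegularArc univ (fun t m => ψ m (c t)) a b where
  smooth := contDiffOn_pi.2 fun m => (hψ m).comp hc.smooth hc.mem
  mem := fun _ _ => mem_univ _
  regular := fun t ht h => by
    rw [(hc.hasDerivAt_image hV hψ ht).deriv] at h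
    exact hc.regular t ht (eq_zero_of_pairing_eq_zero (hw _ (hc.mem t ht))
      (congrFun h 0) (congrFun h 1))

/-- The Υ terms contribute only a multiple of the velocity, so the acceleration is tangent in the
coordinates ψ exactly when the covariant acceleration is tangent. -/
theorem IsRegularArc.deriv_deriv_image {Γ : Connection} {Υ : Fin 2 → Plane → ℝ}
    (hc : IsRegularArc V c a b) (hV : IsOpen V) (hψ : ∀ m, ContDiffOn ℝ (⊤ : ℕ∞) (ψ m) V)
    (hΓ : ∀ q ∈ V, ∀ m i j, pd i (pd j (ψ m)) q = Γ q 0 i j * pd 0 (ψ m) q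
      + Γ q 1 i j * pd 1 (ψ m) q + Υ i q * pd j (ψ m) q + Υ j q * pd i (ψ m) q)
    {t : ℝ} (ht : t ∈ Ioo a b) (m : Fin 2) :
    deriv (deriv (fun t m => ψ m (c t))) t m =
      pd 0 (ψ m) (c t) * acceleration Γ c t 0 + pd 1 (ψ m) (c t) * acceleration Γ c t 1
        + 2 * (Υ 0 (c t) * deriv c t 0 + Υ 1 (c t) * deriv c t 1)
          * deriv (fun t m => ψ m (c t)) t m := by
  have h1 : deriv (fun t m => ψ m (c t)) =ᶠ[𝓝 t]
      fun t m => pd 0 (ψ m) (c t) * deriv c t 0 + pd 1 (ψ m) (c t) * deriv c t 1 :=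
    eventually_of_mem (isOpen_Ioo.mem_nhds ht) fun s hs => (hc.hasDerivAt_image hV hψ hs).deriv
  have hq := hc.mem t ht
  have d : ∀ k m, HasDerivAt (fun t => pd k (ψ m) (c t) * deriv c t k)
      ((pd 0 (pd k (ψ m)) (c t) * deriv c t 0 + pd 1 (pd k (ψ m)) (c t) * deriv c t 1) * deriv c t k
        + pd k (ψ m) (c t) * deriv (deriv c) t k) t := fun k m =>
    (hasDerivAt_comp_arc (diffAt hV (contDiffOn_pd hV (hψ m) k) hq) (hc.hasDerivAt ht)).fun_mul
      (hasDerivAt_apply (hc.hasDerivAt_deriv ht) k)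
  have h2 : HasDerivAt (deriv (fun t m => ψ m (c t))) _ t :=
    (hasDerivAt_pi.2 fun m => (d 0 m).fun_add (d 1 m)).congr_of_eventuallyEq h1
  rw [h2.deriv, h1.self_of_nhds]
  simp only [hΓ _ hq, acceleration, Fin.sum_univ_two]
  ring

end Arc

theorem IsDiagonal.liouville_eq_zero {Γ : Connection} {x y : Plane → ℝ} {U : Set Plane}
    (h : IsDiagonal Γ x y (fun _ => 0) (fun _ => 0) U) (hU : IsOpen U) (hΓ : IsTorsionFree Γ U)
    {p : Plane} (hp : p ∈ U) (i j k : Fin 2) : liouville Γ i j k p = 0 := by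
  rw [h.liouville_eq hU hΓ hp]
  simp [cx, cy, wedge, dif, pd_const]

/-! ### The linearizability criterion -/

/-- Near every point of a linearizable web there is a flat connection for which the web is
geodesic. -/
theorem IsLinearizable.exists_flat {d : ℕ} {θ : Fin d → OneForm} {U : Set Plane}
    (h : IsLinearizable θ U) {p : Plane} (hp : p ∈ U) :
    ∃ W, IsOpen W ∧ p ∈ W ∧ W ⊆ U ∧ ∃ Γ, IsTorsionFree Γ W ∧
      (∀ q ∈ W, ∀ i j k, liouville Γ i j k q = 0) ∧ ∀ i, IsGeodesicFoliation Γ (θ i) W := by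
  obtain ⟨φ, hpφ, hφU, hφ, hφ', hlin⟩ := h p hp
  have hW := φ.open_source
  set ψ : Fin 2 → Plane → ℝ := fun m q => φ q m with hψdef
  have hψ : ∀ m, ContDiffOn ℝ (⊤ : ℕ∞) (ψ m) φ.source := contDiffOn_pi.1 hφ
  have hw : ∀ q ∈ φ.source, wedge (dif (ψ 0) q) (dif (ψ 1) q) ≠ 0 := fun q hq =>
    wedge_dif_ne_zero_of_localDiffeo φ hφ hφ' hq
  -- With P = Q = 0 the coordinate differentials are parallel: this is the flat connection of the
  -- plane pulled back by φ.
  have hD := isDiagonal_diagonalConnection (hψ 0) (hψ 1) hw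
    (contDiffOn_const (c := (0 : ℝ))) (contDiffOn_const (c := (0 : ℝ)))
  have hT := isTorsionFree_diagonalConnection hW (hψ 0) (hψ 1) hw
    (contDiffOn_const (c := (0 : ℝ))) (contDiffOn_const (c := (0 : ℝ)))
  refine ⟨φ.source, hW, hpφ, hφU, _, hT, fun q hq => hD.liouville_eq_zero hW hT hq,
    fun i c a b hc t ht => ?_⟩
  have hγ := hc.arc.image hW hψ hw
  obtain ⟨μ, hμ⟩ := hγ.exists_smul_of_collinear (hlin i c a b hc) ht
  have hdd := hc.arc.deriv_deriv_image (Υ := fun _ _ => 0) hW hψ (fun q hq m i j => by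
    fin_cases m
    · simpa using hD.hessian_fst q hq i j
    · simpa using hD.hessian_snd q hq i j) ht
  have hd := (hc.arc.hasDerivAt_image hW hψ ht).deriv
  refine ⟨μ, sub_eq_zero.1 (eq_zero_of_pairing_eq_zero (hw _ (hc.arc.mem t ht)) ?_ ?_)⟩
  all_goals
    simp only [Pi.sub_apply, Pi.smul_apply, smul_eq_mul, dif]
  · have h1 := hdd 0
    rw [hμ, hd] at h1
    simp only [Pi.smul_apply, smul_eq_mul] at h1
    linear_combination -h1
  · have h1 := hdd 1
    rw [hμ, hd] at h1
    simp only [Pi.smul_apply, smul_eq_mul] at h1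
    linear_combination -h1

/-- Near p the flat connection of a linearization is projectively the canonical connection of the
chosen 4-subweb, by uniqueness. Both conclusions are pointwise, so the local comparison is enough.
-/
theorem IsLinearizable.leafCurvature_eq_zero {d : ℕ} {θ : Fin d → OneForm} {U : Set Plane}
    (hθ : IsWeb θ U) (h : IsLinearizable θ U) (s : Fin 4 ↪ Fin d) (hd : 4 ≤ d)
    {p : Plane} (hp : p ∈ U) :
    (∀ i, leafCurvature (canonicalConnection fun i => θ (s i)) (θ i) p = 0) ∧
      ∀ i j k, webLiouville (fun i => θ (s i)) i j k p = 0 := by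
  obtain ⟨W, hW, hpW, hWU, Γ, hΓ, hL, hg⟩ := h.exists_flat hp
  have hs := (hθ.subweb s).mono hWU
  have hθW := hθ.mono hWU
  have hR := projRel_canonicalConnection hs hW hΓ fun i => hg (s i)
  refine ⟨fun i => ?_, fun i j k => ?_⟩
  · rw [← leafCurvature_projRel hR (θ i) hpW]
    exact (isGeodesicFoliation_iff hW (hθW.smooth i) (hθW.ne_zero (by omega) i)).1 (hg i) p hpW
  · rw [webLiouville, ← liouville_projRel hW (canonicalConnection_mem hW hs).1 hR hpW, hL p hpW]

/-- After passing to the trace-free representative, flat coordinates turn geodesic leaves into arcs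
with tangent acceleration, which lie on lines. -/
theorem isLinearizable_of_liouville_eq_zero {d : ℕ} (hd : 2 ≤ d) {θ : Fin d → OneForm}
    {U : Set Plane} (hU : IsOpen U) (hθ : IsWeb θ U) {Γ : Connection} (hΓ : IsTorsionFree Γ U)
    (hg : ∀ i, IsGeodesicFoliation Γ (θ i) U) (hL : ∀ p ∈ U, ∀ i j k, liouville Γ i j k p = 0) :
    IsLinearizable θ U := by
  intro p hp
  obtain ⟨Γ', hR, htr⟩ := exists_projRel_trace_eq_zero hΓ
  have hΓ' := hR.isTorsionFree hΓ
  obtain ⟨V, hV, hpV, hVU, ψ, Υ, hψ, hw, hH⟩ := exists_flat_coordinates hU hΓ' htr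
    (fun q hq i j k => by rw [liouville_projRel hU hΓ hR hq, hL q hq]) hp
  obtain ⟨φ, hpφ, hφV, hφ, hs, hs'⟩ := exists_localDiffeo hV hψ hw hpV
  refine ⟨φ, hpφ, hφV.trans hVU, hs, hs', fun i c a b hc => ?_⟩
  have hcV : IsRegularArc V c a b := ⟨hc.arc.smooth, fun t ht => hφV (hc.arc.mem t ht),
    hc.arc.regular⟩
  have hcU : IsLeafArc (θ i) U c a b := ⟨⟨hcV.smooth, fun t ht => hVU (hcV.mem t ht),
    hcV.regular⟩, hc.tangent⟩
  have hne := hθ.ne_zero hd i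
  have hg' : IsGeodesicFoliation Γ' (θ i) U := (isGeodesicFoliation_iff hU (hθ.smooth i) hne).2
    fun q hq => by
      rw [leafCurvature_projRel hR _ hq]
      exact (isGeodesicFoliation_iff hU (hθ.smooth i) hne).1 (hg i) q hq
  simp only [hφ]
  refine (hcV.image hV hψ hw).collinear fun t ht => ?_
  obtain ⟨μ, hμ⟩ := hg' c a b hcU t ht
  refine ⟨μ + 2 * (Υ 0 (c t) * deriv c t 0 + Υ 1 (c t) * deriv c t 1), ?_⟩
  funext m
  rw [hcV.deriv_deriv_image hV hψ hH ht, hμ, Pi.smul_apply, Pi.smul_apply, Pi.smul_apply,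
    (hcV.hasDerivAt_image hV hψ ht).deriv]
  simp only [smul_eq_mul]
  ring

/-- A web is linearizable if and only if it is geodesic for the canonical projective structure of
a 4-subweb and the Liouville tensor of a 4-subweb vanishes. -/
theorem isLinearizable_iff {d : ℕ} (hd : 4 ≤ d) {U : Set Plane} (hU : IsOpen U)
    {θ : Fin d → OneForm} (hθ : IsWeb θ U) :
    IsLinearizable θ U ↔
      (∃ s : Fin 4 ↪ Fin d,
        IsGeodesicWeb (canonicalProjectiveStructure (fun i => θ (s i)) U) θ U) ∧
      (∃ s : Fin 4 ↪ Fin d,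
        ∀ p ∈ U, ∀ i j k, webLiouville (fun i => θ (s i)) i j k p = 0) := by
  refine ⟨fun h => ⟨⟨Fin.castLEEmb hd, _, canonicalConnection_mem hU (hθ.subweb _), fun i => ?_⟩,
    ⟨Fin.castLEEmb hd, fun p hp => (h.leafCurvature_eq_zero hθ _ hd hp).2⟩⟩, ?_⟩
  · exact (isGeodesicFoliation_iff hU (hθ.smooth i) (hθ.ne_zero (by omega) i)).2
      fun p hp => (h.leafCurvature_eq_zero hθ _ hd hp).1 i
  · rintro ⟨⟨s, Γ, hΓ, hg⟩, s', hL⟩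
    -- The two 4-subwebs may differ. Since Γ makes all d foliations geodesic, it also belongs to the
    -- canonical structure of the second one, so its own Liouville tensor vanishes.
    refine isLinearizable_of_liouville_eq_zero (by omega) hU hθ hΓ.1 hg fun p hp i j k => ?_
    have hs' := hθ.subweb s'
    rw [liouville_projRel hU (canonicalConnection_mem hU hs').1
      (projRel_canonicalConnection hs' hU hΓ.1 fun i => hg (s' i)) hp]
    exact hL p hp i j k

/-! ### The Liouville tensor in adapted coordinates -/

theorem isGeodesicFoliation_of_mem {θ : Fin 4 → OneForm} {V : Set Plane} (hV : IsOpen V)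
    (hθ : IsWeb θ V) {Γ : Connection} (hΓ : Γ ∈ canonicalProjectiveStructure θ V) (i : Fin 4) :
    IsGeodesicFoliation Γ (θ i) V := fun c a b hc =>
  (hΓ.2 c a b hc.arc).2 (canonicalConnection_isGeodesic hθ hV i c a b hc)

end PlanarWeb

end

theorem theorem9 (d : ℕ) (hd : 4 ≤ d) (U : Set Plane) (hU : IsOpen U)
    (θ : Fin d → OneForm) (hθ : IsWeb θ U) :
    (IsLinearizable θ U ↔
      (∃ s : Fin 4 ↪ Fin d,
        IsGeodesicWeb (canonicalProjectiveStructure (fun i => θ (s i)) U) θ U) ∧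
      (∃ s : Fin 4 ↪ Fin d,
        ∀ p ∈ U, ∀ i j k, webLiouville (fun i => θ (s i)) i j k p = 0)) ∧
    (∀ (s : Fin 4 ↪ Fin d) (V : Set Plane), IsOpen V → V ⊆ U →
      ∀ (x y f g : Plane → ℝ),
        IsWebFunction (θ (s 0)) x V → IsWebFunction (θ (s 1)) y V →
        IsWebFunction (θ (s 2)) f V → IsWebFunction (θ (s 3)) g V →
        ∀ Γ ∈ canonicalProjectiveStructure (fun i => θ (s i)) V,
        ∀ p ∈ V,
          let ω₁ : Fin 2 → ℝ := -cx x y f p • dif x p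
          let ω₂ : Fin 2 → ℝ := -cy x y f p • dif y p
          ∀ i j k,
            cx x y f p ^ 2 * cy x y f p * liouville Γ i j k p =
              (liouvilleL1 x y f g p * ω₁ k + liouvilleL2 x y f g p / wInv x y f p * ω₂ k) *
                (ω₁ i * ω₂ j - ω₁ j * ω₂ i)) := by
  refine ⟨isLinearizable_iff hd hU hθ, ?_⟩
  intro s V hV hVU x y f g hx hy hf hg Γ hΓ p hp ω₁ ω₂ i j k
  have hs := (hθ.subweb s).mono hVU
  have hL := liouville_formula hV hs hx hy hf hg hΓ.1 (isGeodesicFoliation_of_mem hV hs hΓ) hp i j k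
  have gp : ∀ i j, i ≠ j → ∀ q ∈ V, wedge (θ (s i) q) (θ (s j) q) ≠ 0 := fun i j hij q hq =>
    hs.generalPosition q hq i j hij
  have hw := hx.wedge_dif_ne_zero hy (gp 0 1 (by decide)) p hp
  have hcx : cx x y f p ≠ 0 := div_ne_zero (hf.wedge_dif_ne_zero hy (gp 2 1 (by decide)) p hp) hw
  have hcy : cy x y f p ≠ 0 := div_ne_zero (hx.wedge_dif_ne_zero hf (gp 0 2 (by decide)) p hp) hw
  -- As f_y = w f_x, the 1-form L₁ω₁ + (L₂/w)ω₂ equals -f_x(L₁dx + L₂dy), while ω₁∧ω₂ = f_x f_y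
  -- dx∧dy; this accounts for the factor f_x² f_y and for the sign.
  rw [hL]
  simp only [ω₁, ω₂, wInv, Pi.smul_apply, smul_eq_mul, dif]
  field_simp
  ring
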